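/- **Conventions.** Principal branches are used for all logarithms and powers, and $\mathrm{Li}_2(z)=-\int_0^z\frac{\ln(1-u)}{u}\,du$ on $\mathbb C\setminus[1,\infty)$. For $b>0$ let $Q=b+b^{-1}$ and, for $|\operatorname{Im}z|<Q/2$, $$s_b(z)=\exp\Big[i\int_0^\infty\Big(\frac{\sin 2yz}{2\sinh(b^{-1}y)\sinh(by)}-\frac zy\Big)\frac{dy}{y}\Big].$$ For real $\sigma_s,\mu$ let $$\mathcal Q(b,\sigma_s,\mu)=e^{i\pi\left(\frac16+\frac{7Q^2}{24}-\frac{\mu^2}{2}+i\mu Q-\sigma_s^2\right)}s_b(\mu)\int_{\mathbb R+ih}e^{-i\pi x^2}e^{2\pi i x\left(\mu-\frac{iQ}{2}\right)}s_b(x+\sigma_s)\,s_b(x-\sigma_s)\,dx ,$$ where $h$ is any real number with $-Q/2<h<-Q/4$ (the value does not depend on $h$). **Painlevé III$_3$ generating function.** Let $\arcsin z=-i\ln(\sqrt{1-z^2}+iz)$, $\eta(\sigma,\nu)=\frac1{2\pi}\arcsin(e^{\pi\nu}\sin 2\pi\sigma)$ and $$8\pi^2W(\sigma,\nu)=\mathrm{Li}_2\big(-e^{2\pi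 i(\sigma+\eta-\frac{i\nu}{2})}\big)+\mathrm{Li}_2\big(-e^{-2\pi i(\sigma+\eta+\frac{i\nu}{2})}\big)-(2\pi\eta)^2+(\pi\nu)^2,$$ with principal branches, on the real region $0<\eta<\sigma<\frac14$, $\nu<0$. Let $U\subset\mathbb C^2$ be the connected component containing $(\frac18,-1)$ of the set of $(\sigma,\nu)$ for which $e^{\pi\nu}\sin 2\pi\sigma\notin(-\infty,-1]\cup[1,\infty)$ and neither of the two arguments of $\mathrm{Li}_2$ above (formed with the principal $\eta$) lies in $[1,\infty)$. The function $W$ is extended from that real region to $U$ by analytic continuation. **Theorem.** (1) For all real $\sigma_s,\mu$ with $e^{2\pi\mu}>\sinh^2(2\pi\sigma_s)$, $$\mathcal Q\Big(b,\frac{\sigma_s}b,\frac{\mu}b\Big)=\frac{e^{\pi i/4}}{\sqrt2\,(e^{2\pi\mu}-\sinh^2(2\pi\sigma_s))^{1/4}}\;e^{f_{\mathcal Q}(\sigma_s,\mu)/b^2}\,(1+O(b))\qquad\text{as } b\to0^+,$$ where, with $z=\cosh(2\pi\sigma_s)+i\sqrt{e^{2\pi\mu}-\sinh^2(2\pi\sigma_s)}$,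 $$f_{\mathcal Q}(\sigma_s,\mu)=-\frac{\mathrm{Li}_2(-e^{2\pi\mu})+\mathrm{Li}_2(e^{-2\pi\sigma_s}z)+\mathrm{Li}_2(e^{2\pi\sigma_s}z)}{2\pi i}+\Big(\frac12+i\mu\Big)\ln(-z)-\pi\mu+\frac{5\pi i}{12}.$$ (2) The analytic continuation $W$ exists on $U$, and for all real $\sigma_s,\mu$ with $e^{2\pi\mu}>\sinh^2(2\pi\sigma_s)$ the point $(i\sigma_s,-\mu-\frac i2)$ lies in $U$ and $$f_{\mathcal Q}(\sigma_s,\mu)=4\pi i\,W\Big(i\sigma_s,-\mu-\frac i2\Big)-\frac{\mathrm{Li}_2(-e^{2\pi\mu})}{2\pi i}-2\pi i\sigma_s^2+\frac{\pi i}4 .$$ -/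

import Mathlib

open scoped Topology

noncomputable section

namespace HyperbolicQ

/-- The principal dilogarithm on `ℂ ∖ [1, ∞)`: minus the integral of `log (1 - u) / u` from `0`
to `z` along the segment `u = t z`, `0 ≤ t ≤ 1` (so that `du / u = dt / t`). -/
def dilog (z : ℂ) : ℂ :=
  -∫ t in (0 : ℝ)..1, Complex.log (1 - (t : ℂ) * z) / (t : ℂ)

/-- `Q = b + b⁻¹`. -/
def bigQ (b : ℝ) : ℝ := b + b⁻¹

/-- The hyperbolic gamma function `s_b z` for `|im z| < Q / 2`, where the integral converges. -/
def sb (b : ℝ) (z : ℂ) : ℂ :=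
  Complex.exp (Complex.I * ∫ y in Set.Ioi (0 : ℝ),
    (Complex.sin (2 * (y : ℂ) * z) / (2 * (Real.sinh (b⁻¹ * y) : ℂ) * (Real.sinh (b * y) : ℂ))
      - z / (y : ℂ)) / (y : ℂ))

/-- The prefactor of the integral representation of `𝒬`. -/
def prefactorQ (b σ μ : ℝ) : ℂ :=
  Complex.exp (Complex.I * Real.pi *
    (1 / 6 + 7 * (bigQ b : ℂ) ^ 2 / 24 - (μ : ℂ) ^ 2 / 2
      + Complex.I * (μ : ℂ) * (bigQ b : ℂ) - (σ : ℂ) ^ 2)) * sb b (μ : ℂ)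

/-- The integrand of the integral representation of `𝒬`. -/
def integrandQ (b σ μ : ℝ) (x : ℂ) : ℂ :=
  Complex.exp (-(Complex.I * Real.pi * x ^ 2)) *
    Complex.exp (2 * Complex.I * Real.pi * x * ((μ : ℂ) - Complex.I * (bigQ b : ℂ) / 2)) *
    sb b (x + (σ : ℂ)) * sb b (x - (σ : ℂ))

/-- The function `𝒬(b, σ, μ)` for real `σ, μ`, computed with the horizontal contour
`x = t + i h`, `t ∈ ℝ`. The contour is admissible when `-Q / 2 < h < -Q / 4`. -/
def calQ (h b σ μ : ℝ) : ℂ :=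
  prefactorQ b σ μ * ∫ t : ℝ, integrandQ b σ μ ((t : ℂ) + Complex.I * (h : ℂ))

/-- `e^{2πμ} - sinh²(2πσ)`. -/
def disc (σ μ : ℝ) : ℝ := Real.exp (2 * Real.pi * μ) - Real.sinh (2 * Real.pi * σ) ^ 2

/-- `cosh(2πσ) + i √(e^{2πμ} - sinh²(2πσ))`. -/
def saddle (σ μ : ℝ) : ℂ :=
  (Real.cosh (2 * Real.pi * σ) : ℂ) + Complex.I * (Real.sqrt (disc σ μ) : ℂ)

/-- The exponent `f_𝒬(σ, μ)`. -/
def fQ (σ μ : ℝ) : ℂ :=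
  -(dilog (-(Real.exp (2 * Real.pi * μ) : ℂ)) / (2 * Real.pi * Complex.I))
  - dilog ((Real.exp (-2 * Real.pi * σ) : ℂ) * saddle σ μ) / (2 * Real.pi * Complex.I)
  - dilog ((Real.exp (2 * Real.pi * σ) : ℂ) * saddle σ μ) / (2 * Real.pi * Complex.I)
  + (1 / 2 + Complex.I * (μ : ℂ)) * Complex.log (-saddle σ μ)
  - Real.pi * (μ : ℂ) + 5 * Real.pi * Complex.I / 12

/-- The principal complex arcsine `-i log(√(1 - z²) + i z)`, analytic off
`(-∞, -1] ∪ [1, ∞)`. -/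
def carcsin (z : ℂ) : ℂ :=
  -Complex.I * Complex.log ((1 - z ^ 2) ^ (1 / 2 : ℂ) + Complex.I * z)

/-- The argument `e^{πν} sin(2πσ)` of the arcsine in `η(σ, ν)`. -/
def sineArg (p : ℂ × ℂ) : ℂ :=
  Complex.exp (Real.pi * p.2) * Complex.sin (2 * Real.pi * p.1)

/-- `η(σ, ν)`, with the principal arcsine. -/
def eta (p : ℂ × ℂ) : ℂ := 1 / (2 * Real.pi) * carcsin (sineArg p)

/-- The argument of the first dilogarithm, `-e^{2πi(σ + η - iν/2)}`. -/
def dilogArg₁ (p : ℂ × ℂ) : ℂ :=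
  -Complex.exp (2 * Complex.I * Real.pi * (p.1 + eta p - Complex.I * p.2 / 2))

/-- The argument of the second dilogarithm, `-e^{-2πi(σ + η + iν/2)}`. -/
def dilogArg₂ (p : ℂ × ℂ) : ℂ :=
  -Complex.exp (-(2 * Complex.I * Real.pi * (p.1 + eta p + Complex.I * p.2 / 2)))

/-- The explicit formula for `W(σ, ν)` with principal branches everywhere. -/
def principalW (p : ℂ × ℂ) : ℂ :=
  (dilog (dilogArg₁ p) + dilog (dilogArg₂ p)
    - (2 * Real.pi * eta p) ^ 2 + (Real.pi * p.2) ^ 2) / (8 * Real.pi ^ 2)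

/-- The real region `0 < η < σ < 1/4`, `ν < 0` on which `W` is given by the principal branches. -/
def baseRegion : Set (ℂ × ℂ) :=
  {p | ∃ σ ν η : ℝ, p = ((σ : ℂ), (ν : ℂ)) ∧ eta p = (η : ℂ) ∧
    0 < η ∧ η < σ ∧ σ < 1 / 4 ∧ ν < 0}

/-- The points at which no branch cut is met: the argument of the arcsine is outside
`(-∞, -1] ∪ [1, ∞)` and the arguments of the dilogarithms are outside `[1, ∞)`
(`Complex.slitPlane` is `ℂ ∖ (-∞, 0]`). -/
def cutFree : Set (ℂ × ℂ) :=
  {p | 1 - sineArg p ∈ Complex.slitPlane ∧ 1 + sineArg p ∈ Complex.slitPlane ∧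
    1 - dilogArg₁ p ∈ Complex.slitPlane ∧ 1 - dilogArg₂ p ∈ Complex.slitPlane}

/-- The domain over which `W` is continued from the base region without crossing a branch cut:
the connected component of the cut-free set around the point `(1/8, -1)` of the base region. -/
def domainW : Set (ℂ × ℂ) := connectedComponentIn cutFree ((1 / 8 : ℂ), (-1 : ℂ))

/-- `W` is the Painlevé III₃ generating function on `domainW`: it is given by the explicit formula
with principal branches on the base region and continues it analytically to `domainW`. -/
structure IsPIII3GeneratingFunction (W : ℂ × ℂ → ℂ) : Prop where
  eq_on_base : Set.EqOn W principalW baseRegion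
  analytic : AnalyticOnNhd ℂ W domainW

end HyperbolicQ

end

/-! Put `x = X / b` and `β = b ^ 2`. Then `sb b (z / b)` is `exp (i T_β(z) / β)`, where `T_β` is the
`transform` of the kernel `kern β`, and `kern β` differs from `kernZero` by a relative error `β²
y²`. So the integrand is `exp (phase / b²)` times a harmless factor. The limit `T_0` is explicit:
expanding `1 / sinh` and summing the partial fractions of the tangent gives `T_0'' = -π tanh (πz)`,
and integrating twice gives a dilogarithm (`I_mul_transform_kernZero`).

The derivative of `phase` vanishes when `z = -e^{2πX}` solves `z² - 2 cosh(2πσ) z + 1 + e^{2πμ} =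
0`. Under the hypothesis the roots are not real. The root `saddle` lies in the open first quadrant,
so the saddle point has imaginary part strictly between `-1/2` and `-1/4`, and for small `b` the
horizontal line through it is an admissible contour. On this line the real part of `phase` is
concave, so the saddle is its global maximum and no steepest descent path is needed:
`laplace_method` gives the Gaussian value with relative error `O(b)`. Moving the contour to this
line uses Cauchy's theorem and the growth of `im T_β`, which is `-π |t| im z` up to a bounded error.

For part (2), the principal formula is analytic on `cutFree`, which gives existence. A continuation
is determined by its values near the real point `(1/8, -1)`, by the identity theorem in each
variable in turn. The points `(iσ, -μ - i/2)` are joined to the base point by letting `μ` increase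
until the convex set `smallRegion` is reached. At these points the two dilogarithm arguments are `(1
- A)⁻¹` with `A = e^{±2πσ} z`, and the order three relation `dilog_inv_one_sub` turns them into the
dilogarithms of `fQ`; the logarithms are explicit by the polar forms of `1 - A`. -/

namespace HyperbolicQ

open Set Filter MeasureTheory

/-! ### The dilogarithm on the cut plane -/

theorem one_sub_mul_mem_slitPlane {z : ℂ} (hz : 1 - z ∈ Complex.slitPlane) {t : ℝ}
    (ht0 : 0 ≤ t) (ht1 : t ≤ 1) : 1 - (t : ℂ) * z ∈ Complex.slitPlane := by
  have h := StarConvex.add_smul_mem Complex.starConvex_one_slitPlane (y := -z)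
    (by rwa [← sub_eq_add_neg]) ht0 ht1
  simpa [sub_eq_add_neg] using h

theorem isOpen_one_sub_mem_slitPlane : IsOpen {z : ℂ | 1 - z ∈ Complex.slitPlane} :=
  Complex.isOpen_slitPlane.preimage (continuous_const.sub continuous_id)

/-- The singularity at `t = 0` is removable: for `t ≠ 0` the integrand is `z` times the difference
quotient of `log (1 - w)` at `0`, and `dslope` extends this quotient holomorphically. -/
theorem intervalIntegrable_dilog {z : ℂ} (hz : 1 - z ∈ Complex.slitPlane) :
    IntervalIntegrable (fun t : ℝ => Complex.log (1 - (t : ℂ) * z) / (t : ℂ)) volume 0 1 := by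
  have hd : DifferentiableOn ℂ (dslope (fun w : ℂ => Complex.log (1 - w)) 0)
      {z : ℂ | 1 - z ∈ Complex.slitPlane} := by
    refine (Complex.differentiableOn_dslope
      (isOpen_one_sub_mem_slitPlane.mem_nhds (by simp))).2 fun w hw => ?_
    exact ((differentiableAt_id.const_sub 1).clog hw).differentiableWithinAt
  have hc : ContinuousOn (fun t : ℝ => z * dslope (fun w : ℂ => Complex.log (1 - w)) 0 (t * z))
      (uIcc 0 1) := by
    refine continuousOn_const.mul (hd.continuousOn.comp (by fun_prop) fun t ht => ?_)
    rw [uIcc_of_le zero_le_one] at ht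
    exact one_sub_mul_mem_slitPlane hz ht.1 ht.2
  refine hc.intervalIntegrable.congr_ae ?_
  refine (ae_restrict_iff' measurableSet_uIoc).2 (ae_of_all _ fun t ht => ?_)
  rw [uIoc_of_le zero_le_one] at ht
  have ht0 : (t : ℂ) ≠ 0 := by exact_mod_cast ht.1.ne'
  rcases eq_or_ne z 0 with rfl | hz0
  · simp
  · simp only
    rw [dslope_of_ne _ (mul_ne_zero ht0 hz0), slope_def_field]
    simp
    field_simp

/-- Differentiating in `z` cancels the factor `1 / t`. The derivative is left as an integral so that
it also covers `z = 0`, whence analyticity on the whole cut plane. -/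
theorem hasDerivAt_dilog_integral {z : ℂ} (hz : 1 - z ∈ Complex.slitPlane) :
    HasDerivAt dilog (∫ t in (0 : ℝ)..1, (1 - (t : ℂ) * z)⁻¹) z := by
  obtain ⟨r, hr, hball⟩ := Metric.nhds_basis_closedBall.mem_iff.1
    (isOpen_one_sub_mem_slitPlane.mem_nhds hz)
  have hne : ∀ p ∈ Icc (0 : ℝ) 1 ×ˢ Metric.closedBall z r, 1 - (p.1 : ℂ) * p.2 ≠ 0 :=
    fun p hp => Complex.slitPlane_ne_zero
      (one_sub_mul_mem_slitPlane (hball hp.2) hp.1.1 hp.1.2)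
  obtain ⟨C, hC⟩ := (isCompact_Icc.prod (isCompact_closedBall z r)).exists_bound_of_continuousOn
    (f := fun p : ℝ × ℂ => (1 - (p.1 : ℂ) * p.2)⁻¹)
    (ContinuousOn.inv₀ (by fun_prop) hne)
  have hmeas : ∀ᶠ x in 𝓝 z, AEStronglyMeasurable
      (fun t : ℝ => Complex.log (1 - (t : ℂ) * x) / (t : ℂ)) (volume.restrict (uIoc 0 1)) := by
    filter_upwards [Metric.closedBall_mem_nhds z hr] with x hx
    have := intervalIntegrable_dilog (hball hx)
    rw [intervalIntegrable_iff] at this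
    exact this.aestronglyMeasurable
  have key := intervalIntegral.hasDerivAt_integral_of_dominated_loc_of_deriv_le
    (F := fun (x : ℂ) (t : ℝ) => Complex.log (1 - (t : ℂ) * x) / (t : ℂ))
    (F' := fun (x : ℂ) (t : ℝ) => -(1 - (t : ℂ) * x)⁻¹) (bound := fun _ => C)
    (a := 0) (b := 1) (μ := volume)
    (Metric.closedBall_mem_nhds z hr) hmeas (intervalIntegrable_dilog hz) ?_ ?_ ?_ ?_
  · have h := key.2.neg
    rw [intervalIntegral.integral_neg, neg_neg] at h
    exact h
  · refine ContinuousOn.aestronglyMeasurable (ContinuousOn.neg (ContinuousOn.inv₀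
      (by fun_prop) fun t ht => ?_)) measurableSet_uIoc
    rw [uIoc_of_le zero_le_one] at ht
    exact hne (t, z) ⟨⟨ht.1.le, ht.2⟩, Metric.mem_closedBall_self hr.le⟩
  · refine ae_of_all _ fun t ht x hx => ?_
    rw [uIoc_of_le zero_le_one] at ht
    rw [norm_neg]
    exact hC (t, x) ⟨⟨ht.1.le, ht.2⟩, hx⟩
  · exact intervalIntegrable_const
  · refine ae_of_all _ fun t ht x hx => ?_
    rw [uIoc_of_le zero_le_one] at ht
    have ht0 : (t : ℂ) ≠ 0 := by exact_mod_cast ht.1.ne'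
    have h1 := (((hasDerivAt_id x).const_mul (t : ℂ)).const_sub 1).clog
      (one_sub_mul_mem_slitPlane (hball hx) ht.1.le ht.2)
    refine (h1.div_const (t : ℂ)).congr_deriv ?_
    simp only [id, mul_one]
    field_simp

theorem hasDerivAt_dilog {z : ℂ} (hz : 1 - z ∈ Complex.slitPlane) (hz0 : z ≠ 0) :
    HasDerivAt dilog (-Complex.log (1 - z) / z) z := by
  refine (hasDerivAt_dilog_integral hz).congr_deriv ?_
  have h : ∀ t ∈ uIcc (0 : ℝ) 1, HasDerivAt (fun t : ℝ => -Complex.log (1 - (t : ℂ) * z) / z)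
      (1 - (t : ℂ) * z)⁻¹ t := by
    intro t ht
    rw [uIcc_of_le zero_le_one] at ht
    have h1 := (((Complex.ofRealCLM.hasDerivAt (x := t)).mul_const z).const_sub 1).clog_real
      (one_sub_mul_mem_slitPlane hz ht.1 ht.2)
    have hne := Complex.slitPlane_ne_zero (one_sub_mul_mem_slitPlane hz ht.1 ht.2)
    refine (h1.neg.div_const z).congr_deriv ?_
    simp
    field_simp
  rw [intervalIntegral.integral_eq_sub_of_hasDerivAt h]
  · simp
  · refine (ContinuousOn.inv₀ (by fun_prop) fun t ht => ?_).intervalIntegrable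
    rw [uIcc_of_le zero_le_one] at ht
    exact Complex.slitPlane_ne_zero (one_sub_mul_mem_slitPlane hz ht.1 ht.2)

theorem analyticAt_dilog {z : ℂ} (hz : 1 - z ∈ Complex.slitPlane) : AnalyticAt ℂ dilog z :=
  DifferentiableOn.analyticAt (s := {z : ℂ | 1 - z ∈ Complex.slitPlane})
    (fun _ hw => (hasDerivAt_dilog_integral hw).differentiableAt.differentiableWithinAt)
    (isOpen_one_sub_mem_slitPlane.mem_nhds hz)

/-- The Fourier series of the second Bernoulli polynomial at `1/2` gives the alternating sum of `1 /
n²`; the integral of `log (1 + t) / t` is the same series, integrated term by term. -/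
theorem dilog_neg_one : dilog (-1) = -(Real.pi : ℂ) ^ 2 / 12 := by
  have hsum : HasSum (fun n : ℕ => (-1 : ℝ) ^ n / (n : ℝ) ^ 2) (-Real.pi ^ 2 / 12) := by
    have h := hasSum_one_div_nat_pow_mul_cos (k := 1) one_ne_zero (x := 1 / 2) (by norm_num)
    have h2 : (Polynomial.map (algebraMap ℚ ℝ) (Polynomial.bernoulli 2)).eval (1 / 2 : ℝ)
        = -1 / 12 := by
      simp [Polynomial.bernoulli, Finset.sum_range_succ, bernoulli, bernoulli'_two]
      norm_num
    rw [mul_one, h2] at h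
    convert h using 1
    · funext n
      have : 2 * Real.pi * (n : ℝ) * (1 / 2) = n * Real.pi := by ring
      rw [this, Real.cos_nat_mul_pi]
      ring
    · norm_num
      ring
  have hC := (hasSum_integral_of_summable_integral_norm (μ := volume.restrict (Ioc (0 : ℝ) 1))
    (F := fun (n : ℕ) (t : ℝ) => (((-1) ^ (n + 2) * t ^ n / (n + 1) : ℝ) : ℂ)) ?_ ?_)
  · have e1 : ∀ n : ℕ, (∫ t in Ioc (0 : ℝ) 1, (((-1) ^ (n + 2) * t ^ n / (n + 1) : ℝ) : ℂ))
        = -(((-1) ^ (n + 1) / ((n + 1 : ℕ) : ℝ) ^ 2 : ℝ) : ℂ) := by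
      intro n
      rw [integral_complex_ofReal, ← intervalIntegral.integral_of_le zero_le_one]
      rw [intervalIntegral.integral_div, intervalIntegral.integral_const_mul, integral_pow]
      rw [← Complex.ofReal_neg]
      congr 1
      push_cast
      field_simp
      ring
    have hs2 : HasSum (fun n : ℕ => -(((-1) ^ (n + 1) / ((n + 1 : ℕ) : ℝ) ^ 2 : ℝ) : ℂ))
        (-((-Real.pi ^ 2 / 12 : ℝ) : ℂ)) := by
      refine HasSum.neg (Complex.hasSum_ofReal.2 ?_)
      -- The term `n = 0` is dropped; it vanishes since `1 / 0 = 0`.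
      have := (hasSum_nat_add_iff' 1).2 hsum
      simpa using this
    simp only [e1] at hC
    have hI := hC.unique hs2
    unfold dilog
    rw [intervalIntegral.integral_of_le zero_le_one]
    rw [show (-(Real.pi : ℂ) ^ 2 / 12) = -(-((-Real.pi ^ 2 / 12 : ℝ) : ℂ)) by push_cast; ring, ← hI]
    congr 1
    -- The logarithmic series is used for `|t| < 1` only, so the endpoint is discarded.
    have hae : ∀ᵐ t : ℝ, t ≠ 1 := Measure.ae_ne volume 1
    refine setIntegral_congr_ae measurableSet_Ioc ?_
    filter_upwards [hae] with t ht1 ht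
    have htlt : |t| < 1 := by rw [abs_of_pos ht.1]; exact lt_of_le_of_ne ht.2 ht1
    have hl := Real.hasSum_pow_div_log_of_abs_lt_one (x := -t) (by rwa [abs_neg])
    have h3 : HasSum (fun n : ℕ => (((-1) ^ (n + 2) * t ^ n / (n + 1) : ℝ) : ℂ))
        ((Real.log (1 + t) / t : ℝ) : ℂ) := by
      refine Complex.hasSum_ofReal.2 ?_
      have h4 := (hl.neg).div_const t
      rw [neg_neg, sub_neg_eq_add] at h4
      refine h4.congr_fun fun n => ?_
      have := ht.1.ne'
      field_simp
      rw [neg_pow]; ring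
    rw [h3.tsum_eq]
    rw [show (1 - (t : ℂ) * (-1)) = ((1 + t : ℝ) : ℂ) by push_cast; ring,
      ← Complex.ofReal_log (by linarith [ht.1])]
    push_cast; rfl
  · intro n
    refine (Continuous.integrableOn_Icc (by fun_prop)).mono_set Ioc_subset_Icc_self
  · have e2 : ∀ n : ℕ, (∫ t in Ioc (0 : ℝ) 1, ‖(((-1) ^ (n + 2) * t ^ n / (n + 1) : ℝ) : ℂ)‖)
        = 1 / ((n + 1 : ℕ) : ℝ) ^ 2 := by
      intro n
      rw [setIntegral_congr_fun (g := fun t : ℝ => t ^ n / (n + 1)) measurableSet_Ioc]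
      · rw [← intervalIntegral.integral_of_le zero_le_one, intervalIntegral.integral_div,
          integral_pow]
        push_cast
        field_simp
        simp
      · intro t ht
        simp only [Complex.norm_real, norm_div, norm_mul, norm_pow, norm_neg, norm_one, one_pow,
          one_mul, Real.norm_eq_abs, abs_of_pos ht.1]
        congr 1
        exact abs_of_pos (by positivity)
    simp only [e2]
    exact (summable_nat_add_iff 1).2 (Real.summable_one_div_nat_pow.2 one_lt_two)

end HyperbolicQ

/-! ### The order three relation of the dilogarithm -/

namespace HyperbolicQ

open Set Filter MeasureTheory

theorem norm_cos_le (w : ℂ) : ‖Complex.cos w‖ ≤ Real.exp |w.im| := by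
  have h1 : ‖Complex.exp (w * Complex.I)‖ ≤ Real.exp |w.im| := by
    rw [Complex.norm_exp]; simpa using neg_le_abs w.im
  have h2 : ‖Complex.exp (-w * Complex.I)‖ ≤ Real.exp |w.im| := by
    rw [Complex.norm_exp]; simpa using le_abs_self w.im
  rw [Complex.cos, norm_div, Complex.norm_ofNat, div_le_iff₀ two_pos]
  linarith [norm_add_le (Complex.exp (w * Complex.I)) (Complex.exp (-w * Complex.I))]

theorem norm_sin_le (w : ℂ) : ‖Complex.sin w‖ ≤ Real.exp |w.im| := by
  have h1 : ‖Complex.exp (w * Complex.I)‖ ≤ Real.exp |w.im| := by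
    rw [Complex.norm_exp]; simpa using neg_le_abs w.im
  have h2 : ‖Complex.exp (-w * Complex.I)‖ ≤ Real.exp |w.im| := by
    rw [Complex.norm_exp]; simpa using le_abs_self w.im
  rw [Complex.sin, norm_div, norm_mul, Complex.norm_I, mul_one, Complex.norm_ofNat,
    div_le_iff₀ two_pos]
  linarith [norm_sub_le (Complex.exp (-w * Complex.I)) (Complex.exp (w * Complex.I))]

theorem arg_mem_Ioo_of_im_pos {z : ℂ} (hz : 0 < z.im) : z.arg ∈ Ioo 0 Real.pi := by
  refine ⟨lt_of_le_of_ne (Complex.arg_nonneg_iff.2 hz.le) fun h => ?_,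
    Complex.arg_lt_pi_iff.2 (Or.inr hz.ne')⟩
  exact hz.ne' (Complex.arg_eq_zero_iff.1 h.symm).2

/-- Both arguments lie in `(0, π)`, so their difference stays in `(-π, π)`. -/
theorem log_sub_log_of_im_pos {v w : ℂ} (hv : 0 < v.im) (hw : 0 < w.im) :
    Complex.log (v / w) = Complex.log v - Complex.log w := by
  have hv0 : v ≠ 0 := fun h => by simp [h] at hv
  have hw0 : w ≠ 0 := fun h => by simp [h] at hw
  have hlv := (arg_mem_Ioo_of_im_pos hv)
  have hlw := (arg_mem_Ioo_of_im_pos hw)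
  rw [← Complex.log_exp (x := Complex.log v - Complex.log w), Complex.exp_sub, Complex.exp_log hv0,
    Complex.exp_log hw0]
  · simp only [Complex.sub_im, Complex.log_im]; linarith [hlv.1, hlw.2]
  · simp only [Complex.sub_im, Complex.log_im]; linarith [hlv.2, hlw.1]

theorem mem_slitPlane_of_im_ne_zero {z : ℂ} (h : z.im ≠ 0) : z ∈ Complex.slitPlane := Or.inr h

/-- The order three transformation `A ↦ (1 - A)⁻¹` of the dilogarithm. -/
theorem dilog_inv_one_sub {A : ℂ} (hA : 0 < A.im) :
    dilog (1 - A)⁻¹ = dilog A - Real.pi ^ 2 / 3 + Complex.log A * Complex.log (1 - A)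
      - Complex.log (A - 1) ^ 2 / 2 := by
  -- `G` has zero derivative on the upper half-plane, which is connected, so it is enough to
  -- evaluate it at one point.
  set G : ℂ → ℂ := fun A => dilog (1 - A)⁻¹ - dilog A - Complex.log A * Complex.log (1 - A)
      + Complex.log (A - 1) ^ 2 / 2 with hG
  have hopen : IsOpen {z : ℂ | 0 < z.im} := isOpen_lt continuous_const Complex.continuous_im
  have hconn : IsPreconnected {z : ℂ | 0 < z.im} :=
    (convex_halfSpace_im_gt 0).isPreconnected
  have hderiv : ∀ A : ℂ, 0 < A.im → HasDerivAt G 0 A := by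
    intro A hA
    have hA0 : A ≠ 0 := fun h => by simp [h] at hA
    have h1A : 1 - A ≠ 0 := fun h => by
      have := congrArg Complex.im h
      simp at this; exact hA.ne' this
    have hA1 : A - 1 ≠ 0 := fun h => h1A (by rw [← neg_sub, h, neg_zero])
    have him1 : (1 - A).im ≠ 0 := by simp [hA.ne']
    have him2 : 0 < (A - 1).im := by simpa using hA
    have e : 1 - (1 - A)⁻¹ = A / (A - 1) := by rw [← neg_sub A 1]; field_simp; ring
    have him3 : (1 - (1 - A)⁻¹).im ≠ 0 := by
      rw [Complex.sub_im, Complex.inv_im]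
      have := Complex.normSq_pos.2 h1A
      simp only [Complex.one_im, Complex.sub_im, zero_sub, neg_neg, neg_ne_zero]
      exact (div_pos hA this).ne'
    have d1 := (hasDerivAt_dilog (mem_slitPlane_of_im_ne_zero him3) (inv_ne_zero h1A)).comp A
      (((hasDerivAt_id A).const_sub 1).inv h1A)
    have d2 := hasDerivAt_dilog (mem_slitPlane_of_im_ne_zero him1) hA0
    have d3 := (hasDerivAt_id A).clog (mem_slitPlane_of_im_ne_zero hA.ne')
    have d4 := ((hasDerivAt_id A).const_sub 1).clog (mem_slitPlane_of_im_ne_zero him1)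
    have d5 := ((hasDerivAt_id A).sub_const 1).clog (mem_slitPlane_of_im_ne_zero him2.ne')
    refine (((d1.sub d2).sub (d3.mul d4)).add ((d5.pow 2).div_const 2)).congr_deriv ?_
    simp only [id, e, log_sub_log_of_im_pos hA him2]
    rw [← neg_sub A 1] at h1A ⊢
    field_simp
    ring
  -- `e^{iπ/3}` is the fixed point of `A ↦ (1 - A)⁻¹` in the upper half-plane: there the two
  -- dilogarithms cancel and only logarithms of roots of unity remain.
  set A₀ : ℂ := Complex.exp ((Real.pi / 3 : ℝ) * Complex.I) with hA₀
  have hc : Real.cos (Real.pi / 3) = 1 / 2 := Real.cos_pi_div_three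
  have hs : Real.sin (Real.pi / 3) = √3 / 2 := Real.sin_pi_div_three
  have h3 : (√3 : ℝ) ^ 2 = 3 := Real.sq_sqrt (by norm_num)
  have h3pos : 0 < √3 := by positivity
  have eA : A₀ = ⟨1 / 2, √3 / 2⟩ := by
    apply Complex.ext
    · rw [hA₀, Complex.exp_ofReal_mul_I_re, hc]
    · rw [hA₀, Complex.exp_ofReal_mul_I_im, hs]
  have hA₀im : 0 < A₀.im := by rw [eA]; simp
  have e1 : 1 - A₀ = Complex.exp ((-(Real.pi / 3) : ℝ) * Complex.I) := by
    apply Complex.ext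
    · rw [Complex.exp_ofReal_mul_I_re, Real.cos_neg, hc, eA]; norm_num
    · rw [Complex.exp_ofReal_mul_I_im, Real.sin_neg, hs, eA]; simp
  have e2 : A₀ - 1 = Complex.exp ((Real.pi - Real.pi / 3 : ℝ) * Complex.I) := by
    apply Complex.ext
    · rw [Complex.exp_ofReal_mul_I_re, Real.cos_pi_sub, hc, eA]; norm_num
    · rw [Complex.exp_ofReal_mul_I_im, Real.sin_pi_sub, hs, eA]; simp
  have e3 : (1 - A₀)⁻¹ = A₀ := by
    rw [e1, ← Complex.exp_neg, hA₀]; congr 1; push_cast; ring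
  have hpi := Real.pi_pos
  have l : ∀ x : ℝ, -Real.pi < x → x ≤ Real.pi →
      Complex.log (Complex.exp (x * Complex.I)) = x * Complex.I := fun x h1 h2 =>
    Complex.log_exp (by simpa using h1) (by simpa using h2)
  have hval : G A₀ = -Real.pi ^ 2 / 3 := by
    simp only [hG, e3]
    rw [e1, e2, l _ (by linarith) (by linarith), l _ (by linarith) (by linarith), hA₀,
      l _ (by linarith) (by linarith)]
    push_cast
    ring_nf
    rw [Complex.I_sq]
    ring
  have key : G A = G A₀ := hopen.is_const_of_deriv_eq_zero hconn
    (fun w hw => (hderiv w hw).differentiableAt.differentiableWithinAt)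
    (fun w hw => (hderiv w hw).deriv) hA hA₀im
  rw [hval] at key
  simp only [hG] at key
  linear_combination key

/-! ### The principal arcsine -/

section Arcsine

theorem sq_cpow_half (w : ℂ) : (w ^ (1 / 2 : ℂ)) ^ 2 = w := by
  rw [one_div]; exact Complex.cpow_nat_inv_pow w two_ne_zero

theorem sqrt_add_mul_sqrt_sub (s : ℂ) :
    ((1 - s ^ 2) ^ (1 / 2 : ℂ) + Complex.I * s) * ((1 - s ^ 2) ^ (1 / 2 : ℂ) - Complex.I * s)
      = 1 := by
  have h := sq_cpow_half (1 - s ^ 2)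
  linear_combination h - s ^ 2 * Complex.I_sq

theorem sqrt_add_ne_zero (s : ℂ) : (1 - s ^ 2) ^ (1 / 2 : ℂ) + Complex.I * s ≠ 0 :=
  left_ne_zero_of_mul_eq_one (sqrt_add_mul_sqrt_sub s)

theorem exp_I_mul_carcsin (s : ℂ) :
    Complex.exp (Complex.I * carcsin s) = (1 - s ^ 2) ^ (1 / 2 : ℂ) + Complex.I * s := by
  rw [carcsin, ← mul_assoc, mul_neg, Complex.I_mul_I, neg_neg, one_mul,
    Complex.exp_log (sqrt_add_ne_zero s)]

theorem exp_neg_I_mul_carcsin (s : ℂ) :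
    Complex.exp (-(Complex.I * carcsin s)) = (1 - s ^ 2) ^ (1 / 2 : ℂ) - Complex.I * s := by
  rw [Complex.exp_neg, exp_I_mul_carcsin]
  exact inv_eq_of_mul_eq_one_right (sqrt_add_mul_sqrt_sub s)

theorem norm_sqrt_le {s : ℂ} (hs : ‖s‖ ≤ 1) : ‖(1 - s ^ 2) ^ (1 / 2 : ℂ)‖ ≤ 2 := by
  have h : ‖(1 - s ^ 2) ^ (1 / 2 : ℂ)‖ ^ 2 ≤ 2 := by
    rw [← norm_pow, sq_cpow_half]
    calc ‖1 - s ^ 2‖ ≤ ‖(1 : ℂ)‖ + ‖s ^ 2‖ := norm_sub_le _ _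
      _ ≤ 1 + 1 := by
        rw [norm_one, norm_pow]; gcongr; exact pow_le_one₀ (norm_nonneg _) hs
      _ = 2 := by norm_num
  nlinarith [norm_nonneg ((1 - s ^ 2) ^ (1 / 2 : ℂ))]

/-- This `3` is the source of the `log 3` in `smallRegion`. -/
theorem norm_exp_I_mul_carcsin_le {s : ℂ} (hs : ‖s‖ ≤ 1) :
    ‖Complex.exp (Complex.I * carcsin s)‖ ≤ 3 ∧ ‖Complex.exp (-(Complex.I * carcsin s))‖ ≤ 3 := by
  have h := norm_sqrt_le hs
  have hI : ‖Complex.I * s‖ ≤ 1 := by simpa using hs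
  rw [exp_I_mul_carcsin, exp_neg_I_mul_carcsin]
  exact ⟨by linarith [norm_add_le ((1 - s ^ 2) ^ (1 / 2 : ℂ)) (Complex.I * s)],
    by linarith [norm_sub_le ((1 - s ^ 2) ^ (1 / 2 : ℂ)) (Complex.I * s)]⟩

/-- If `1 - s²` were real and nonpositive, then `s` would be real or imaginary; an imaginary `s`
gives `1 - s² ≥ 1`, and a real one has `|s| ≥ 1`, on a cut. -/
theorem one_sub_sq_mem_slitPlane {s : ℂ} (h1 : 1 - s ∈ Complex.slitPlane)
    (h2 : 1 + s ∈ Complex.slitPlane) : 1 - s ^ 2 ∈ Complex.slitPlane := by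
  by_contra h
  have him : (1 - s ^ 2).im = 0 := by
    by_contra h0; exact h (Or.inr h0)
  have hre : (1 - s ^ 2).re ≤ 0 := by
    by_contra h0; exact h (Or.inl (not_le.1 h0))
  simp only [Complex.sub_re, Complex.sub_im, Complex.one_re, Complex.one_im, sq, Complex.mul_re,
    Complex.mul_im] at him hre
  have hp : s.re * s.im = 0 := by linarith
  rw [Complex.mem_slitPlane_iff] at h1 h2
  simp only [Complex.sub_re, Complex.sub_im, Complex.add_re, Complex.add_im, Complex.one_re,
    Complex.one_im, zero_sub, zero_add] at h1 h2
  rcases mul_eq_zero.1 hp with h0 | h0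
  · rw [h0] at hre; nlinarith [sq_nonneg s.im]
  · simp only [h0, neg_zero, ne_eq, not_true_eq_false, or_false] at h1 h2
    rw [h0] at hre
    nlinarith

theorem cpow_half_re_pos {w : ℂ} (hw : w ∈ Complex.slitPlane) : 0 < (w ^ (1 / 2 : ℂ)).re := by
  have hw0 := Complex.slitPlane_ne_zero hw
  rw [Complex.cpow_def_of_ne_zero hw0, Complex.exp_re]
  refine mul_pos (Real.exp_pos _) (Real.cos_pos_of_mem_Ioo ?_)
  have h1 := Complex.neg_pi_lt_arg w
  have h2 := lt_of_le_of_ne (Complex.arg_le_pi w) (Complex.slitPlane_arg_ne_pi hw)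
  have : (Complex.log w * (1 / 2)).im = w.arg / 2 := by
    rw [show (1 / 2 : ℂ) = ((1 / 2 : ℝ) : ℂ) by norm_num, Complex.im_mul_ofReal, Complex.log_im]
    ring
  rw [this]
  constructor <;> linarith

/-- Write `u` for this number; its inverse is the one with the opposite sign, so `u + u⁻¹` is twice
the square root and has positive real part. That is impossible for real `u ≤ 0`. -/
theorem sqrt_add_mem_slitPlane {s : ℂ} (h : 1 - s ^ 2 ∈ Complex.slitPlane) :
    (1 - s ^ 2) ^ (1 / 2 : ℂ) + Complex.I * s ∈ Complex.slitPlane := by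
  set u := (1 - s ^ 2) ^ (1 / 2 : ℂ) + Complex.I * s with hu
  have hmul := sqrt_add_mul_sqrt_sub s
  rw [← hu] at hmul
  have hre := cpow_half_re_pos h
  by_contra hc
  have him : u.im = 0 := by
    by_contra h0; exact hc (Or.inr h0)
  have hure : u.re ≤ 0 := by
    by_contra h0; exact hc (Or.inl (not_le.1 h0))
  have hinv : (1 - s ^ 2) ^ (1 / 2 : ℂ) - Complex.I * s = u⁻¹ :=
    (inv_eq_of_mul_eq_one_right hmul).symm
  have hsum : 2 * (1 - s ^ 2) ^ (1 / 2 : ℂ) = u + u⁻¹ := by rw [← hinv, hu]; ring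
  have := congrArg Complex.re hsum
  rw [Complex.add_re, Complex.inv_re] at this
  have h2 : u.re / Complex.normSq u ≤ 0 := div_nonpos_of_nonpos_of_nonneg hure (Complex.normSq_nonneg u)
  simp only [Complex.mul_re, Complex.re_ofNat, Complex.im_ofNat, zero_mul, sub_zero] at this
  linarith

theorem analyticAt_carcsin {s : ℂ} (h1 : 1 - s ∈ Complex.slitPlane)
    (h2 : 1 + s ∈ Complex.slitPlane) : AnalyticAt ℂ carcsin s := by
  have h := one_sub_sq_mem_slitPlane h1 h2
  unfold carcsin
  refine analyticAt_const.mul (AnalyticAt.clog ?_ (sqrt_add_mem_slitPlane h))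
  exact ((analyticAt_const.sub (analyticAt_id.pow 2)).cpow analyticAt_const h).add
    (analyticAt_const.mul analyticAt_id)

theorem carcsin_ofReal {x : ℝ} (h1 : -1 ≤ x) (h2 : x ≤ 1) : carcsin x = (Real.arcsin x : ℂ) := by
  have hs : (0 : ℝ) ≤ 1 - x ^ 2 := by nlinarith
  have hr : (1 - (x : ℂ) ^ 2) ^ (1 / 2 : ℂ) = (Real.cos (Real.arcsin x) : ℂ) := by
    rw [Real.cos_arcsin, Real.sqrt_eq_rpow, Complex.ofReal_cpow hs]
    push_cast; rfl
  have he : (1 - (x : ℂ) ^ 2) ^ (1 / 2 : ℂ) + Complex.I * x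
      = Complex.exp (Real.arcsin x * Complex.I) := by
    rw [hr, Complex.exp_mul_I, ← Complex.ofReal_cos, ← Complex.ofReal_sin, Real.sin_arcsin h1 h2]
    ring
  have hpi := Real.pi_pos
  rw [carcsin, he, Complex.log_exp]
  · linear_combination (-(Real.arcsin x : ℂ)) * Complex.I_sq
  · simpa using by linarith [Real.neg_pi_div_two_le_arcsin x]
  · simpa using by linarith [Real.arcsin_le_pi_div_two x]

end Arcsine

end HyperbolicQ

/-! ### The generating function `W`: existence, uniqueness, special points -/

namespace HyperbolicQ

open Set Filter MeasureTheory

theorem two_pi_I_mul_eta (p : ℂ × ℂ) :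
    2 * Complex.I * Real.pi * eta p = Complex.I * carcsin (sineArg p) := by
  have : (Real.pi : ℂ) ≠ 0 := by exact_mod_cast Real.pi_ne_zero
  rw [eta]; field_simp

theorem dilogArg₁_eq (p : ℂ × ℂ) : dilogArg₁ p = -(Complex.exp (2 * Complex.I * Real.pi * p.1) *
    Complex.exp (Complex.I * carcsin (sineArg p)) * Complex.exp (Real.pi * p.2)) := by
  rw [dilogArg₁, ← two_pi_I_mul_eta, ← Complex.exp_add, ← Complex.exp_add]
  congr 2
  linear_combination (-Real.pi * p.2) * Complex.I_sq

theorem dilogArg₂_eq (p : ℂ × ℂ) :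
    dilogArg₂ p = -(Complex.exp (-(2 * Complex.I * Real.pi * p.1)) *
      Complex.exp (-(Complex.I * carcsin (sineArg p))) * Complex.exp (Real.pi * p.2)) := by
  rw [dilogArg₂, ← two_pi_I_mul_eta, ← Complex.exp_add, ← Complex.exp_add]
  congr 2
  linear_combination (-Real.pi * p.2) * Complex.I_sq

theorem analyticAt_fst' (p : ℂ × ℂ) : AnalyticAt ℂ (fun p : ℂ × ℂ => p.1) p := analyticAt_fst
theorem analyticAt_snd' (p : ℂ × ℂ) : AnalyticAt ℂ (fun p : ℂ × ℂ => p.2) p := analyticAt_snd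

theorem analyticAt_eta {p : ℂ × ℂ} (hp : p ∈ cutFree) : AnalyticAt ℂ eta p := by
  have hs : AnalyticAt ℂ sineArg p :=
    ((analyticAt_const.mul (analyticAt_snd' p)).cexp).mul
      ((Complex.differentiable_sin.analyticAt _).comp (analyticAt_const.mul (analyticAt_fst' p)))
  exact analyticAt_const.mul ((analyticAt_carcsin hp.1 hp.2.1).comp hs)

/-- No principal branch in the formula meets its cut on `cutFree`, so the formula itself is the
continuation. -/
theorem analyticAt_principalW {p : ℂ × ℂ} (hp : p ∈ cutFree) : AnalyticAt ℂ principalW p := by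
  have he := analyticAt_eta hp
  have h1 : AnalyticAt ℂ dilogArg₁ p :=
    ((analyticAt_const.mul (((analyticAt_fst' p).add he).sub
      ((analyticAt_const.mul (analyticAt_snd' p)).div analyticAt_const two_ne_zero))).cexp).neg
  have h2 : AnalyticAt ℂ dilogArg₂ p :=
    ((analyticAt_const.mul (((analyticAt_fst' p).add he).add
      ((analyticAt_const.mul (analyticAt_snd' p)).div analyticAt_const two_ne_zero))).neg.cexp).neg
  have hpi : (8 * (Real.pi : ℂ) ^ 2) ≠ 0 := by
    have : (Real.pi : ℂ) ≠ 0 := by exact_mod_cast Real.pi_ne_zero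
    exact mul_ne_zero (by norm_num) (pow_ne_zero 2 this)
  exact (((((analyticAt_dilog hp.2.2.1).comp h1).add ((analyticAt_dilog hp.2.2.2).comp h2)).sub
    ((analyticAt_const.mul he).pow 2)).add ((analyticAt_const.mul (analyticAt_snd' p)).pow 2)).div
    analyticAt_const hpi

/-- A convex region on which all the arguments of the formula for `W` are small. -/
def smallRegion : Set (ℂ × ℂ) :=
  {p | Real.log 3 + (Real.pi * p.2.re + 2 * Real.pi * |p.1.im|) < 0}

theorem convex_smallRegion : Convex ℝ smallRegion := by
  have hc : ConvexOn ℝ univ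
      (fun p : ℂ × ℂ => Real.log 3 + (Real.pi * p.2.re + 2 * Real.pi * |p.1.im|)) := by
    refine ⟨convex_univ, fun p _ q _ a b ha hb hab => ?_⟩
    simp only [Prod.snd_add, Prod.smul_snd, Complex.add_re, Complex.smul_re, Prod.fst_add,
      Prod.smul_fst, Complex.add_im, Complex.smul_im, smul_eq_mul]
    have h := abs_add_le (a * p.1.im) (b * q.1.im)
    rw [abs_mul, abs_mul, abs_of_nonneg ha, abs_of_nonneg hb] at h
    have h2 := mul_le_mul_of_nonneg_left h (by positivity : 0 ≤ 2 * Real.pi)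
    linear_combination h2 - (Real.log 3) * hab
  simpa [smallRegion] using hc.convex_lt 0

theorem isOpen_smallRegion : IsOpen smallRegion := by
  refine isOpen_lt ?_ continuous_const
  fun_prop

theorem one_sub_mem_slitPlane_of_norm_lt_one {z : ℂ} (hz : ‖z‖ < 1) :
    1 - z ∈ Complex.slitPlane := by
  rw [sub_eq_add_neg]
  exact Complex.mem_slitPlane_of_norm_lt_one (by rwa [norm_neg])

/-- The arguments of the arcsine and of both dilogarithms have modulus less than `1` here, because
`3 e^{π re ν} e^{2π |im σ|} < 1`. -/
theorem smallRegion_subset_cutFree : smallRegion ⊆ cutFree := by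
  intro p hp
  have hp' : Real.log 3 + (Real.pi * p.2.re + 2 * Real.pi * |p.1.im|) < 0 := hp
  have hpi := Real.pi_pos
  have hprod : 3 * (Real.exp (Real.pi * p.2.re) * Real.exp (2 * Real.pi * |p.1.im|)) < 1 := by
    rw [← Real.exp_add]
    nth_rewrite 1 [← Real.exp_log (by norm_num : (0 : ℝ) < 3)]
    rw [← Real.exp_add]
    exact Real.exp_lt_one_iff.2 hp'
  have hexp : ‖Complex.exp (Real.pi * p.2)‖ = Real.exp (Real.pi * p.2.re) := by
    rw [Complex.norm_exp, Complex.re_ofReal_mul]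
  have hs : ‖sineArg p‖ < 1 := by
    rw [sineArg, norm_mul, hexp]
    have h := norm_sin_le (2 * Real.pi * p.1)
    have : (2 * Real.pi * p.1).im = 2 * Real.pi * p.1.im := by
      rw [show (2 * Real.pi : ℂ) = ((2 * Real.pi : ℝ) : ℂ) by push_cast; rfl, Complex.im_ofReal_mul]
    rw [this, abs_mul, abs_of_pos (by positivity : 0 < 2 * Real.pi)] at h
    have h2 := mul_le_mul_of_nonneg_left h (Real.exp_pos (Real.pi * p.2.re)).le
    have : 0 < Real.exp (Real.pi * p.2.re) * Real.exp (2 * Real.pi * |p.1.im|) := by positivity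
    linarith
  have hc := norm_exp_I_mul_carcsin_le hs.le
  have hre : (2 * Complex.I * Real.pi * p.1).re = -(2 * Real.pi * p.1.im) := by
    rw [show (2 * Complex.I * Real.pi * p.1) = ((2 * Real.pi : ℝ) : ℂ) * (Complex.I * p.1) by
      push_cast; ring, Complex.re_ofReal_mul, Complex.I_mul_re]; ring
  have e1 : ‖Complex.exp (2 * Complex.I * Real.pi * p.1)‖ ≤ Real.exp (2 * Real.pi * |p.1.im|) := by
    rw [Complex.norm_exp, hre, Real.exp_le_exp]
    nlinarith [neg_abs_le p.1.im]
  have e2 : ‖Complex.exp (-(2 * Complex.I * Real.pi * p.1))‖ ≤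
      Real.exp (2 * Real.pi * |p.1.im|) := by
    rw [Complex.norm_exp, Complex.neg_re, hre, Real.exp_le_exp]
    nlinarith [le_abs_self p.1.im]
  refine ⟨one_sub_mem_slitPlane_of_norm_lt_one hs, Complex.mem_slitPlane_of_norm_lt_one hs,
    one_sub_mem_slitPlane_of_norm_lt_one ?_, one_sub_mem_slitPlane_of_norm_lt_one ?_⟩
  · rw [dilogArg₁_eq, norm_neg, norm_mul, norm_mul, hexp]
    refine lt_of_le_of_lt ?_ hprod
    calc _ ≤ Real.exp (2 * Real.pi * |p.1.im|) * 3 * Real.exp (Real.pi * p.2.re) := by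
          gcongr; exact hc.1
      _ = _ := by ring
  · rw [dilogArg₂_eq, norm_neg, norm_mul, norm_mul, hexp]
    refine lt_of_le_of_lt ?_ hprod
    calc _ ≤ Real.exp (2 * Real.pi * |p.1.im|) * 3 * Real.exp (Real.pi * p.2.re) := by
          gcongr; exact hc.2
      _ = _ := by ring

theorem basePoint_mem_smallRegion : ((1 / 8 : ℂ), (-1 : ℂ)) ∈ smallRegion := by
  have h3 : Real.log 3 < Real.pi := by
    have := Real.log_le_sub_one_of_pos (by norm_num : (0 : ℝ) < 3)
    linarith [Real.pi_gt_three]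
  have : ((1 / 8 : ℂ)).im = 0 := by norm_num
  simp only [smallRegion, mem_ofPred_eq, this]
  simpa using h3

theorem smallRegion_subset_domainW : smallRegion ⊆ domainW :=
  convex_smallRegion.isPreconnected.subset_connectedComponentIn basePoint_mem_smallRegion
    smallRegion_subset_cutFree

theorem domainW_subset_cutFree : domainW ⊆ cutFree := connectedComponentIn_subset _ _

theorem isPIII3GeneratingFunction_principalW : IsPIII3GeneratingFunction principalW :=
  ⟨fun _ _ => rfl, fun _ hp => analyticAt_principalW (domainW_subset_cutFree hp)⟩

theorem sineArg_ofReal (σ ν : ℝ) : sineArg ((σ : ℂ), (ν : ℂ)) =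
    ((Real.exp (Real.pi * ν) * Real.sin (2 * Real.pi * σ) : ℝ) : ℂ) := by
  simp only [sineArg]; push_cast; rfl

/-- Since `e^{πν} < 1`, the arcsine is automatically below `2πσ`. So the base region contains all
real points near `(1/8, -1)`. -/
theorem mem_baseRegion {σ ν : ℝ} (h0 : 0 < σ) (h1 : σ < 1 / 4) (hν : ν < 0) :
    ((σ : ℂ), (ν : ℂ)) ∈ baseRegion := by
  have hpi := Real.pi_pos
  have hσ1 : 0 < 2 * Real.pi * σ := by positivity
  have hσ2 : 2 * Real.pi * σ < Real.pi / 2 := by nlinarith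
  have hsin : 0 < Real.sin (2 * Real.pi * σ) := Real.sin_pos_of_pos_of_lt_pi hσ1 (by linarith)
  have hexp : Real.exp (Real.pi * ν) < 1 := Real.exp_lt_one_iff.2 (mul_neg_of_pos_of_neg hpi hν)
  set s := Real.exp (Real.pi * ν) * Real.sin (2 * Real.pi * σ) with hs
  have hs0 : 0 < s := by positivity
  have hs1 : s < Real.sin (2 * Real.pi * σ) := by nlinarith
  have hs2 : s ≤ 1 := hs1.le.trans (Real.sin_le_one _)
  refine ⟨σ, ν, 1 / (2 * Real.pi) * Real.arcsin s, rfl, ?_, ?_, ?_, h1, hν⟩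
  · rw [eta, sineArg_ofReal, ← hs, carcsin_ofReal (by linarith) hs2]
    push_cast; rfl
  · have := Real.arcsin_pos.2 hs0
    positivity
  · have : Real.arcsin s < 2 * Real.pi * σ := by
      rw [Real.arcsin_lt_iff_lt_sin ⟨by linarith, hs2⟩ ⟨by linarith, hσ2.le⟩]
      exact hs1
    rw [one_div, inv_mul_lt_iff₀ (by positivity)]
    exact this

theorem eq_zero_on_ball_of_eq_zero_on_real {g : ℂ → ℂ} {c r : ℝ} (hr : 0 < r)
    (hg : AnalyticOnNhd ℂ g (Metric.ball (c : ℂ) r))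
    (h0 : ∀ x : ℝ, |x - c| < r → g x = 0) : ∀ w ∈ Metric.ball (c : ℂ) r, g w = 0 := by
  refine hg.eqOn_zero_of_preconnected_of_frequently_eq_zero (convex_ball _ _).isPreconnected
    (Metric.mem_ball_self hr) ?_
  have ht : Tendsto (fun x : ℝ => (x : ℂ)) (𝓝[≠] c) (𝓝[≠] (c : ℂ)) :=
    tendsto_nhdsWithin_of_tendsto_nhds_of_eventually_within _
      (Complex.continuous_ofReal.continuousAt.tendsto.mono_left nhdsWithin_le_nhds)
      (by filter_upwards [self_mem_nhdsWithin] with x hx; simpa using hx)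
  refine ht.frequently (Eventually.frequently ?_)
  filter_upwards [nhdsWithin_le_nhds (Metric.ball_mem_nhds c hr)] with x hx
  exact h0 x (by simpa [Real.dist_eq] using hx)

/-- The base region consists of real points and has empty interior in `ℂ × ℂ`, so agreement on it is
first spread to a complex neighbourhood, one variable at a time; then the identity theorem on the
connected set `domainW` applies. -/
theorem IsPIII3GeneratingFunction.eqOn_principalW {W : ℂ × ℂ → ℂ}
    (hW : IsPIII3GeneratingFunction W) : EqOn W principalW domainW := by
  have hz₀ := smallRegion_subset_domainW basePoint_mem_smallRegion
  refine hW.analytic.eqOn_of_preconnected_of_eventuallyEq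
    isPIII3GeneratingFunction_principalW.analytic isPreconnected_connectedComponentIn hz₀ ?_
  obtain ⟨r, hr, hball⟩ := Metric.isOpen_iff.1 isOpen_smallRegion _ basePoint_mem_smallRegion
  set f : ℂ × ℂ → ℂ := fun p => W p - principalW p with hf
  -- `δ ≤ r` keeps the bidisc inside `smallRegion`; `δ ≤ 1/8` keeps its real points in `0 < σ <
  -- 1/4`, `ν < 0`.
  obtain ⟨δ, hδ, hδr, hδ8⟩ : ∃ δ : ℝ, 0 < δ ∧ δ ≤ r ∧ δ ≤ 1 / 8 :=
    ⟨min r (1 / 8), by positivity, min_le_left _ _, min_le_right _ _⟩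
  have hmem : ∀ s ∈ Metric.ball ((1 / 8 : ℝ) : ℂ) δ, ∀ v ∈ Metric.ball ((-1 : ℝ) : ℂ) δ,
      (s, v) ∈ domainW := fun s hs v hv => by
    refine smallRegion_subset_domainW (hball ?_)
    rw [← ball_prod_same]
    refine ⟨Metric.ball_subset_ball hδr ?_, Metric.ball_subset_ball hδr ?_⟩
    · simpa using hs
    · simpa using hv
  have hfan : ∀ p ∈ domainW, AnalyticAt ℂ f p := fun p hp =>
    (hW.analytic p hp).sub (isPIII3GeneratingFunction_principalW.analytic p hp)
  have hreal : ∀ x : ℝ, |x - 1 / 8| < δ → ∀ y : ℝ, |y - (-1)| < δ → f (x, y) = 0 := by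
    intro x hx y hy
    rw [abs_lt] at hx hy
    exact sub_eq_zero.2 (hW.eq_on_base (mem_baseRegion (by linarith) (by linarith) (by linarith)))
  have hball_real : ∀ c x : ℝ, |x - c| < δ → (x : ℂ) ∈ Metric.ball (c : ℂ) δ := fun c x hx => by
    rw [Metric.mem_ball, dist_eq_norm, ← Complex.ofReal_sub, Complex.norm_real]; exact hx
  -- Now `σ` becomes complex while `ν` is still real; `hall` then frees `ν`.
  have hstep : ∀ y : ℝ, |y - (-1)| < δ → ∀ s ∈ Metric.ball ((1 / 8 : ℝ) : ℂ) δ,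
      f (s, y) = 0 := fun y hy =>
    eq_zero_on_ball_of_eq_zero_on_real hδ (fun s hs =>
      (hfan _ (hmem s hs y (hball_real _ _ hy))).comp₂ analyticAt_id analyticAt_const)
      (fun x hx => hreal x hx y hy)
  have hall : ∀ s ∈ Metric.ball ((1 / 8 : ℝ) : ℂ) δ, ∀ v ∈ Metric.ball ((-1 : ℝ) : ℂ) δ,
      f (s, v) = 0 := fun s hs =>
    eq_zero_on_ball_of_eq_zero_on_real hδ (fun v hv =>
      (hfan _ (hmem s hs v hv)).comp₂ analyticAt_const analyticAt_id)
      (fun y hy => hstep y hy s hs)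
  filter_upwards [Metric.ball_mem_nhds ((1 / 8 : ℂ), (-1 : ℂ)) hδ] with p hp
  rw [← ball_prod_same] at hp
  exact sub_eq_zero.1 (hall p.1 (by simpa using hp.1) p.2 (by simpa using hp.2))

/-! ### The points `(iσ, -μ - i/2)` -/

/-- The point `(iσ, -μ - i/2)` at which the generating function is evaluated. -/
noncomputable def specialPoint (σ μ : ℝ) : ℂ × ℂ := (Complex.I * σ, -μ - Complex.I / 2)

/-- The angle `arcsin (e^{-πμ} sinh 2πσ)`. -/
noncomputable def angle (σ μ : ℝ) : ℝ := Real.arcsin (Real.exp (-(Real.pi * μ)) * Real.sinh (2 * Real.pi * σ))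

/-- The shift by `-i/2` contributes `e^{-iπ/2} = -i`, which cancels the `i` of `sin (ix) = i sinh
x`; the argument is real. -/
theorem sineArg_specialPoint (σ μ : ℝ) : sineArg (specialPoint σ μ) =
    ((Real.exp (-(Real.pi * μ)) * Real.sinh (2 * Real.pi * σ) : ℝ) : ℂ) := by
  have h1 : (Real.pi : ℂ) * (-μ - Complex.I / 2) =
      ((-(Real.pi * μ) : ℝ) : ℂ) - Real.pi / 2 * Complex.I := by push_cast; ring
  have h2 : 2 * (Real.pi : ℂ) * (Complex.I * σ) = ((2 * Real.pi * σ : ℝ) : ℂ) * Complex.I := by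
    push_cast; ring
  simp only [sineArg, specialPoint]
  rw [h1, h2, Complex.exp_sub, Complex.exp_pi_div_two_mul_I, Complex.sin_mul_I]
  rw [← Complex.ofReal_sinh, ← Complex.ofReal_exp, Complex.div_I]
  push_cast
  linear_combination (-(Complex.exp (-(Real.pi * μ)) * Complex.sinh (2 * Real.pi * σ))) *
    Complex.I_sq

variable {σ μ : ℝ}

theorem abs_sineArg_lt_one (h : Real.sinh (2 * Real.pi * σ) ^ 2 < Real.exp (2 * Real.pi * μ)) :
    |Real.exp (-(Real.pi * μ)) * Real.sinh (2 * Real.pi * σ)| < 1 := by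
  rw [← sq_lt_one_iff_abs_lt_one, mul_pow, ← Real.exp_nat_mul]
  calc _ < Real.exp ((2 : ℕ) * -(Real.pi * μ)) * Real.exp (2 * Real.pi * μ) := by gcongr
    _ = 1 := by rw [← Real.exp_add]; simp; ring

theorem angle_mem (h : Real.sinh (2 * Real.pi * σ) ^ 2 < Real.exp (2 * Real.pi * μ)) :
    angle σ μ ∈ Ioo (-(Real.pi / 2)) (Real.pi / 2) := by
  have := abs_lt.1 (abs_sineArg_lt_one h)
  exact ⟨Real.neg_pi_div_two_lt_arcsin.2 this.1, Real.arcsin_lt_pi_div_two.2 this.2⟩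

theorem sin_angle (h : Real.sinh (2 * Real.pi * σ) ^ 2 < Real.exp (2 * Real.pi * μ)) :
    Real.exp (Real.pi * μ) * Real.sin (angle σ μ) = Real.sinh (2 * Real.pi * σ) := by
  have := abs_lt.1 (abs_sineArg_lt_one h)
  rw [angle, Real.sin_arcsin this.1.le this.2.le, ← mul_assoc, ← Real.exp_add]
  simp

theorem cos_angle (h : Real.sinh (2 * Real.pi * σ) ^ 2 < Real.exp (2 * Real.pi * μ)) :
    Real.exp (Real.pi * μ) * Real.cos (angle σ μ) = √(disc σ μ) := by
  have hm := angle_mem h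
  symm
  have hc := Real.cos_nonneg_of_mem_Icc ⟨hm.1.le, hm.2.le⟩
  rw [Real.sqrt_eq_iff_eq_sq (by rw [disc]; linarith) (by positivity), disc, mul_pow,
    Real.cos_sq', mul_sub, ← mul_pow, sin_angle h, ← Real.exp_nat_mul, mul_one]
  congr 2
  push_cast; ring

theorem eta_specialPoint (h : Real.sinh (2 * Real.pi * σ) ^ 2 < Real.exp (2 * Real.pi * μ)) :
    carcsin (sineArg (specialPoint σ μ)) = angle σ μ := by
  have := abs_lt.1 (abs_sineArg_lt_one h)
  rw [sineArg_specialPoint, carcsin_ofReal this.1.le this.2.le, angle]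

/-- The left side is `e^{-2πσ} (sinh 2πσ - i √disc)`, and by `sin_angle` and `cos_angle` the bracket
is `e^{πμ} (sin α - i cos α)` with `α` the angle. As `|α| < π/2`, the exponent has imaginary part in
`(-π, 0)`, so this polar form yields the principal logarithm. -/
theorem one_sub_exp_neg_mul_saddle
    (h : Real.sinh (2 * Real.pi * σ) ^ 2 < Real.exp (2 * Real.pi * μ)) :
    1 - (Real.exp (-2 * Real.pi * σ) : ℂ) * saddle σ μ =
      Complex.exp (((-2 * Real.pi * σ + Real.pi * μ : ℝ) : ℂ) +
        ((angle σ μ - Real.pi / 2 : ℝ) : ℂ) * Complex.I) := by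
  have e : Real.exp (-2 * Real.pi * σ) * Real.exp (2 * Real.pi * σ) = 1 := by
    rw [← Real.exp_add]; simp
  have hs := sin_angle h
  have hc := cos_angle h
  rw [Complex.exp_add, ← Complex.ofReal_exp, Real.exp_add]
  rw [Real.sinh_eq] at hs
  have e' : Real.exp (-(2 * Real.pi * σ)) = Real.exp (-2 * Real.pi * σ) := by congr 1; ring
  rw [e'] at hs
  apply Complex.ext
  · rw [Complex.re_ofReal_mul, Complex.exp_ofReal_mul_I_re, Real.cos_sub_pi_div_two]
    simp only [saddle, Complex.sub_re, Complex.one_re, Complex.re_ofReal_mul, Complex.add_re,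
      Complex.ofReal_re, Complex.I_mul_re, Complex.ofReal_im, neg_zero, add_zero]
    rw [Real.cosh_eq, e']
    linear_combination (-Real.exp (-2 * Real.pi * σ)) * hs - e
  · rw [Complex.im_ofReal_mul, Complex.exp_ofReal_mul_I_im, Real.sin_sub_pi_div_two]
    simp only [saddle, Complex.sub_im, Complex.one_im, Complex.im_ofReal_mul, Complex.add_im,
      Complex.ofReal_re, Complex.I_mul_im, Complex.ofReal_im, zero_add, zero_sub]
    linear_combination Real.exp (-2 * Real.pi * σ) * hc

theorem saddle_neg (σ μ : ℝ) : saddle (-σ) μ = saddle σ μ := by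
  simp [saddle, disc, Real.sinh_neg]

theorem angle_neg (σ μ : ℝ) : angle (-σ) μ = -angle σ μ := by
  simp [angle, Real.sinh_neg]

/-- Symmetry `σ ↦ -σ`, which fixes the saddle and reverses the angle. -/
theorem one_sub_exp_mul_saddle
    (h : Real.sinh (2 * Real.pi * σ) ^ 2 < Real.exp (2 * Real.pi * μ)) :
    1 - (Real.exp (2 * Real.pi * σ) : ℂ) * saddle σ μ =
      Complex.exp (((2 * Real.pi * σ + Real.pi * μ : ℝ) : ℂ) +
        ((-angle σ μ - Real.pi / 2 : ℝ) : ℂ) * Complex.I) := by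
  have := one_sub_exp_neg_mul_saddle (σ := -σ) (μ := μ) (by simpa using h)
  rw [saddle_neg, angle_neg] at this
  simpa using this

theorem dilogArg₂_specialPoint
    (h : Real.sinh (2 * Real.pi * σ) ^ 2 < Real.exp (2 * Real.pi * μ)) :
    dilogArg₂ (specialPoint σ μ) = (1 - (Real.exp (-2 * Real.pi * σ) : ℂ) * saddle σ μ)⁻¹ := by
  rw [one_sub_exp_neg_mul_saddle h, dilogArg₂_eq, eta_specialPoint h, ← Complex.exp_neg,
    ← Complex.exp_add, ← Complex.exp_add, ← neg_one_mul, ← Complex.exp_pi_mul_I, ← Complex.exp_add]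
  congr 1
  simp only [specialPoint]
  push_cast
  linear_combination (-2 * Real.pi * σ) * Complex.I_sq

theorem dilogArg₁_specialPoint
    (h : Real.sinh (2 * Real.pi * σ) ^ 2 < Real.exp (2 * Real.pi * μ)) :
    dilogArg₁ (specialPoint σ μ) = (1 - (Real.exp (2 * Real.pi * σ) : ℂ) * saddle σ μ)⁻¹ := by
  rw [one_sub_exp_mul_saddle h, dilogArg₁_eq, eta_specialPoint h, ← Complex.exp_neg,
    ← Complex.exp_add, ← Complex.exp_add, ← neg_one_mul, ← Complex.exp_pi_mul_I, ← Complex.exp_add]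
  congr 1
  simp only [specialPoint]
  push_cast
  linear_combination (2 * Real.pi * σ) * Complex.I_sq

theorem saddle_im_pos (h : Real.sinh (2 * Real.pi * σ) ^ 2 < Real.exp (2 * Real.pi * μ)) :
    0 < (saddle σ μ).im := by
  simp only [saddle, Complex.add_im, Complex.ofReal_im, Complex.I_mul_im, Complex.ofReal_re,
    zero_add]
  exact Real.sqrt_pos.2 (by rw [disc]; linarith)

theorem saddle_re_pos (σ μ : ℝ) : 0 < (saddle σ μ).re := by
  simp only [saddle, Complex.add_re, Complex.ofReal_re, Complex.I_mul_re, Complex.ofReal_im,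
    neg_zero, add_zero]
  exact Real.cosh_pos _

theorem one_sub_inv_mem_slitPlane {A : ℂ} (hA : 0 < A.im) :
    1 - (1 - A)⁻¹ ∈ Complex.slitPlane := by
  refine Or.inr ?_
  have : 1 - A ≠ 0 := fun h => by
    have := congrArg Complex.im h
    simp at this; exact hA.ne' this
  have hn := Complex.normSq_pos.2 this
  rw [Complex.sub_im, Complex.inv_im]
  simp only [Complex.one_im, Complex.sub_im, zero_sub, neg_neg, neg_ne_zero]
  exact (div_pos hA hn).ne'

/-- The hypothesis says that the real arcsine argument lies in `(-1, 1)`. The dilogarithm arguments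
are `(1 - A)⁻¹` with `A` in the upper half-plane, hence not real. -/
theorem specialPoint_mem_cutFree
    (h : Real.sinh (2 * Real.pi * σ) ^ 2 < Real.exp (2 * Real.pi * μ)) :
    specialPoint σ μ ∈ cutFree := by
  have hs := abs_lt.1 (abs_sineArg_lt_one h)
  have hz := saddle_im_pos h
  refine ⟨?_, ?_, ?_, ?_⟩
  · rw [sineArg_specialPoint]
    refine Or.inl ?_
    rw [Complex.sub_re, Complex.ofReal_re, Complex.one_re]; linarith
  · rw [sineArg_specialPoint]
    refine Or.inl ?_
    rw [Complex.add_re, Complex.ofReal_re, Complex.one_re]; linarith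
  · rw [dilogArg₁_specialPoint h]
    refine one_sub_inv_mem_slitPlane ?_
    rw [Complex.im_ofReal_mul]; positivity
  · rw [dilogArg₂_specialPoint h]
    refine one_sub_inv_mem_slitPlane ?_
    rw [Complex.im_ofReal_mul]; positivity

/-- Increasing `μ` preserves the hypothesis, so the ray of special points starting at `μ` stays in
`cutFree`; far along it enters `smallRegion`, which lies in `domainW`. -/
theorem specialPoint_mem_domainW
    (h : Real.sinh (2 * Real.pi * σ) ^ 2 < Real.exp (2 * Real.pi * μ)) :
    specialPoint σ μ ∈ domainW := by
  have hpi := Real.pi_pos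
  obtain ⟨N, hN⟩ : ∃ N : ℝ, Real.log 3 + 2 * Real.pi * |σ| < Real.pi * N :=
    ⟨(Real.log 3 + 2 * Real.pi * |σ|) / Real.pi + 1, by field_simp; linarith⟩
  set M := max μ N with hM
  have hMN : N ≤ M := le_max_right _ _
  have hsmall : specialPoint σ M ∈ smallRegion := by
    simp only [smallRegion, specialPoint, mem_ofPred_eq, Complex.I_mul_im, Complex.ofReal_re,
      Complex.sub_re, Complex.neg_re, Complex.div_ofNat_re, Complex.I_re, zero_div, sub_zero]
    nlinarith
  have hpre : IsPreconnected ((fun m : ℝ => specialPoint σ m) '' Ici μ) := by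
    refine isPreconnected_Ici.image _ (Continuous.continuousOn ?_)
    unfold specialPoint
    fun_prop
  have hsub : (fun m : ℝ => specialPoint σ m) '' Ici μ ⊆ cutFree := by
    rintro _ ⟨m, hm, rfl⟩
    refine specialPoint_mem_cutFree (h.trans_le (Real.exp_le_exp.2 ?_))
    have : μ ≤ m := hm
    nlinarith
  have hMmem := smallRegion_subset_domainW hsmall
  have := hpre.subset_connectedComponentIn (mem_image_of_mem _ (le_max_left μ N : M ∈ Ici μ)) hsub
  rw [domainW, ← connectedComponentIn_eq hMmem] at *
  exact this (mem_image_of_mem _ (self_mem_Ici : μ ∈ Ici μ))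

/-- The order three relation is applied to `A = e^{±2πσ} z`. All logarithms then reduce to `log z`,
`σ`, `μ` and the angle, and a polynomial identity is left. -/
theorem fQ_eq_principalW (h : Real.sinh (2 * Real.pi * σ) ^ 2 < Real.exp (2 * Real.pi * μ)) :
    fQ σ μ = 4 * Real.pi * Complex.I * principalW (specialPoint σ μ)
      - dilog (-(Real.exp (2 * Real.pi * μ) : ℂ)) / (2 * Real.pi * Complex.I)
      - 2 * Real.pi * Complex.I * (σ : ℂ) ^ 2 + Real.pi * Complex.I / 4 := by
  have hpi := Real.pi_pos
  have hz := saddle_im_pos h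
  have hz0 : saddle σ μ ≠ 0 := fun h0 => by simp [h0] at hz
  have hm := angle_mem h
  have hA : 0 < ((Real.exp (-2 * Real.pi * σ) : ℂ) * saddle σ μ).im := by
    rw [Complex.im_ofReal_mul]; positivity
  have hB : 0 < ((Real.exp (2 * Real.pi * σ) : ℂ) * saddle σ μ).im := by
    rw [Complex.im_ofReal_mul]; positivity
  have lA : Complex.log ((Real.exp (-2 * Real.pi * σ) : ℂ) * saddle σ μ)
      = Complex.log (saddle σ μ) - 2 * Real.pi * σ := by
    rw [Complex.log_ofReal_mul (Real.exp_pos _) hz0, Real.log_exp]; push_cast; ring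
  have lB : Complex.log ((Real.exp (2 * Real.pi * σ) : ℂ) * saddle σ μ)
      = Complex.log (saddle σ μ) + 2 * Real.pi * σ := by
    rw [Complex.log_ofReal_mul (Real.exp_pos _) hz0, Real.log_exp]; push_cast; ring
  have lexp : ∀ x y : ℝ, -Real.pi < y → y ≤ Real.pi →
      Complex.log (Complex.exp ((x : ℂ) + (y : ℂ) * Complex.I)) = x + y * Complex.I :=
    fun x y h1 h2 => Complex.log_exp (by simpa using h1) (by simpa using h2)
  have l1A := one_sub_exp_neg_mul_saddle h
  have l1B := one_sub_exp_mul_saddle h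
  have lneg : ∀ x y : ℝ, -Complex.exp ((x : ℂ) + (y : ℂ) * Complex.I) =
      Complex.exp ((x : ℂ) + ((y + Real.pi : ℝ) : ℂ) * Complex.I) := fun x y => by
    rw [← neg_one_mul, ← Complex.exp_pi_mul_I, ← Complex.exp_add]
    congr 1; push_cast; ring
  -- Negating the polar form of `1 - A` adds `π` to its argument, which moves from `(-π, 0)` to `(0,
  -- π)` and stays principal.
  have lA1 : Complex.log ((Real.exp (-2 * Real.pi * σ) : ℂ) * saddle σ μ - 1) =
      ((-2 * Real.pi * σ + Real.pi * μ : ℝ) : ℂ) +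
        ((angle σ μ - Real.pi / 2 + Real.pi : ℝ) : ℂ) * Complex.I := by
    rw [← neg_sub, l1A, lneg, lexp _ _ (by linarith [hm.1]) (by linarith [hm.2])]
  have lB1 : Complex.log ((Real.exp (2 * Real.pi * σ) : ℂ) * saddle σ μ - 1) =
      ((2 * Real.pi * σ + Real.pi * μ : ℝ) : ℂ) +
        ((-angle σ μ - Real.pi / 2 + Real.pi : ℝ) : ℂ) * Complex.I := by
    rw [← neg_sub, l1B, lneg, lexp _ _ (by linarith [hm.2]) (by linarith [hm.1])]
  have lz : Complex.log (-saddle σ μ) = Complex.log (saddle σ μ) - Real.pi * Complex.I := by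
    have harg := Complex.arg_neg_eq_arg_sub_pi_of_im_pos hz
    rw [Complex.log, Complex.log, harg, norm_neg]
    push_cast; ring
  have hpi0 : (Real.pi : ℂ) ≠ 0 := by exact_mod_cast hpi.ne'
  have heta : 2 * Real.pi * eta (specialPoint σ μ) = angle σ μ := by
    rw [eta, eta_specialPoint h]; field_simp
  rw [fQ, principalW, heta, dilogArg₁_specialPoint h, dilogArg₂_specialPoint h,
    dilog_inv_one_sub hA, dilog_inv_one_sub hB, lA, lB, lA1, lB1, l1A, l1B,
    lexp _ _ (by linarith [hm.2]) (by linarith [hm.1]),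
    lexp _ _ (by linarith [hm.1]) (by linarith [hm.2]), lz]
  simp only [specialPoint]
  push_cast
  -- From here the dilogarithms, `log z` and the angle are independent indeterminates.
  generalize dilog (-Complex.exp (2 * Real.pi * μ)) = d
  generalize dilog (Complex.exp (-2 * Real.pi * σ) * saddle σ μ) = dA
  generalize dilog (Complex.exp (2 * Real.pi * σ) * saddle σ μ) = dB
  generalize Complex.log (saddle σ μ) = ℓ
  generalize (angle σ μ : ℂ) = α
  have hI : Complex.I ≠ 0 := Complex.I_ne_zero
  have hI2 : Complex.I ^ 2 = -1 := Complex.I_sq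
  have hI3 : Complex.I ^ 3 = -Complex.I := by rw [pow_succ, hI2]; ring
  simp only [div_eq_mul_inv, mul_inv, Complex.inv_I]
  field_simp
  ring_nf
  simp only [hI2, hI3]
  ring

end HyperbolicQ

/-! ### Holomorphy and growth of the transform of a kernel -/

namespace HyperbolicQ

open Set Filter MeasureTheory

section TrigBounds

/-- Mean value inequality on the segment from `0` to `w`, where modulus and absolute imaginary part
do not exceed those of `w`. Iterating it gives the bounds of orders one, two and three for `sin w`,
`cos w - 1` and `sin w - w`. -/
theorem norm_image_sub_image_zero_le {f f' : ℂ → ℂ} (hf : ∀ u, HasDerivAt f (f' u) u) (w : ℂ) {C : ℝ}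
    (hC : ∀ u : ℂ, ‖u‖ ≤ ‖w‖ → |u.im| ≤ |w.im| → ‖f' u‖ ≤ C) : ‖f w - f 0‖ ≤ C * ‖w‖ := by
  have h := (convex_segment (𝕜 := ℝ) (0 : ℂ) w).norm_image_sub_le_of_norm_hasDerivWithin_le
    (f := f) (f' := f') (C := C) (fun u _ => (hf u).hasDerivWithinAt) ?_
    (left_mem_segment ℝ 0 w) (right_mem_segment ℝ 0 w)
  · simpa using h
  · rintro _ ⟨a, b, ha, hb, hab, rfl⟩
    have hb1 : b ≤ 1 := by linarith
    refine hC _ ?_ ?_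
    · rw [smul_zero, zero_add, norm_smul, Real.norm_of_nonneg hb]
      exact mul_le_of_le_one_left (norm_nonneg _) hb1
    · rw [smul_zero, zero_add, Complex.smul_im, smul_eq_mul, abs_mul, abs_of_nonneg hb]
      exact mul_le_of_le_one_left (abs_nonneg _) hb1

theorem norm_sin_le_mul (w : ℂ) : ‖Complex.sin w‖ ≤ ‖w‖ * Real.exp |w.im| := by
  have h := norm_image_sub_image_zero_le Complex.hasDerivAt_sin w (C := Real.exp |w.im|)
    fun u _ hu => (norm_cos_le u).trans (Real.exp_le_exp.2 hu)
  rwa [Complex.sin_zero, sub_zero, mul_comm] at h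

theorem norm_cos_sub_one_le (w : ℂ) : ‖Complex.cos w - 1‖ ≤ ‖w‖ ^ 2 * Real.exp |w.im| := by
  have h := norm_image_sub_image_zero_le Complex.hasDerivAt_cos w (C := ‖w‖ * Real.exp |w.im|)
    fun u hu hu' => by
      rw [norm_neg]
      exact (norm_sin_le_mul u).trans (by gcongr)
  rw [Complex.cos_zero] at h
  linarith

theorem norm_sin_sub_le (w : ℂ) : ‖Complex.sin w - w‖ ≤ ‖w‖ ^ 3 * Real.exp |w.im| := by
  have h := norm_image_sub_image_zero_le
    (fun u => (Complex.hasDerivAt_sin u).sub (hasDerivAt_id u)) w (C := ‖w‖ ^ 2 * Real.exp |w.im|)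
    fun u hu hu' => (norm_cos_sub_one_le u).trans (by gcongr)
  simp only [Pi.sub_apply, id, Complex.sin_zero, sub_zero] at h
  linarith

end TrigBounds

/-- The kernels `k` for which `∫₀^∞ (k(y) sin(2yz) - z/y) dy/y` is holomorphic in the strip
`|im z| < B`. -/
structure IsKernel (k : ℝ → ℝ) (B : ℝ) : Prop where
  nonneg : ∀ y, 0 < y → 0 ≤ k y
  continuousOn : ContinuousOn k (Ioi 0)
  integrable_sub : IntegrableOn (fun y => k y - 1 / (2 * y ^ 2)) (Ioi 0)
  integrable_exp : ∀ a < B, IntegrableOn (fun y => y ^ 2 * Real.exp (2 * a * y) * k y) (Ioi 0)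

/-- The transform `∫₀^∞ (k(y) sin(2yz) - z/y) dy/y`. -/
noncomputable def transform (k : ℝ → ℝ) (z : ℂ) : ℂ :=
  ∫ y in Ioi (0 : ℝ), (Complex.sin (2 * (y : ℂ) * z) * (k y : ℂ) - z / (y : ℂ)) / (y : ℂ)

/-- The derivative of `transform k`. -/
noncomputable def transformDeriv (k : ℝ → ℝ) (z : ℂ) : ℂ :=
  2 * ((∫ y in Ioi (0 : ℝ), (k y - 1 / (2 * y ^ 2)) : ℝ) : ℂ) +
    ∫ y in Ioi (0 : ℝ), 2 * (Complex.cos (2 * (y : ℂ) * z) - 1) * (k y : ℂ)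

variable {k : ℝ → ℝ} {B : ℝ}

theorem abs_im_two_mul_ofReal_mul {y : ℝ} (hy : 0 < y) (z : ℂ) :
    |(2 * (y : ℂ) * z).im| = 2 * |z.im| * y := by
  rw [show (2 * (y : ℂ)) = ((2 * y : ℝ) : ℂ) by push_cast; rfl, Complex.im_ofReal_mul, abs_mul,
    abs_of_pos (by positivity)]
  ring

theorem norm_two_mul_ofReal_mul {y : ℝ} (hy : 0 < y) (z : ℂ) :
    ‖2 * (y : ℂ) * z‖ = 2 * y * ‖z‖ := by
  rw [norm_mul, norm_mul, Complex.norm_ofNat, Complex.norm_real, Real.norm_of_nonneg hy.le]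

/-- The transform and its first two derivatives share the majorant `y² e^{2ay} k y`, which is why
`IsKernel` asks for its integrability. -/
theorem IsKernel.norm_sin_sub_mul_le (hk : IsKernel k B) {y : ℝ} (hy : 0 < y) {z : ℂ} {a R : ℝ}
    (hz : |z.im| ≤ a) (hR : ‖z‖ ≤ R) :
    ‖(Complex.sin (2 * (y : ℂ) * z) - 2 * (y : ℂ) * z) * (k y : ℂ) / (y : ℂ)‖ ≤
      8 * R ^ 3 * (y ^ 2 * Real.exp (2 * a * y) * k y) := by
  have hR0 : 0 ≤ R := (norm_nonneg z).trans hR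
  have hky := hk.nonneg y hy
  have h := norm_sin_sub_le (2 * (y : ℂ) * z)
  rw [abs_im_two_mul_ofReal_mul hy, norm_two_mul_ofReal_mul hy] at h
  rw [norm_div, norm_mul, Complex.norm_real, Complex.norm_real, Real.norm_of_nonneg hy.le,
    Real.norm_of_nonneg hky, div_le_iff₀ hy]
  calc _ ≤ (2 * y * ‖z‖) ^ 3 * Real.exp (2 * |z.im| * y) * k y := by gcongr
    _ ≤ (2 * y * R) ^ 3 * Real.exp (2 * a * y) * k y := by gcongr
    _ = _ := by ring

theorem IsKernel.norm_cos_sub_mul_le (hk : IsKernel k B) {y : ℝ} (hy : 0 < y) {z : ℂ} {a R : ℝ}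
    (hz : |z.im| ≤ a) (hR : ‖z‖ ≤ R) :
    ‖2 * (Complex.cos (2 * (y : ℂ) * z) - 1) * (k y : ℂ)‖ ≤
      8 * R ^ 2 * (y ^ 2 * Real.exp (2 * a * y) * k y) := by
  have hky := hk.nonneg y hy
  have h := norm_cos_sub_one_le (2 * (y : ℂ) * z)
  rw [abs_im_two_mul_ofReal_mul hy, norm_two_mul_ofReal_mul hy] at h
  rw [norm_mul, norm_mul, Complex.norm_real, Real.norm_of_nonneg hky, Complex.norm_ofNat]
  calc _ ≤ 2 * ((2 * y * ‖z‖) ^ 2 * Real.exp (2 * |z.im| * y)) * k y := by gcongr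
    _ ≤ 2 * ((2 * y * R) ^ 2 * Real.exp (2 * a * y)) * k y := by gcongr
    _ = _ := by ring

theorem IsKernel.norm_mul_sin_mul_le (hk : IsKernel k B) {y : ℝ} (hy : 0 < y) {z : ℂ} {a R : ℝ}
    (hz : |z.im| ≤ a) (hR : ‖z‖ ≤ R) :
    ‖-(4 * (y : ℂ) * Complex.sin (2 * (y : ℂ) * z) * (k y : ℂ))‖ ≤
      8 * R * (y ^ 2 * Real.exp (2 * a * y) * k y) := by
  have hR0 : 0 ≤ R := (norm_nonneg z).trans hR
  have hky := hk.nonneg y hy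
  have h := norm_sin_le_mul (2 * (y : ℂ) * z)
  rw [abs_im_two_mul_ofReal_mul hy, norm_two_mul_ofReal_mul hy] at h
  rw [norm_neg, norm_mul, norm_mul, norm_mul, Complex.norm_real, Complex.norm_real,
    Real.norm_of_nonneg hky, Real.norm_of_nonneg hy.le, Complex.norm_ofNat]
  calc _ ≤ 4 * y * (2 * y * ‖z‖ * Real.exp (2 * |z.im| * y)) * k y := by gcongr
    _ ≤ 4 * y * (2 * y * R * Real.exp (2 * a * y)) * k y := by gcongr
    _ = _ := by ring

theorem IsKernel.aestronglyMeasurable (hk : IsKernel k B) {f : ℝ → ℂ} (hf : ContinuousOn f (Ioi 0)) :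
    AEStronglyMeasurable (fun y => f y * (k y : ℂ)) (volume.restrict (Ioi 0)) :=
  (hf.mul (Complex.continuous_ofReal.comp_continuousOn hk.continuousOn)).aestronglyMeasurable
    measurableSet_Ioi

theorem IsKernel.aestronglyMeasurable_sin_sub (hk : IsKernel k B) (z : ℂ) :
    AEStronglyMeasurable (fun y : ℝ =>
      (Complex.sin (2 * (y : ℂ) * z) - 2 * (y : ℂ) * z) * (k y : ℂ) / (y : ℂ))
      (volume.restrict (Ioi 0)) := by
  refine (ContinuousOn.div ((by fun_prop : ContinuousOn _ _).mul
    (Complex.continuous_ofReal.comp_continuousOn hk.continuousOn)) (by fun_prop)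
    fun y hy => ?_).aestronglyMeasurable measurableSet_Ioi
  exact_mod_cast (ne_of_gt hy)

theorem IsKernel.aestronglyMeasurable_cos_sub (hk : IsKernel k B) (z : ℂ) :
    AEStronglyMeasurable (fun y : ℝ => 2 * (Complex.cos (2 * (y : ℂ) * z) - 1) * (k y : ℂ))
      (volume.restrict (Ioi 0)) :=
  hk.aestronglyMeasurable (by fun_prop)

theorem IsKernel.integrableOn_sin_sub (hk : IsKernel k B) {z : ℂ} (hz : |z.im| < B) :
    IntegrableOn (fun y : ℝ =>
      (Complex.sin (2 * (y : ℂ) * z) - 2 * (y : ℂ) * z) * (k y : ℂ) / (y : ℂ)) (Ioi 0) :=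
  ((hk.integrable_exp _ hz).const_mul (8 * ‖z‖ ^ 3)).mono' (hk.aestronglyMeasurable_sin_sub z)
    ((ae_restrict_iff' measurableSet_Ioi).2 (ae_of_all _ fun _ hy =>
      hk.norm_sin_sub_mul_le hy le_rfl le_rfl))

theorem IsKernel.integrableOn_cos_sub (hk : IsKernel k B) {z : ℂ} (hz : |z.im| < B) :
    IntegrableOn (fun y : ℝ => 2 * (Complex.cos (2 * (y : ℂ) * z) - 1) * (k y : ℂ)) (Ioi 0) :=
  ((hk.integrable_exp _ hz).const_mul (8 * ‖z‖ ^ 2)).mono' (hk.aestronglyMeasurable_cos_sub z)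
    ((ae_restrict_iff' measurableSet_Ioi).2 (ae_of_all _ fun _ hy =>
      hk.norm_cos_sub_mul_le hy le_rfl le_rfl))

/-- Removing the linear part of the sine separates the convergence at `0` of the two terms: `sin w -
w` is of order `w³`, and `k y - 1 / (2 y²)` is integrable for a kernel. -/
theorem transform_integrand_eq {y : ℝ} (hy : 0 < y) (z : ℂ) :
    (Complex.sin (2 * (y : ℂ) * z) * (k y : ℂ) - z / (y : ℂ)) / (y : ℂ) =
      (Complex.sin (2 * (y : ℂ) * z) - 2 * (y : ℂ) * z) * (k y : ℂ) / (y : ℂ) +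
        2 * z * ((k y - 1 / (2 * y ^ 2) : ℝ) : ℂ) := by
  have : (y : ℂ) ≠ 0 := by exact_mod_cast hy.ne'
  push_cast
  field_simp
  ring

theorem IsKernel.integrableOn_transform (hk : IsKernel k B) {z : ℂ} (hz : |z.im| < B) :
    IntegrableOn (fun y : ℝ =>
      (Complex.sin (2 * (y : ℂ) * z) * (k y : ℂ) - z / (y : ℂ)) / (y : ℂ)) (Ioi 0) := by
  refine ((hk.integrableOn_sin_sub hz).add (hk.integrable_sub.ofReal.const_mul (2 * z))).congr_fun
    (fun y hy => ?_) measurableSet_Ioi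
  exact (transform_integrand_eq hy z).symm

theorem IsKernel.transform_eq (hk : IsKernel k B) {z : ℂ} (hz : |z.im| < B) :
    transform k z =
      (∫ y in Ioi (0 : ℝ), (Complex.sin (2 * (y : ℂ) * z) - 2 * (y : ℂ) * z) * (k y : ℂ) / (y : ℂ))
        + 2 * z * ((∫ y in Ioi (0 : ℝ), (k y - 1 / (2 * y ^ 2)) : ℝ) : ℂ) := by
  have h2 : IntegrableOn (fun y : ℝ => 2 * z * ((k y - 1 / (2 * y ^ 2) : ℝ) : ℂ)) (Ioi 0) :=
    hk.integrable_sub.ofReal.const_mul (2 * z)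
  rw [transform, ← integral_complex_ofReal, ← integral_const_mul,
    ← integral_add (hk.integrableOn_sin_sub hz) h2]
  exact setIntegral_congr_fun measurableSet_Ioi fun y hy => transform_integrand_eq hy z

theorem exists_ball_subset_strip {z : ℂ} (hz : |z.im| < B) : ∃ a R δ : ℝ, a < B ∧ 0 < δ ∧
    ∀ w ∈ Metric.ball z δ, |w.im| ≤ a ∧ ‖w‖ ≤ R := by
  obtain ⟨a, ha, haB⟩ := exists_between hz
  refine ⟨a, ‖z‖ + (a - |z.im|), a - |z.im|, haB, by linarith, fun w hw => ?_⟩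
  rw [Metric.mem_ball, dist_eq_norm] at hw
  constructor
  · have h1 : |w.im| ≤ |z.im| + |(w - z).im| := by
      rw [Complex.sub_im]
      have := abs_add_le z.im (w.im - z.im)
      simpa using this
    linarith [Complex.abs_im_le_norm (w - z)]
  · have : ‖w‖ ≤ ‖z‖ + ‖w - z‖ := by
      have := norm_add_le z (w - z)
      simpa using this
    linarith

theorem hasDerivAt_two_mul (y : ℝ) (w : ℂ) :
    HasDerivAt (fun z : ℂ => 2 * (y : ℂ) * z) (2 * (y : ℂ)) w := by
  simpa using (hasDerivAt_id w).const_mul (2 * (y : ℂ))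

theorem isOpen_strip (B : ℝ) : IsOpen {z : ℂ | |z.im| < B} :=
  isOpen_lt (by fun_prop) continuous_const

theorem IsKernel.hasDerivAt_transform (hk : IsKernel k B) {z : ℂ} (hz : |z.im| < B) :
    HasDerivAt (transform k) (transformDeriv k z) z := by
  obtain ⟨a, R, δ, haB, hδ, hball⟩ := exists_ball_subset_strip hz
  have key := hasDerivAt_integral_of_dominated_loc_of_deriv_le
    (μ := volume.restrict (Ioi (0 : ℝ)))
    (F := fun (z : ℂ) (y : ℝ) =>
      (Complex.sin (2 * (y : ℂ) * z) - 2 * (y : ℂ) * z) * (k y : ℂ) / (y : ℂ))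
    (F' := fun (z : ℂ) (y : ℝ) => 2 * (Complex.cos (2 * (y : ℂ) * z) - 1) * (k y : ℂ))
    (bound := fun y => 8 * R ^ 2 * (y ^ 2 * Real.exp (2 * a * y) * k y))
    (Metric.ball_mem_nhds z hδ) (Eventually.of_forall hk.aestronglyMeasurable_sin_sub)
    (hk.integrableOn_sin_sub hz) (hk.aestronglyMeasurable_cos_sub z)
    ((ae_restrict_iff' measurableSet_Ioi).2 (ae_of_all _ fun y hy w hw =>
      hk.norm_cos_sub_mul_le hy (hball w hw).1 (hball w hw).2))
    ((hk.integrable_exp a haB).const_mul _)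
    ((ae_restrict_iff' measurableSet_Ioi).2 (ae_of_all _ fun y hy w _ => by
      have hy0 : (y : ℂ) ≠ 0 := by exact_mod_cast (ne_of_gt hy)
      have h := hasDerivAt_two_mul y w
      refine (((h.csin.sub h).mul_const (k y : ℂ)).div_const (y : ℂ)).congr_deriv ?_
      field_simp))
  have h2 := key.2.add (((hasDerivAt_id z).const_mul 2).mul_const
    ((∫ y in Ioi (0 : ℝ), (k y - 1 / (2 * y ^ 2)) : ℝ) : ℂ))
  refine (h2.congr_of_eventuallyEq ?_).congr_deriv ?_
  · filter_upwards [(isOpen_strip B).mem_nhds hz] with w hw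
    exact hk.transform_eq hw
  · rw [transformDeriv]; ring

theorem IsKernel.hasDerivAt_transformDeriv (hk : IsKernel k B) {z : ℂ} (hz : |z.im| < B) :
    HasDerivAt (transformDeriv k)
      (∫ y in Ioi (0 : ℝ), -(4 * (y : ℂ) * Complex.sin (2 * (y : ℂ) * z) * (k y : ℂ))) z := by
  obtain ⟨a, R, δ, haB, hδ, hball⟩ := exists_ball_subset_strip hz
  have key := hasDerivAt_integral_of_dominated_loc_of_deriv_le
    (μ := volume.restrict (Ioi (0 : ℝ)))
    (F := fun (z : ℂ) (y : ℝ) => 2 * (Complex.cos (2 * (y : ℂ) * z) - 1) * (k y : ℂ))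
    (F' := fun (z : ℂ) (y : ℝ) => -(4 * (y : ℂ) * Complex.sin (2 * (y : ℂ) * z) * (k y : ℂ)))
    (bound := fun y => 8 * R * (y ^ 2 * Real.exp (2 * a * y) * k y))
    (Metric.ball_mem_nhds z hδ) (Eventually.of_forall hk.aestronglyMeasurable_cos_sub)
    (hk.integrableOn_cos_sub hz) (hk.aestronglyMeasurable (by fun_prop)).neg
    ((ae_restrict_iff' measurableSet_Ioi).2 (ae_of_all _ fun y hy w hw =>
      hk.norm_mul_sin_mul_le hy (hball w hw).1 (hball w hw).2))
    ((hk.integrable_exp a haB).const_mul _)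
    ((ae_restrict_iff' measurableSet_Ioi).2 (ae_of_all _ fun y hy w _ => by
      have h := hasDerivAt_two_mul y w
      refine (((h.ccos.sub_const 1).const_mul 2).mul_const (k y : ℂ)).congr_deriv ?_
      ring))
  exact key.2.const_add _

/-- The integral `∫₀^∞ (1 - cos 2yt) / y² dy`. -/
noncomputable def cosIntegral (t : ℝ) : ℝ :=
  ∫ y in Ioi (0 : ℝ), (1 - Real.cos (2 * y * t)) / y ^ 2

theorem integrableOn_cosIntegral (t : ℝ) :
    IntegrableOn (fun y : ℝ => (1 - Real.cos (2 * y * t)) / y ^ 2) (Ioi 0) := by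
  refine (integrable_inv_one_add_sq.integrableOn.const_mul (2 * t ^ 2 + 2)).mono'
    (ContinuousOn.aestronglyMeasurable (ContinuousOn.div (by fun_prop) (by fun_prop)
      fun y hy => pow_ne_zero 2 (ne_of_gt hy)) measurableSet_Ioi)
    ((ae_restrict_iff' measurableSet_Ioi).2 (ae_of_all _ fun y hy => ?_))
  have hy0 : (0 : ℝ) < y := hy
  have h1 := Real.one_sub_sq_div_two_le_cos (x := 2 * y * t)
  have h2 := Real.neg_one_le_cos (2 * y * t)
  have h3 := Real.cos_le_one (2 * y * t)
  rw [Real.norm_of_nonneg (div_nonneg (by linarith) (by positivity)), ← div_eq_mul_inv,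
    div_le_div_iff₀ (by positivity) (by positivity)]
  nlinarith

/-- A bound for the difference between `im (transform k)` and its leading term. -/
noncomputable def growthBound (k : ℝ → ℝ) (a : ℝ) : ℝ :=
  8 * a ^ 3 * (∫ y in Ioi (0 : ℝ), y ^ 2 * Real.exp (2 * a * y) * k y) +
    6 * a * ∫ y in Ioi (0 : ℝ), |k y - 1 / (2 * y ^ 2)|

theorem IsKernel.abs_integral_cos_sub_le (hk : IsKernel k B) (t : ℝ) :
    |∫ y in Ioi (0 : ℝ), (Real.cos (2 * y * t) - 1) * (k y - 1 / (2 * y ^ 2))| ≤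
      2 * ∫ y in Ioi (0 : ℝ), |k y - 1 / (2 * y ^ 2)| := by
  rw [← integral_const_mul, ← Real.norm_eq_abs]
  refine norm_integral_le_of_norm_le (hk.integrable_sub.abs.const_mul 2) (ae_of_all _ fun y => ?_)
  rw [norm_mul, Real.norm_eq_abs, Real.norm_eq_abs]
  gcongr
  rw [abs_le]; constructor <;> linarith [Real.cos_le_one (2 * y * t), Real.neg_one_le_cos (2 * y * t)]

theorem IsKernel.integrableOn_cos_sub_mul (hk : IsKernel k B) (t : ℝ) :
    IntegrableOn (fun y => (Real.cos (2 * y * t) - 1) * (k y - 1 / (2 * y ^ 2))) (Ioi 0) :=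
  hk.integrable_sub.bdd_mul (c := 2) (by fun_prop) (ae_of_all _ fun y => by
    rw [Real.norm_eq_abs, abs_le]
    constructor <;> linarith [Real.cos_le_one (2 * y * t), Real.neg_one_le_cos (2 * y * t)])

/-- The imaginary part of `sin (2y(t + iη))` is `cos (2yt) sinh (2yη)`. Replacing `sinh x` by `x`
and `k y` by `1 / (2 y²)` leaves exactly `-η cosIntegral t`; both replacements cost an amount
independent of `t`. This controls the integrand at infinity. -/
theorem IsKernel.abs_im_transform_add_le (hk : IsKernel k B) {t η a : ℝ} (hη : |η| ≤ a)
    (ha : a < B) :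
    |(transform k (t + Complex.I * η)).im + η * cosIntegral t| ≤ growthBound k a := by
  set z : ℂ := t + Complex.I * η with hz
  have him : z.im = η := by simp [hz]
  have hzB : |z.im| < B := by rw [him]; linarith
  have hIm : (transform k z).im =
      ∫ y in Ioi (0 : ℝ), ((Complex.sin (2 * (y : ℂ) * z) * (k y : ℂ) - z / (y : ℂ)) / (y : ℂ)).im :=
    (integral_im (𝕜 := ℂ) (hk.integrableOn_transform hzB)).symm
  have hpt : ∀ y ∈ Ioi (0 : ℝ),
      ((Complex.sin (2 * (y : ℂ) * z) * (k y : ℂ) - z / (y : ℂ)) / (y : ℂ)).im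
        + η * ((1 - Real.cos (2 * y * t)) / y ^ 2) =
      Real.cos (2 * y * t) * ((Real.sinh (2 * y * η) - 2 * y * η) * k y / y)
        + 2 * η * ((Real.cos (2 * y * t) - 1) * (k y - 1 / (2 * y ^ 2)) + (k y - 1 / (2 * y ^ 2))) := by
    intro y hy
    have hy0 : y ≠ 0 := ne_of_gt hy
    have e1 : 2 * (y : ℂ) * z = ((2 * y * t : ℝ) : ℂ) + ((2 * y * η : ℝ) : ℂ) * Complex.I := by
      rw [hz]; push_cast; ring
    rw [e1, Complex.sin_add_mul_I, ← Complex.ofReal_sin, ← Complex.ofReal_cos,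
      ← Complex.ofReal_cosh, ← Complex.ofReal_sinh, Complex.div_ofReal_im, Complex.sub_im,
      Complex.div_ofReal_im, Complex.im_mul_ofReal, him]
    have : ((Real.sin (2 * y * t) : ℂ) * (Real.cosh (2 * y * η) : ℂ) +
        (Real.cos (2 * y * t) : ℂ) * (Real.sinh (2 * y * η) : ℂ) * Complex.I).im =
        Real.cos (2 * y * t) * Real.sinh (2 * y * η) := by
      rw [← Complex.ofReal_mul, ← Complex.ofReal_mul, Complex.add_im, Complex.ofReal_im,
        Complex.im_ofReal_mul, Complex.I_im, mul_one, zero_add]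
    rw [this]
    field_simp
    ring
  have hb : ∀ y ∈ Ioi (0 : ℝ), ‖Real.cos (2 * y * t) * ((Real.sinh (2 * y * η) - 2 * y * η) * k y / y)‖
      ≤ 8 * a ^ 3 * (y ^ 2 * Real.exp (2 * a * y) * k y) := by
    intro y hy
    have h := hk.norm_sin_sub_mul_le (z := Complex.I * η) hy (a := a) (R := a) (by simpa using hη)
      (by simpa using hη)
    have e1 : 2 * (y : ℂ) * (Complex.I * η) = ((2 * y * η : ℝ) : ℂ) * Complex.I := by push_cast; ring
    have e2 : (Complex.sin (2 * (y : ℂ) * (Complex.I * η)) - 2 * (y : ℂ) * (Complex.I * η)) * (k y : ℂ)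
        / (y : ℂ) = (((Real.sinh (2 * y * η) - 2 * y * η) * k y / y : ℝ) : ℂ) * Complex.I := by
      rw [e1, Complex.sin_mul_I, ← Complex.ofReal_sinh]; push_cast; ring
    rw [e2, norm_mul, Complex.norm_I, mul_one, Complex.norm_real] at h
    rw [norm_mul]
    refine le_trans (mul_le_of_le_one_left (norm_nonneg _) ?_) h
    exact Real.abs_cos_le_one _
  have hiA : IntegrableOn (fun y => Real.cos (2 * y * t) *
      ((Real.sinh (2 * y * η) - 2 * y * η) * k y / y)) (Ioi 0) := by
    refine ((hk.integrable_exp a ha).const_mul (8 * a ^ 3)).mono' ?_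
      ((ae_restrict_iff' measurableSet_Ioi).2 (ae_of_all _ hb))
    refine ContinuousOn.aestronglyMeasurable ((by fun_prop : ContinuousOn _ _).mul (ContinuousOn.div
      ((by fun_prop : ContinuousOn _ _).mul hk.continuousOn) (by fun_prop)
      fun y hy => ne_of_gt hy)) measurableSet_Ioi
  have hbA : |∫ y in Ioi (0 : ℝ), Real.cos (2 * y * t) *
      ((Real.sinh (2 * y * η) - 2 * y * η) * k y / y)| ≤
      8 * a ^ 3 * ∫ y in Ioi (0 : ℝ), y ^ 2 * Real.exp (2 * a * y) * k y := by
    rw [← integral_const_mul, ← Real.norm_eq_abs]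
    exact norm_integral_le_of_norm_le ((hk.integrable_exp a ha).const_mul _)
      ((ae_restrict_iff' measurableSet_Ioi).2 (ae_of_all _ hb))
  have hcos := hk.abs_integral_cos_sub_le t
  have hsum : (transform k z).im + η * cosIntegral t =
      (∫ y in Ioi (0 : ℝ), Real.cos (2 * y * t) * ((Real.sinh (2 * y * η) - 2 * y * η) * k y / y))
      + 2 * η * ((∫ y in Ioi (0 : ℝ), (Real.cos (2 * y * t) - 1) * (k y - 1 / (2 * y ^ 2)))
        + ∫ y in Ioi (0 : ℝ), (k y - 1 / (2 * y ^ 2))) := by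
    have him' : IntegrableOn (fun y : ℝ =>
        ((Complex.sin (2 * (y : ℂ) * z) * (k y : ℂ) - z / (y : ℂ)) / (y : ℂ)).im) (Ioi 0) :=
      (hk.integrableOn_transform hzB).im
    have hiB : IntegrableOn (fun y => 2 * η * ((Real.cos (2 * y * t) - 1) *
        (k y - 1 / (2 * y ^ 2)) + (k y - 1 / (2 * y ^ 2)))) (Ioi 0) :=
      ((hk.integrableOn_cos_sub_mul t).add hk.integrable_sub).const_mul (2 * η)
    rw [hIm, cosIntegral, ← integral_const_mul, ← integral_add him' ((integrableOn_cosIntegral t).const_mul η),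
      ← integral_add (hk.integrableOn_cos_sub_mul t) hk.integrable_sub, ← integral_const_mul,
      ← integral_add hiA hiB]
    exact setIntegral_congr_fun measurableSet_Ioi hpt
  have h0 : |∫ y in Ioi (0 : ℝ), (k y - 1 / (2 * y ^ 2))| ≤
      ∫ y in Ioi (0 : ℝ), |k y - 1 / (2 * y ^ 2)| := abs_integral_le_integral_abs
  have hJ : 0 ≤ ∫ y in Ioi (0 : ℝ), |k y - 1 / (2 * y ^ 2)| := integral_nonneg fun _ => abs_nonneg _
  rw [hsum, growthBound]
  refine (abs_add_le _ _).trans (add_le_add hbA ?_)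
  rw [abs_mul, abs_mul, abs_two]
  calc _ ≤ 2 * a * (2 * (∫ y in Ioi (0 : ℝ), |k y - 1 / (2 * y ^ 2)|) +
        ∫ y in Ioi (0 : ℝ), |k y - 1 / (2 * y ^ 2)|) := by
        gcongr
        · linarith [abs_nonneg η]
        · exact (abs_add_le _ _).trans (add_le_add hcos h0)
    _ = _ := by ring

/-- Read backwards for `kernZero`, whose transform is explicit, this gives the growth of
`cosIntegral`. -/
theorem IsKernel.norm_transformDeriv_add_le (hk : IsKernel k B) (t : ℝ) :
    ‖transformDeriv k t + (cosIntegral t : ℂ)‖ ≤ 6 * ∫ y in Ioi (0 : ℝ), |k y - 1 / (2 * y ^ 2)| := by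
  have e : ∀ y ∈ Ioi (0 : ℝ), 2 * (Complex.cos (2 * (y : ℂ) * t) - 1) * (k y : ℂ) =
      ((2 * ((Real.cos (2 * y * t) - 1) * (k y - 1 / (2 * y ^ 2)))
        - (1 - Real.cos (2 * y * t)) / y ^ 2 : ℝ) : ℂ) := by
    intro y hy
    have : (y : ℂ) ≠ 0 := by exact_mod_cast (ne_of_gt hy)
    push_cast
    field_simp
    ring
  have hcos := hk.abs_integral_cos_sub_le t
  have h0 : |∫ y in Ioi (0 : ℝ), (k y - 1 / (2 * y ^ 2))| ≤
      ∫ y in Ioi (0 : ℝ), |k y - 1 / (2 * y ^ 2)| := abs_integral_le_integral_abs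
  rw [transformDeriv, setIntegral_congr_fun measurableSet_Ioi e, integral_complex_ofReal,
    integral_sub ((hk.integrableOn_cos_sub_mul t).const_mul 2) (integrableOn_cosIntegral t),
    integral_const_mul, ← cosIntegral]
  set I1 := ∫ y in Ioi (0 : ℝ), (k y - 1 / (2 * y ^ 2))
  set I2 := ∫ y in Ioi (0 : ℝ), (Real.cos (2 * y * t) - 1) * (k y - 1 / (2 * y ^ 2))
  set I3 := ∫ y in Ioi (0 : ℝ), |k y - 1 / (2 * y ^ 2)|
  rw [show (2 * (I1 : ℂ) + ((2 * I2 - cosIntegral t : ℝ) : ℂ) + (cosIntegral t : ℂ)) =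
    ((2 * I1 + 2 * I2 : ℝ) : ℂ) by push_cast; ring, Complex.norm_real, Real.norm_eq_abs]
  refine (abs_add_le _ _).trans ?_
  rw [abs_mul, abs_mul, abs_two]
  linarith

end HyperbolicQ

/-! ### The kernels `kern` and `kernZero` and their comparison -/

namespace HyperbolicQ

open Set Filter MeasureTheory

section SinhBounds

variable {y : ℝ}

theorem div_sinh_le (hy : 0 < y) : y / Real.sinh y ≤ (1 + 2 * y) * Real.exp (-y) := by
  have hs : 0 < Real.sinh y := Real.sinh_pos_iff.2 hy
  have h1 := Real.add_one_le_exp (2 * y)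
  have h2 : Real.exp (2 * y) = Real.exp y * Real.exp y := by rw [← Real.exp_add]; ring_nf
  have h3 : Real.exp (-y) * Real.exp y = 1 := by rw [← Real.exp_add]; simp
  have hp := Real.exp_pos (-y)
  rw [div_le_iff₀ hs, Real.sinh_eq]
  have h4 : Real.exp (-y) * Real.exp (-y) * (2 * y + 1) ≤ 1 := by
    calc _ ≤ Real.exp (-y) * Real.exp (-y) * Real.exp (2 * y) := by gcongr
      _ = (Real.exp (-y) * Real.exp y) ^ 2 := by rw [h2]; ring
      _ = 1 := by rw [h3]; norm_num
  have h5 : (1 + 2 * y) * Real.exp (-y) * ((Real.exp y - Real.exp (-y)) / 2) =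
      ((1 + 2 * y) - Real.exp (-y) * Real.exp (-y) * (2 * y + 1)) / 2 := by
    linear_combination ((1 + 2 * y) / 2) * h3
  rw [h5]; linarith

theorem inv_sinh_le_inv (hy : 0 < y) : 1 / Real.sinh y ≤ 1 / y :=
  one_div_le_one_div_of_le hy (Real.self_le_sinh_iff.2 hy.le)

/-- For `y < 1` the claim amounts to `(1 - y²) sinh y ≤ y`, which follows from `sinh y ≤ y cosh y`,
`cosh y ≤ e^{y²/2}` and `1 - y² ≤ e^{-y²}`. For `y ≥ 1` already `1 / y ≤ y`. -/
theorem inv_sub_inv_sinh_le (hy : 0 < y) : 1 / y - 1 / Real.sinh y ≤ y := by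
  have hs : 0 < Real.sinh y := Real.sinh_pos_iff.2 hy
  rcases le_or_gt 1 y with h1 | h1
  · have : 1 / y ≤ 1 := by rw [div_le_one hy]; exact h1
    have : 0 < 1 / Real.sinh y := by positivity
    linarith
  · have hc : Real.sinh y ≤ y * Real.cosh y := by
      have h := norm_image_sub_le_of_norm_deriv_le_segment' (f := Real.sinh) (f' := Real.cosh)
        (C := Real.cosh y) (a := 0) (b := y) (fun x _ => (Real.hasDerivAt_sinh x).hasDerivWithinAt)
        (fun x hx => by
          rw [Real.norm_of_nonneg (Real.cosh_pos x).le]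
          exact Real.cosh_le_cosh.2 (by rw [abs_of_nonneg hx.1, abs_of_pos hy]; exact hx.2.le))
        y ⟨hy.le, le_rfl⟩
      rw [Real.sinh_zero, sub_zero, sub_zero, Real.norm_of_nonneg hs.le] at h
      linarith
    have he : Real.cosh y * (1 - y ^ 2) ≤ 1 := by
      have h2 := Real.cosh_le_exp_half_sq y
      have h3 := Real.add_one_le_exp (-(y ^ 2))
      have h4 : Real.exp (y ^ 2 / 2) ≤ Real.exp (y ^ 2) := Real.exp_le_exp.2 (by nlinarith)
      have h5 : (0 : ℝ) ≤ 1 - y ^ 2 := by nlinarith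
      calc _ ≤ Real.exp (y ^ 2) * (1 - y ^ 2) := by gcongr; exact h2.trans h4
        _ ≤ Real.exp (y ^ 2) * Real.exp (-(y ^ 2)) := by gcongr; linarith
        _ = 1 := by rw [← Real.exp_add]; simp
    rw [div_sub_div _ _ hy.ne' hs.ne', div_le_iff₀ (by positivity)]
    have h5 : (0 : ℝ) ≤ 1 - y ^ 2 := by nlinarith
    nlinarith [mul_le_mul_of_nonneg_right hc h5]

theorem one_add_mul_le (c ε : ℝ) (hε : 0 < ε) (hc : 0 ≤ c) (hy : 0 < y) :
    1 + c * y ≤ (1 + c / ε) * Real.exp (ε * y) := by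
  have h1 := Real.add_one_le_exp (ε * y)
  have h2 : (1 : ℝ) ≤ Real.exp (ε * y) := Real.one_le_exp (by positivity)
  have h3 : c / ε * (ε * y + 1) ≤ c / ε * Real.exp (ε * y) := by gcongr
  have h4 : c / ε * (ε * y + 1) = c * y + c / ε := by field_simp
  have h5 : 0 ≤ c / ε := by positivity
  nlinarith

/-- Each linear factor is absorbed by `e^{ay/4}`, leaving the decay `e^{-ay/2}`. -/
theorem integrableOn_one_add_mul_exp {a c d : ℝ} (ha : 0 < a) (hc : 0 ≤ c) (hd : 0 ≤ d) :
    IntegrableOn (fun y : ℝ => (1 + c * y) * (1 + d * y) * Real.exp (-a * y)) (Ioi 0) := by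
  refine ((exp_neg_integrableOn_Ioi 0 (half_pos ha)).const_mul
    ((1 + c / (a / 4)) * (1 + d / (a / 4)))).mono' (by fun_prop)
    ((ae_restrict_iff' measurableSet_Ioi).2 (ae_of_all _ fun y hy => ?_))
  have hy0 : (0 : ℝ) < y := hy
  rw [Real.norm_of_nonneg (by positivity)]
  calc _ ≤ ((1 + c / (a / 4)) * Real.exp (a / 4 * y)) * ((1 + d / (a / 4)) * Real.exp (a / 4 * y)) *
        Real.exp (-a * y) := by
        gcongr
        · exact one_add_mul_le c _ (by positivity) hc hy0
        · exact one_add_mul_le d _ (by positivity) hd hy0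
    _ = (1 + c / (a / 4)) * (1 + d / (a / 4)) *
        (Real.exp (a / 4 * y) * Real.exp (a / 4 * y) * Real.exp (-a * y)) := by ring
    _ = _ := by
        rw [← Real.exp_add, ← Real.exp_add]
        congr 2; ring

end SinhBounds

/-- The kernel of the hyperbolic gamma function with `β = b ^ 2`, after rescaling. -/
noncomputable def kern (β y : ℝ) : ℝ := β / (2 * Real.sinh y * Real.sinh (β * y))

/-- The semiclassical limit of `kern β`. -/
noncomputable def kernZero (y : ℝ) : ℝ := 1 / (2 * y * Real.sinh y)

theorem continuousOn_kernZero : ContinuousOn kernZero (Ioi 0) := by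
  unfold kernZero
  refine ContinuousOn.div (by fun_prop) (by fun_prop) fun y hy => ?_
  have hy0 : (0 : ℝ) < y := hy
  have := Real.sinh_pos_iff.2 hy0
  positivity

theorem continuousOn_kern {β : ℝ} (hβ : 0 < β) : ContinuousOn (kern β) (Ioi 0) := by
  unfold kern
  refine ContinuousOn.div (by fun_prop) (by fun_prop) fun y hy => ?_
  have hy0 : (0 : ℝ) < y := hy
  have h1 := Real.sinh_pos_iff.2 hy0
  have h2 := Real.sinh_pos_iff.2 (mul_pos hβ hy0)
  positivity

theorem kernZero_nonneg {y : ℝ} (hy : 0 < y) : 0 ≤ kernZero y := by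
  have := Real.sinh_pos_iff.2 hy
  unfold kernZero; positivity

theorem kern_nonneg {β y : ℝ} (hβ : 0 < β) (hy : 0 < y) : 0 ≤ kern β y := by
  have h1 := Real.sinh_pos_iff.2 hy
  have h2 := Real.sinh_pos_iff.2 (mul_pos hβ hy)
  unfold kern; positivity

theorem integrable_kernZero_exp {a : ℝ} (ha : a < 1 / 2) :
    IntegrableOn (fun y => y ^ 2 * Real.exp (2 * a * y) * kernZero y) (Ioi 0) := by
  refine (integrableOn_one_add_mul_exp (a := 1 - 2 * a) (c := 2) (d := 0) (by linarith)
    (by norm_num) le_rfl).mono' (ContinuousOn.aestronglyMeasurable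
      ((by fun_prop : ContinuousOn _ _).mul continuousOn_kernZero) measurableSet_Ioi)
    ((ae_restrict_iff' measurableSet_Ioi).2 (ae_of_all _ fun y hy => ?_))
  have hy0 : (0 : ℝ) < y := hy
  have hs := Real.sinh_pos_iff.2 hy0
  have hk := kernZero_nonneg hy0
  rw [Real.norm_of_nonneg (by positivity)]
  calc _ = Real.exp (2 * a * y) * (y / Real.sinh y) / 2 := by
        unfold kernZero; field_simp
    _ ≤ Real.exp (2 * a * y) * (y / Real.sinh y) := by
        have : 0 ≤ Real.exp (2 * a * y) * (y / Real.sinh y) := by positivity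
        linarith
    _ ≤ Real.exp (2 * a * y) * ((1 + 2 * y) * Real.exp (-y)) := by gcongr; exact div_sinh_le hy0
    _ = (1 + 2 * y) * (1 + 0 * y) * (Real.exp (2 * a * y) * Real.exp (-y)) := by ring
    _ = _ := by rw [← Real.exp_add]; congr 2; ring

/-- The product of the two hyperbolic sines supplies the decay `e^{-(1+β)y}` up to polynomial
factors; hence the half-width `(1 + β)/2` of the strip, which is `Q/2` before rescaling. -/
theorem integrable_kern_exp {β a : ℝ} (hβ : 0 < β) (ha : a < (1 + β) / 2) :
    IntegrableOn (fun y => y ^ 2 * Real.exp (2 * a * y) * kern β y) (Ioi 0) := by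
  refine (integrableOn_one_add_mul_exp (a := 1 + β - 2 * a) (c := 2) (d := 2 * β) (by linarith)
    (by norm_num) (by positivity)).mono' (ContinuousOn.aestronglyMeasurable
      ((by fun_prop : ContinuousOn _ _).mul (continuousOn_kern hβ)) measurableSet_Ioi)
    ((ae_restrict_iff' measurableSet_Ioi).2 (ae_of_all _ fun y hy => ?_))
  have hy0 : (0 : ℝ) < y := hy
  have hβy : 0 < β * y := mul_pos hβ hy0
  have hs := Real.sinh_pos_iff.2 hy0
  have hs2 := Real.sinh_pos_iff.2 hβy
  have hk := kern_nonneg hβ hy0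
  rw [Real.norm_of_nonneg (by positivity)]
  calc _ = Real.exp (2 * a * y) * ((y / Real.sinh y) * (β * y / Real.sinh (β * y))) / 2 := by
        unfold kern; field_simp
    _ ≤ Real.exp (2 * a * y) * ((y / Real.sinh y) * (β * y / Real.sinh (β * y))) := by
        have : 0 ≤ Real.exp (2 * a * y) * ((y / Real.sinh y) * (β * y / Real.sinh (β * y))) := by
          positivity
        linarith
    _ ≤ Real.exp (2 * a * y) * (((1 + 2 * y) * Real.exp (-y)) *
        ((1 + 2 * (β * y)) * Real.exp (-(β * y)))) := by
        gcongr
        · exact div_sinh_le hy0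
        · exact div_sinh_le hβy
    _ = (1 + 2 * y) * (1 + 2 * β * y) *
        (Real.exp (2 * a * y) * Real.exp (-y) * Real.exp (-(β * y))) := by ring
    _ = _ := by rw [← Real.exp_add, ← Real.exp_add]; congr 2; ring

theorem integrable_kernZero_sub :
    IntegrableOn (fun y => kernZero y - 1 / (2 * y ^ 2)) (Ioi 0) := by
  refine (integrable_inv_one_add_sq.integrableOn).mono' (ContinuousOn.aestronglyMeasurable
      (continuousOn_kernZero.sub (ContinuousOn.div (by fun_prop) (by fun_prop)
      fun y hy => ?_)) measurableSet_Ioi)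
    ((ae_restrict_iff' measurableSet_Ioi).2 (ae_of_all _ fun y hy => ?_))
  · have hy0 : (0 : ℝ) < y := hy
    positivity
  have hy0 : (0 : ℝ) < y := hy
  have hs := Real.sinh_pos_iff.2 hy0
  have h1 := inv_sinh_le_inv hy0
  have h2 := inv_sub_inv_sinh_le hy0
  have h3 : 0 < 1 / Real.sinh y := by positivity
  have e : kernZero y - 1 / (2 * y ^ 2) = -((1 / y - 1 / Real.sinh y) / (2 * y)) := by
    unfold kernZero; field_simp; ring
  set d := 1 / y - 1 / Real.sinh y with hd
  have hd0 : 0 ≤ d := by linarith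
  have hdy : y * d ≤ 1 := by
    calc y * d ≤ y * (1 / y) := by gcongr; linarith
      _ = 1 := by field_simp
  rw [e, norm_neg, Real.norm_of_nonneg (by positivity), ← one_div,
    div_le_div_iff₀ (by positivity) (by positivity)]
  nlinarith

/-- This is `inv_sub_inv_sinh_le` at `βy`. The error is of order `β²`, so one power of `β` survives
the division by `β` in the exponent. -/
theorem abs_kern_sub_kernZero_le {β y : ℝ} (hβ : 0 < β) (hy : 0 < y) :
    |kern β y - kernZero y| ≤ β ^ 2 * (y ^ 2 * kernZero y) := by
  have hβy : 0 < β * y := mul_pos hβ hy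
  have hs := Real.sinh_pos_iff.2 hy
  have hs2 := Real.sinh_pos_iff.2 hβy
  have h1 := inv_sinh_le_inv hβy
  have h2 := inv_sub_inv_sinh_le hβy
  have e : kern β y - kernZero y =
      -(β / (2 * Real.sinh y) * (1 / (β * y) - 1 / Real.sinh (β * y))) := by
    unfold kern kernZero; field_simp; ring
  rw [e, abs_neg, abs_of_nonneg (mul_nonneg (by positivity) (by linarith))]
  calc _ ≤ β / (2 * Real.sinh y) * (β * y) := by gcongr
    _ = _ := by unfold kernZero; field_simp

theorem isKernel_kernZero : IsKernel kernZero (1 / 2) :=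
  ⟨fun _ => kernZero_nonneg, continuousOn_kernZero, integrable_kernZero_sub,
    fun _ => integrable_kernZero_exp⟩

theorem integrable_kern_sub {β : ℝ} (hβ : 0 < β) :
    IntegrableOn (fun y => kern β y - 1 / (2 * y ^ 2)) (Ioi 0) := by
  have h : IntegrableOn (fun y => kern β y - kernZero y) (Ioi 0) := by
    refine ((integrable_kernZero_exp (a := 0) (by norm_num)).const_mul (β ^ 2)).mono'
      (((continuousOn_kern hβ).sub continuousOn_kernZero).aestronglyMeasurable measurableSet_Ioi)
      ((ae_restrict_iff' measurableSet_Ioi).2 (ae_of_all _ fun y hy => ?_))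
    simpa using abs_kern_sub_kernZero_le hβ hy
  refine (h.add integrable_kernZero_sub).congr (ae_of_all _ fun y => ?_)
  simp

theorem isKernel_kern {β : ℝ} (hβ : 0 < β) : IsKernel (kern β) ((1 + β) / 2) :=
  ⟨fun _ => kern_nonneg hβ, continuousOn_kern hβ, integrable_kern_sub hβ,
    fun _ => integrable_kern_exp hβ⟩

/-- The constant in the comparison of `transform (kern β)` with its limit. -/
noncomputable def comparisonBound (a : ℝ) : ℝ :=
  2 * ∫ y in Ioi (0 : ℝ), y ^ 2 * Real.exp (2 * a * y) * kernZero y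

/-- The counterterms `z / y` cancel in the difference, so the error grows only linearly in `z`. -/
theorem norm_transform_kern_sub_le {β a : ℝ} (hβ : 0 < β) (ha : a < 1 / 2) {z : ℂ}
    (hz : |z.im| ≤ a) :
    ‖transform (kern β) z - transform kernZero z‖ ≤ β ^ 2 * ‖z‖ * comparisonBound a := by
  have h1 := (isKernel_kern hβ).integrableOn_transform (z := z) (by linarith)
  have h2 := isKernel_kernZero.integrableOn_transform (z := z) (by linarith)
  rw [transform, transform, ← integral_sub h1 h2, comparisonBound, ← mul_assoc,
    ← integral_const_mul]
  refine norm_integral_le_of_norm_le ((integrable_kernZero_exp ha).const_mul _)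
    ((ae_restrict_iff' measurableSet_Ioi).2 (ae_of_all _ fun y hy => ?_))
  have hy0 : (0 : ℝ) < y := hy
  have hk := kernZero_nonneg hy0
  have e : (Complex.sin (2 * (y : ℂ) * z) * (kern β y : ℂ) - z / (y : ℂ)) / (y : ℂ) -
      (Complex.sin (2 * (y : ℂ) * z) * (kernZero y : ℂ) - z / (y : ℂ)) / (y : ℂ) =
      Complex.sin (2 * (y : ℂ) * z) * ((kern β y - kernZero y : ℝ) : ℂ) / (y : ℂ) := by
    push_cast; ring
  have h := norm_sin_le_mul (2 * (y : ℂ) * z)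
  rw [abs_im_two_mul_ofReal_mul hy0, norm_two_mul_ofReal_mul hy0] at h
  rw [e, norm_div, norm_mul, Complex.norm_real, Complex.norm_real, Real.norm_of_nonneg hy0.le,
    Real.norm_eq_abs, div_le_iff₀ hy0]
  calc _ ≤ (2 * y * ‖z‖ * Real.exp (2 * |z.im| * y)) * (β ^ 2 * (y ^ 2 * kernZero y)) := by
        gcongr; exact abs_kern_sub_kernZero_le hβ hy0
    _ ≤ (2 * y * ‖z‖ * Real.exp (2 * a * y)) * (β ^ 2 * (y ^ 2 * kernZero y)) := by gcongr
    _ = _ := by ring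

/-- Substitution of `b y` for `y`. -/
theorem sb_div_eq {b : ℝ} (hb : 0 < b) (z : ℂ) :
    sb b (z / b) = Complex.exp (Complex.I / (b : ℂ) ^ 2 * transform (kern (b ^ 2)) z) := by
  have hbC : (b : ℂ) ≠ 0 := by exact_mod_cast hb.ne'
  have h := integral_comp_mul_left_Ioi' (fun y : ℝ =>
    (Complex.sin (2 * (y : ℂ) * (z / b)) /
      (2 * (Real.sinh (b⁻¹ * y) : ℂ) * (Real.sinh (b * y) : ℂ))
      - z / b / (y : ℂ)) / (y : ℂ)) 0 hb
  rw [mul_zero] at h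
  rw [sb, ← h, transform]
  congr 1
  rw [Complex.real_smul, ← integral_const_mul, ← integral_const_mul, ← integral_const_mul]
  refine setIntegral_congr_fun measurableSet_Ioi fun y hy => ?_
  have hy0 : (0 : ℝ) < y := hy
  have hyC : (y : ℂ) ≠ 0 := by exact_mod_cast hy0.ne'
  have hs : (Real.sinh y : ℂ) ≠ 0 := by exact_mod_cast (Real.sinh_pos_iff.2 hy0).ne'
  have hs2 : (Real.sinh (b ^ 2 * y) : ℂ) ≠ 0 := by
    exact_mod_cast (Real.sinh_pos_iff.2 (by positivity : 0 < b ^ 2 * y)).ne'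
  have e1 : b⁻¹ * (b * y) = y := by field_simp
  have e2 : b * (b * y) = b ^ 2 * y := by ring
  have e3 : 2 * ((b * y : ℝ) : ℂ) * (z / b) = 2 * (y : ℂ) * z := by push_cast; field_simp
  simp only [e1, e2, e3, kern]
  push_cast at hs hs2 ⊢
  field_simp

/-! ### The limiting transform in closed form -/

section Limit

theorem hasSum_inv_sinh {y : ℝ} (hy : 0 < y) :
    HasSum (fun n : ℕ => 2 * Real.exp (-(2 * n + 1) * y)) (1 / Real.sinh y) := by
  have hlt : Real.exp (-(2 * y)) < 1 := Real.exp_lt_one_iff.2 (by linarith)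
  have h := (hasSum_geometric_of_lt_one (Real.exp_pos (-(2 * y))).le hlt).mul_left
    (2 * Real.exp (-y))
  have hs := Real.sinh_pos_iff.2 hy
  have e1 : Real.exp (-(2 * y)) = Real.exp (-y) * Real.exp (-y) := by
    rw [← Real.exp_add]; congr 1; ring
  have e2 : Real.exp y * Real.exp (-y) = 1 := by rw [← Real.exp_add]; simp
  have hne : 1 - Real.exp (-(2 * y)) ≠ 0 := by linarith
  have hval : 2 * Real.exp (-y) * (1 - Real.exp (-(2 * y)))⁻¹ = 1 / Real.sinh y := by
    rw [eq_div_iff hs.ne', ← div_eq_mul_inv, div_mul_eq_mul_div, div_eq_iff hne, Real.sinh_eq, e1]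
    linear_combination e2
  rw [hval] at h
  refine h.congr_fun fun n => ?_
  rw [← Real.exp_nat_mul, mul_assoc, ← Real.exp_add]
  congr 2; ring

theorem integral_sin_mul_exp {c : ℝ} {z : ℂ} (hz : 2 * |z.im| < c) :
    ∫ y in Ioi (0 : ℝ), Complex.sin (2 * (y : ℂ) * z) * (Real.exp (-c * y) : ℂ) =
      2 * z / ((c : ℂ) ^ 2 + 4 * z ^ 2) := by
  have h1 := abs_lt.1 (show |z.im| < c / 2 by linarith)
  set p : ℂ := -c - 2 * z * Complex.I with hp
  set q : ℂ := -c + 2 * z * Complex.I with hq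
  have hpre : p.re < 0 := by simp [hp]; linarith
  have hqre : q.re < 0 := by simp [hq]; linarith
  have hp0 : p ≠ 0 := fun h => by simp [h] at hpre
  have hq0 : q ≠ 0 := fun h => by simp [h] at hqre
  have e : ∀ y : ℝ, Complex.sin (2 * (y : ℂ) * z) * (Real.exp (-c * y) : ℂ) =
      Complex.I / 2 * Complex.exp (p * y) - Complex.I / 2 * Complex.exp (q * y) := by
    intro y
    have e1 : p * y = -(2 * (y : ℂ) * z) * Complex.I + ((-c * y : ℝ) : ℂ) := by
      rw [hp]; push_cast; ring
    have e2 : q * y = (2 * (y : ℂ) * z) * Complex.I + ((-c * y : ℝ) : ℂ) := by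
      rw [hq]; push_cast; ring
    rw [e1, e2, Complex.exp_add, Complex.exp_add, Complex.sin, Complex.ofReal_exp]
    ring
  have hpq : p * q = (c : ℂ) ^ 2 + 4 * z ^ 2 := by
    rw [hp, hq]; linear_combination (-4 * z ^ 2) * Complex.I_sq
  simp only [e]
  rw [integral_sub ((integrableOn_exp_mul_complex_Ioi hpre 0).const_mul _)
    ((integrableOn_exp_mul_complex_Ioi hqre 0).const_mul _), integral_const_mul,
    integral_const_mul, integral_exp_mul_complex_Ioi hpre, integral_exp_mul_complex_Ioi hqre,
    ← hpq]
  simp only [Complex.ofReal_zero, mul_zero, Complex.exp_zero]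
  field_simp
  rw [hp, hq]
  linear_combination (-4 * z) * Complex.I_sq

open scoped Real in
-- From `tan x = cot x - 2 cot 2x`: in the cotangent series at `2x`, the terms with even integer
-- poles make up half the series at `x`, and the remaining ones are the series of the tangent.
theorem hasSum_tan {x : ℂ} (hx : x ∈ Complex.integerComplement)
    (h2x : 2 * x ∈ Complex.integerComplement) :
    HasSum (fun n : ℕ => 8 * x / ((2 * n + 1) ^ 2 - 4 * x ^ 2)) (π * Complex.tan (π * x)) := by
  have hS := (summable_cotTerm h2x).hasSum
  have hS1 := (summable_cotTerm hx).hasSum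
  have hr := cot_series_rep' hx
  have hr2 := cot_series_rep' h2x
  have hev := ((summable_cotTerm h2x).comp_injective
    (mul_right_injective₀ (two_ne_zero' ℕ))).hasSum
  have hodd : HasSum (fun n : ℕ => cotTerm (2 * x) (2 * n + 1)) (2⁻¹ * ∑' n, cotTerm x n) := by
    refine (hS1.mul_left 2⁻¹).congr_fun fun n => ?_
    have a1 := Complex.integerComplement_add_ne_zero hx ((n : ℤ) + 1)
    have a2 := Complex.integerComplement_add_ne_zero hx (-((n : ℤ) + 1))
    push_cast at a1 a2
    rw [cotTerm, cotTerm]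
    have b1 : 2 * x + (((2 * n + 1 : ℕ) : ℂ) + 1) = 2 * (x + (n + 1)) := by push_cast; ring
    have b2 : 2 * x - (((2 * n + 1 : ℕ) : ℂ) + 1) = 2 * (x - (n + 1)) := by push_cast; ring
    rw [b1, b2, one_div, one_div, mul_inv, mul_inv]
    ring
  have htot := (hev.even_add_odd hodd).unique hS
  change _ = ∑' n : ℕ, (1 / (2 * x - (n + 1)) + 1 / (2 * x + (n + 1))) at htot
  change _ = ∑' n, cotTerm x n at hr
  rw [← hr2, ← hr] at htot
  have hval : -2 * (∑' n, ((fun n => cotTerm (2 * x) n) ∘ fun n => 2 * n) n) =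
      π * Complex.tan (π * x) := by
    have hx0 : x ≠ 0 := Complex.integerComplement.ne_zero hx
    have hsin : Complex.sin (π * x) ≠ 0 := by
      intro h
      obtain ⟨m, hm⟩ := Complex.sin_eq_zero_iff.1 h
      refine hx ⟨m, ?_⟩
      have : (π : ℂ) ≠ 0 := by exact_mod_cast Real.pi_ne_zero
      exact (mul_left_cancel₀ this (by rw [hm]; ring)).symm
    have hcos : Complex.cos (π * x) ≠ 0 := by
      intro h
      obtain ⟨m, hm⟩ := Complex.cos_eq_zero_iff.1 h
      refine h2x ⟨2 * m + 1, ?_⟩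
      have : (π : ℂ) ≠ 0 := by exact_mod_cast Real.pi_ne_zero
      refine (mul_left_cancel₀ this ?_).symm
      push_cast
      linear_combination 2 * hm
    have e : Complex.cot (π * (2 * x)) =
        (Complex.cos (π * x) ^ 2 - Complex.sin (π * x) ^ 2) /
          (2 * Complex.sin (π * x) * Complex.cos (π * x)) := by
      rw [show (π : ℂ) * (2 * x) = 2 * (π * x) by ring, Complex.cot_eq_cos_div_sin,
        Complex.cos_two_mul', Complex.sin_two_mul]
    have e2 : (∑' n, ((fun n => cotTerm (2 * x) n) ∘ fun n => 2 * n) n) =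
        π * Complex.cot (π * (2 * x)) - 1 / (2 * x) -
          2⁻¹ * (π * Complex.cot (π * x) - 1 / x) := by
      linear_combination htot
    rw [e2, e, Complex.cot_eq_cos_div_sin, Complex.tan_eq_sin_div_cos]
    field_simp
    ring
  rw [← hval]
  refine (hev.mul_left (-2)).congr_fun fun n => ?_
  have a1 := Complex.integerComplement_add_ne_zero h2x ((2 * n : ℤ) + 1)
  have a2 := Complex.integerComplement_add_ne_zero h2x (-((2 * n : ℤ) + 1))
  push_cast at a1 a2
  have a3 : (2 * (n : ℂ) + 1) ^ 2 - 4 * x ^ 2 ≠ 0 := by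
    intro h
    have : (2 * x + (2 * n + 1)) * (2 * x + -(2 * n + 1)) = 0 := by linear_combination -h
    rcases mul_eq_zero.1 this with h | h
    · exact a1 h
    · exact a2 h
  simp only [Function.comp, cotTerm]
  push_cast
  rw [← sub_eq_add_neg] at a2
  rw [div_add_div _ _ a2 a1, mul_div_assoc', div_eq_div_iff a3 (mul_ne_zero a2 a1)]
  ring

end Limit

end HyperbolicQ

namespace HyperbolicQ

open Set Filter MeasureTheory

theorem one_add_exp_mem_slitPlane {z : ℂ} (hz : |z.im| < 1 / 2) :
    1 + Complex.exp (2 * Real.pi * z) ∈ Complex.slitPlane := by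
  have hpi := Real.pi_pos
  have h1 := abs_lt.1 hz
  have him : (2 * Real.pi * z).im = 2 * Real.pi * z.im := by
    rw [show (2 * Real.pi : ℂ) = ((2 * Real.pi : ℝ) : ℂ) by push_cast; rfl, Complex.im_ofReal_mul]
  by_cases h0 : z.im = 0
  · left
    rw [Complex.add_re, Complex.exp_re, him, h0]
    simp only [Complex.one_re, mul_zero, Real.cos_zero, mul_one]
    positivity
  · right
    rw [Complex.add_im, Complex.exp_im, him, Complex.one_im, zero_add]
    refine mul_ne_zero (Real.exp_pos _).ne' fun h => ?_
    rw [Real.sin_eq_zero_iff_of_lt_of_lt (by nlinarith) (by nlinarith)] at h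
    exact h0 (by simpa [hpi.ne'] using h)

theorem one_add_exp_ne_zero {z : ℂ} (hz : |z.im| < 1 / 2) :
    1 + Complex.exp (2 * Real.pi * z) ≠ 0 :=
  Complex.slitPlane_ne_zero (one_add_exp_mem_slitPlane hz)

theorem mem_integerComplement_of_strip {z : ℂ} (hz : |z.im| < 1 / 2) (hz0 : z ≠ 0) :
    2 * (Complex.I * z) ∈ Complex.integerComplement := by
  rintro ⟨n, hn⟩
  have h1 := congrArg Complex.re hn
  have h2 := congrArg Complex.im hn
  simp only [Complex.intCast_re, Complex.intCast_im, Complex.mul_re, Complex.mul_im,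
    Complex.re_ofNat, Complex.im_ofNat, Complex.I_re, Complex.I_im] at h1 h2
  ring_nf at h1 h2
  have h3 := abs_lt.1 hz
  have hn0 : n = 0 := by
    have a1 : (-1 : ℝ) < n := by linarith
    have a2 : (n : ℝ) < 1 := by linarith
    have b1 : (-1 : ℤ) < n := by exact_mod_cast a1
    have b2 : n < (1 : ℤ) := by exact_mod_cast a2
    omega
  refine hz0 (Complex.ext ?_ ?_)
  · simp; linarith
  · rw [hn0] at h1; simp at h1 ⊢; linarith

/-- Expanding `1 / sinh y` in odd exponentials and integrating termwise gives the tangent series at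
`iz`. The value is `-π tanh (πz)`, written so as to integrate to `log (1 + e^{2πz})`. -/
theorem integral_sin_mul_kernZero {z : ℂ} (hz : |z.im| < 1 / 2) :
    ∫ y in Ioi (0 : ℝ), -(4 * (y : ℂ) * Complex.sin (2 * (y : ℂ) * z) * (kernZero y : ℂ)) =
      Real.pi - 2 * Real.pi * Complex.exp (2 * Real.pi * z) /
        (1 + Complex.exp (2 * Real.pi * z)) := by
  have hne := one_add_exp_ne_zero hz
  -- At `z = 0` the point `iz` is an integer, where the cotangent series is not available.
  rcases eq_or_ne z 0 with rfl | hz0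
  · simp; norm_num
  have hpt : ∀ y : ℝ, 0 < y → HasSum
      (fun n : ℕ => -2 * Complex.sin (2 * (y : ℂ) * z) * ((2 * Real.exp (-(2 * n + 1) * y) : ℝ) : ℂ))
      (-(4 * (y : ℂ) * Complex.sin (2 * (y : ℂ) * z) * (kernZero y : ℂ))) := by
    intro y hy
    have h := (Complex.hasSum_ofReal.2 (hasSum_inv_sinh hy)).mul_left
      (-2 * Complex.sin (2 * (y : ℂ) * z))
    have e : -2 * Complex.sin (2 * (y : ℂ) * z) * ((1 / Real.sinh y : ℝ) : ℂ) =
        -(4 * (y : ℂ) * Complex.sin (2 * (y : ℂ) * z) * (kernZero y : ℂ)) := by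
      have hs : (Real.sinh y : ℂ) ≠ 0 := by exact_mod_cast (Real.sinh_pos_iff.2 hy).ne'
      have hy0 : (y : ℂ) ≠ 0 := by exact_mod_cast hy.ne'
      unfold kernZero
      push_cast at hs ⊢
      field_simp
      ring
    rwa [e] at h
  have hsumm : ∀ y : ℝ, 0 < y → HasSum (fun n : ℕ => 4 * ‖z‖ * y * Real.exp (2 * |z.im| * y) *
      (2 * Real.exp (-(2 * n + 1) * y))) (8 * ‖z‖ * (y ^ 2 * Real.exp (2 * |z.im| * y) * kernZero y)) := by
    intro y hy
    have h := (hasSum_inv_sinh hy).mul_left (4 * ‖z‖ * y * Real.exp (2 * |z.im| * y))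
    have e : 4 * ‖z‖ * y * Real.exp (2 * |z.im| * y) * (1 / Real.sinh y) =
        8 * ‖z‖ * (y ^ 2 * Real.exp (2 * |z.im| * y) * kernZero y) := by
      have hs := (Real.sinh_pos_iff.2 hy).ne'
      unfold kernZero
      field_simp
      norm_num
    rwa [e] at h
  have hS := hasSum_integral_of_dominated_convergence (μ := volume.restrict (Ioi (0 : ℝ)))
    (F := fun (n : ℕ) (y : ℝ) =>
      -2 * Complex.sin (2 * (y : ℂ) * z) * ((2 * Real.exp (-(2 * n + 1) * y) : ℝ) : ℂ))
    (f := fun y : ℝ => -(4 * (y : ℂ) * Complex.sin (2 * (y : ℂ) * z) * (kernZero y : ℂ)))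
    (fun (n : ℕ) (y : ℝ) => 4 * ‖z‖ * y * Real.exp (2 * |z.im| * y) *
      (2 * Real.exp (-(2 * n + 1) * y)))
    (fun n => (by fun_prop : Continuous _).aestronglyMeasurable)
    (fun n => (ae_restrict_iff' measurableSet_Ioi).2 (ae_of_all _ fun y hy => ?_))
    ((ae_restrict_iff' measurableSet_Ioi).2 (ae_of_all _ fun y hy => (hsumm y hy).summable))
    (Integrable.congr ((integrable_kernZero_exp hz).const_mul (8 * ‖z‖))
      ((ae_restrict_iff' measurableSet_Ioi).2 (ae_of_all _ fun y hy => (hsumm y hy).tsum_eq.symm)))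
    ((ae_restrict_iff' measurableSet_Ioi).2 (ae_of_all _ fun y hy => hpt y hy))
  · have h2x := mem_integerComplement_of_strip hz hz0
    have hx : Complex.I * z ∈ Complex.integerComplement := by
      rintro ⟨n, hn⟩
      exact h2x ⟨2 * n, by push_cast; rw [hn]⟩
    have hT := (hasSum_tan hx h2x).mul_left Complex.I
    have hterm : ∀ n : ℕ, (∫ y in Ioi (0 : ℝ), -2 * Complex.sin (2 * (y : ℂ) * z) *
        ((2 * Real.exp (-(2 * n + 1) * y) : ℝ) : ℂ)) =
        Complex.I * (8 * (Complex.I * z) / ((2 * n + 1) ^ 2 - 4 * (Complex.I * z) ^ 2)) := by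
      intro n
      have h := integral_sin_mul_exp (c := 2 * n + 1) (z := z)
        (by have : (0 : ℝ) ≤ n := n.cast_nonneg
            linarith)
      have e : ∀ y : ℝ, -2 * Complex.sin (2 * (y : ℂ) * z) *
          ((2 * Real.exp (-(2 * n + 1) * y) : ℝ) : ℂ) =
          -4 * (Complex.sin (2 * (y : ℂ) * z) * (Real.exp (-(2 * n + 1) * y) : ℂ)) := by
        intro y; push_cast; ring
      simp only [e]
      rw [integral_const_mul, h, mul_pow, Complex.I_sq]
      push_cast
      rw [show Complex.I * (8 * (Complex.I * z) / ((2 * (n : ℂ) + 1) ^ 2 - 4 * (-1 * z ^ 2))) =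
        (Complex.I ^ 2) * 8 * z / ((2 * (n : ℂ) + 1) ^ 2 + 4 * z ^ 2) by ring, Complex.I_sq]
      ring
    simp only [hterm] at hS
    rw [hS.unique hT]
    rw [show (Real.pi : ℂ) * (Complex.I * z) = (Real.pi * z) * Complex.I by ring,
      Complex.tan_mul_I, Complex.tanh_eq_sinh_div_cosh, Complex.sinh, Complex.cosh]
    have e2 : Complex.exp (2 * Real.pi * z) = Complex.exp (Real.pi * z) * Complex.exp (Real.pi * z) := by
      rw [← Complex.exp_add]; congr 1; ring
    have e0 := Complex.exp_ne_zero (Real.pi * z)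
    rw [e2] at hne ⊢
    have h3 : Complex.exp (Real.pi * z) + Complex.exp (-(Real.pi * z)) ≠ 0 := by
      rw [Complex.exp_neg]
      intro h0
      field_simp at h0
      exact hne (by linear_combination h0)
    rw [show Complex.I * (Real.pi * ((Complex.exp (Real.pi * z) - Complex.exp (-(Real.pi * z))) / 2 /
      ((Complex.exp (Real.pi * z) + Complex.exp (-(Real.pi * z))) / 2) * Complex.I)) =
      Complex.I ^ 2 * (Real.pi * ((Complex.exp (Real.pi * z) - Complex.exp (-(Real.pi * z))) / 2 /
      ((Complex.exp (Real.pi * z) + Complex.exp (-(Real.pi * z))) / 2))) by ring, Complex.I_sq]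
    rw [Complex.exp_neg] at h3 ⊢
    have h4 : Complex.exp (Real.pi * z) ^ 2 + 1 ≠ 0 := by
      intro h0; exact hne (by linear_combination h0)
    have h5 : 1 + Complex.exp (Real.pi * z) ^ 2 ≠ 0 := by rwa [add_comm]
    field_simp
    ring
  · have hy0 : (0 : ℝ) < y := hy
    have h := norm_sin_le_mul (2 * (y : ℂ) * z)
    rw [abs_im_two_mul_ofReal_mul hy0, norm_two_mul_ofReal_mul hy0] at h
    rw [norm_mul, norm_mul, Complex.norm_real, Real.norm_of_nonneg (by positivity), norm_neg,
      Complex.norm_ofNat]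
    calc _ ≤ 2 * (2 * y * ‖z‖ * Real.exp (2 * |z.im| * y)) * (2 * Real.exp (-(2 * n + 1) * y)) := by
          gcongr
      _ = _ := by ring

theorem isOpen_strip_half : IsOpen {z : ℂ | |z.im| < 1 / 2} := isOpen_strip _

theorem isPreconnected_strip_half : IsPreconnected {z : ℂ | |z.im| < 1 / 2} := by
  have : {z : ℂ | |z.im| < 1 / 2} = {z : ℂ | -(1 / 2) < z.im} ∩ {z : ℂ | z.im < 1 / 2} := by
    ext z
    simp only [mem_ofPred_eq, mem_inter_iff, abs_lt]
  rw [this]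
  exact ((convex_halfSpace_im_gt _).inter (convex_halfSpace_im_lt _)).isPreconnected

theorem hasDerivAt_exp_two_pi (z : ℂ) : HasDerivAt (fun z : ℂ => Complex.exp (2 * Real.pi * z))
    (2 * Real.pi * Complex.exp (2 * Real.pi * z)) z := by
  have h := ((hasDerivAt_id z).const_mul (2 * Real.pi : ℂ)).cexp
  simp only [id, mul_one] at h
  exact h.congr_deriv (mul_comm _ _)

theorem hasDerivAt_log_one_add_exp {z : ℂ} (hz : |z.im| < 1 / 2) :
    HasDerivAt (fun z : ℂ => Complex.log (1 + Complex.exp (2 * Real.pi * z)))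
      (2 * Real.pi * Complex.exp (2 * Real.pi * z) / (1 + Complex.exp (2 * Real.pi * z))) z :=
  ((hasDerivAt_exp_two_pi z).const_add 1).clog (one_add_exp_mem_slitPlane hz)

theorem hasDerivAt_transformDeriv_kernZero {z : ℂ} (hz : |z.im| < 1 / 2) :
    HasDerivAt (transformDeriv kernZero) (Real.pi - 2 * Real.pi * Complex.exp (2 * Real.pi * z) /
        (1 + Complex.exp (2 * Real.pi * z))) z :=
  (isKernel_kernZero.hasDerivAt_transformDeriv hz).congr_deriv (integral_sin_mul_kernZero hz)

theorem transformDeriv_kernZero_zero :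
    transformDeriv kernZero 0 =
      ((2 * ∫ y in Ioi (0 : ℝ), (kernZero y - 1 / (2 * y ^ 2)) : ℝ) : ℂ) := by
  rw [transformDeriv]; simp

/-- By `sinh y = 2 sinh (y/2) cosh (y/2)` the factor `cosh (y/2)` produced by `z = i/4` turns
`kernZero y` into a multiple of `kernZero (y/2)`, and rescaling recovers half the integral at `0`.
This fixes the constant of integration. -/
theorem transformDeriv_kernZero_I_div_four :
    transformDeriv kernZero (Complex.I / 4) = transformDeriv kernZero 0 / 2 := by
  have him : |(Complex.I / 4).im| < 1 / 2 := by
    simp only [Complex.div_ofNat_im, Complex.I_im]; rw [abs_of_pos] <;> norm_num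
  have h0 : IntegrableOn (fun y : ℝ => 2 * ((kernZero y - 1 / (2 * y ^ 2) : ℝ) : ℂ)) (Ioi 0) :=
    isKernel_kernZero.integrable_sub.ofReal.const_mul 2
  have hsc := integral_comp_mul_left_Ioi' (fun y : ℝ => 2 * (kernZero (y / 2) / 4 - 1 / (2 * y ^ 2))) 0
    two_pos
  rw [mul_zero] at hsc
  rw [transformDeriv_kernZero_zero, transformDeriv, ← integral_complex_ofReal, ← integral_const_mul,
    ← integral_add h0 (isKernel_kernZero.integrableOn_cos_sub him)]
  have e1 : ∀ y ∈ Ioi (0 : ℝ), 2 * ((kernZero y - 1 / (2 * y ^ 2) : ℝ) : ℂ) +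
      2 * (Complex.cos (2 * (y : ℂ) * (Complex.I / 4)) - 1) * (kernZero y : ℂ) =
      ((2 * (kernZero (y / 2) / 4 - 1 / (2 * y ^ 2)) : ℝ) : ℂ) := by
    intro y hy
    have hy0 : (0 : ℝ) < y := hy
    have hs := (Real.sinh_pos_iff.2 (half_pos hy0)).ne'
    have hc := (Real.cosh_pos (y / 2)).ne'
    have e2 : 2 * (y : ℂ) * (Complex.I / 4) = ((y / 2 : ℝ) : ℂ) * Complex.I := by push_cast; ring
    rw [e2, Complex.cos_mul_I, ← Complex.ofReal_cosh]
    have e3 : Real.sinh y = 2 * Real.sinh (y / 2) * Real.cosh (y / 2) := by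
      rw [← Real.sinh_two_mul]; congr 1; ring
    have e4 : 2 * (kernZero y - 1 / (2 * y ^ 2)) + 2 * (Real.cosh (y / 2) - 1) * kernZero y =
        2 * (kernZero (y / 2) / 4 - 1 / (2 * y ^ 2)) := by
      unfold kernZero
      rw [e3]
      field_simp
      ring
    rw [← e4]; push_cast; ring
  rw [setIntegral_congr_fun measurableSet_Ioi e1, integral_complex_ofReal, ← hsc]
  have e5 : ∀ u ∈ Ioi (0 : ℝ), 2 * (kernZero (2 * u / 2) / 4 - 1 / (2 * (2 * u) ^ 2)) =
      2⁻¹ * (kernZero u - 1 / (2 * u ^ 2)) := by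
    intro u hu
    have hu0 : u ≠ 0 := ne_of_gt hu
    rw [mul_div_cancel_left₀ u two_ne_zero]
    field_simp
    ring
  rw [setIntegral_congr_fun measurableSet_Ioi e5, integral_const_mul, smul_eq_mul]
  push_cast
  ring

/-- Both sides have the same derivative, so they differ by a constant. The values at `0` and `i/4`,
with `log (1 + i) = (log 2)/2 + iπ/4`, show that it equals half of itself. -/
theorem transformDeriv_kernZero_eq {z : ℂ} (hz : |z.im| < 1 / 2) :
    transformDeriv kernZero z =
      Real.pi * z - Complex.log (1 + Complex.exp (2 * Real.pi * z)) := by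
  set g : ℂ → ℂ := fun z => transformDeriv kernZero z -
    (Real.pi * z - Complex.log (1 + Complex.exp (2 * Real.pi * z))) with hg
  have hd : ∀ w : ℂ, |w.im| < 1 / 2 → HasDerivAt g 0 w := by
    intro w hw
    have h := (hasDerivAt_transformDeriv_kernZero hw).sub
      (((hasDerivAt_id w).const_mul (Real.pi : ℂ)).sub (hasDerivAt_log_one_add_exp hw))
    refine h.congr_deriv ?_
    ring
  have hconst : ∀ w : ℂ, |w.im| < 1 / 2 → g w = g 0 := fun w hw =>
    isOpen_strip_half.is_const_of_deriv_eq_zero isPreconnected_strip_half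
      (fun w hw => (hd w hw).differentiableAt.differentiableWithinAt)
      (fun w hw => (hd w hw).deriv) hw (by simp)
  have hq := hconst (Complex.I / 4) (by
    simp only [Complex.div_ofNat_im, Complex.I_im]; rw [abs_of_pos] <;> norm_num)
  have hpi := Real.pi_pos
  have hlog : Complex.log (1 + Complex.exp (2 * Real.pi * (Complex.I / 4))) =
      Real.log 2 / 2 + Real.pi * Complex.I / 4 := by
    have e1 : 2 * (Real.pi : ℂ) * (Complex.I / 4) = Real.pi / 2 * Complex.I := by ring
    have e2 : (1 : ℂ) + Complex.I =
        Complex.exp (((Real.log 2 / 2 : ℝ) : ℂ) + ((Real.pi / 4 : ℝ) : ℂ) * Complex.I) := by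
      have h2 : Real.exp (Real.log 2 / 2) = √2 := by
        rw [Real.sqrt_eq_rpow, Real.rpow_def_of_pos two_pos]; congr 1; ring
      have h3 : √2 * √2 = 2 := Real.mul_self_sqrt (by norm_num)
      rw [Complex.exp_add, ← Complex.ofReal_exp, h2]
      apply Complex.ext
      · rw [Complex.re_ofReal_mul, Complex.exp_ofReal_mul_I_re, Real.cos_pi_div_four]
        simp; linarith
      · rw [Complex.im_ofReal_mul, Complex.exp_ofReal_mul_I_im, Real.sin_pi_div_four]
        simp; linarith
    rw [e1, Complex.exp_pi_div_two_mul_I, e2, Complex.log_exp]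
    · push_cast; ring
    · simp only [Complex.add_im, Complex.ofReal_im, Complex.im_ofReal_mul, Complex.I_im]; linarith
    · simp only [Complex.add_im, Complex.ofReal_im, Complex.im_ofReal_mul, Complex.I_im]; linarith
  have hlog2 : Complex.log (1 + 1) = Real.log 2 := by
    rw [Complex.ofReal_log (by norm_num)]; norm_num
  have h0 : g 0 = 0 := by
    simp only [hg, transformDeriv_kernZero_I_div_four, hlog, mul_zero, Complex.exp_zero, hlog2] at hq ⊢
    linear_combination -2 * hq
  have := hconst z hz
  rw [h0] at this
  exact sub_eq_zero.1 this

theorem transform_kernZero_zero : transform kernZero 0 = 0 := by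
  simp [transform]

/-- Integration of the previous formula; the constant `iπ/24` comes from the value of the
dilogarithm at `-1`. -/
theorem I_mul_transform_kernZero {z : ℂ} (hz : |z.im| < 1 / 2) :
    Complex.I * transform kernZero z =
      Complex.I * Real.pi * z ^ 2 / 2 - dilog (-Complex.exp (2 * Real.pi * z)) /
        (2 * Real.pi * Complex.I) + Complex.I * Real.pi / 24 := by
  have hpi0 : (Real.pi : ℂ) ≠ 0 := by exact_mod_cast Real.pi_ne_zero
  have hI := Complex.I_ne_zero
  set g : ℂ → ℂ := fun z => Complex.I * transform kernZero z - (Complex.I * Real.pi * z ^ 2 / 2 -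
    dilog (-Complex.exp (2 * Real.pi * z)) / (2 * Real.pi * Complex.I)) with hg
  have hd : ∀ w : ℂ, |w.im| < 1 / 2 → HasDerivAt g 0 w := by
    intro w hw
    have hs : 1 - -Complex.exp (2 * Real.pi * w) ∈ Complex.slitPlane := by
      rw [sub_neg_eq_add]; exact one_add_exp_mem_slitPlane hw
    have hE := Complex.exp_ne_zero (2 * Real.pi * w)
    have h1 := (isKernel_kernZero.hasDerivAt_transform hw).const_mul Complex.I
    have h2 := (((hasDerivAt_id w).pow 2).const_mul (Complex.I * Real.pi)).div_const 2
    have h3 := ((hasDerivAt_dilog hs (neg_ne_zero.2 hE)).comp w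
      (hasDerivAt_exp_two_pi w).neg).div_const (2 * Real.pi * Complex.I)
    refine (h1.sub (h2.sub h3)).congr_deriv ?_
    rw [transformDeriv_kernZero_eq hw, sub_neg_eq_add]
    simp only [id]
    generalize Complex.log (1 + Complex.exp (2 * Real.pi * w)) = L
    field_simp
    linear_combination (-2 * L) * Complex.I_sq
  have hconst : g z = g 0 :=
    isOpen_strip_half.is_const_of_deriv_eq_zero isPreconnected_strip_half
      (fun w hw => (hd w hw).differentiableAt.differentiableWithinAt)
      (fun w hw => (hd w hw).deriv) hz (by simp)
  have h0 : g 0 = Complex.I * Real.pi / 24 := by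
    simp only [hg, transform_kernZero_zero, mul_zero, Complex.exp_zero, dilog_neg_one]
    field_simp
    linear_combination (-24 * Real.pi : ℂ) * Complex.I_sq
  rw [h0] at hconst
  simp only [hg] at hconst
  linear_combination hconst

theorem cosIntegral_neg (t : ℝ) : cosIntegral (-t) = cosIntegral t := by
  simp [cosIntegral]

/-- For `t ≥ 0` the explicit derivative `πt - log (1 + e^{2πt})` is `-πt` up to `log 2`; evenness
gives the other half. -/
theorem exists_abs_cosIntegral_sub_le :
    ∃ M : ℝ, ∀ t : ℝ, |cosIntegral t - Real.pi * abs t| ≤ M := by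
  set J := 6 * ∫ y in Ioi (0 : ℝ), |kernZero y - 1 / (2 * y ^ 2)| with hJ
  have hpos : ∀ t : ℝ, 0 ≤ t → |cosIntegral t - Real.pi * t| ≤ J + Real.log 2 := by
    intro t ht
    have hpi := Real.pi_pos
    have h := isKernel_kernZero.norm_transformDeriv_add_le t
    rw [transformDeriv_kernZero_eq (by simp), ← hJ] at h
    have e : (1 : ℂ) + Complex.exp (2 * Real.pi * t) = ((1 + Real.exp (2 * Real.pi * t) : ℝ) : ℂ) := by
      push_cast; rfl
    rw [e, ← Complex.ofReal_log (by positivity), ← Complex.ofReal_mul, ← Complex.ofReal_sub,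
      ← Complex.ofReal_add, Complex.norm_real, Real.norm_eq_abs] at h
    have l1 : 2 * Real.pi * t ≤ Real.log (1 + Real.exp (2 * Real.pi * t)) := by
      rw [Real.le_log_iff_exp_le (by positivity)]; linarith
    have l2 : Real.log (1 + Real.exp (2 * Real.pi * t)) ≤ Real.log 2 + 2 * Real.pi * t := by
      rw [Real.log_le_iff_le_exp (by positivity), Real.exp_add, Real.exp_log two_pos]
      have := Real.one_le_exp (x := 2 * Real.pi * t) (by positivity)
      linarith
    have := abs_le.1 h
    rw [abs_le]
    constructor <;> linarith
  refine ⟨J + Real.log 2, fun t => ?_⟩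
  rcases le_total 0 t with ht | ht
  · rw [abs_of_nonneg ht]; exact hpos t ht
  · rw [abs_of_nonpos ht, ← cosIntegral_neg]; exact hpos (-t) (by linarith)

end HyperbolicQ

/-! ### Rescaling the integral and moving the contour -/

namespace HyperbolicQ

open Set Filter MeasureTheory

theorem integrable_exp_neg_mul_abs {c : ℝ} (hc : 0 < c) :
    Integrable fun x : ℝ => Real.exp (-(c * |x|)) := by
  -- Chosen so that `m (1 + x²) ≤ 1 + c² x² / 2 ≤ e^{c|x|}`.
  set m := min 1 (c ^ 2 / 2) with hm
  have hm0 : 0 < m := by positivity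
  have h1 : m ≤ 1 := min_le_left _ _
  have h2 : m ≤ c ^ 2 / 2 := min_le_right _ _
  refine (integrable_inv_one_add_sq.const_mul m⁻¹).mono'
    (by fun_prop : Continuous _).aestronglyMeasurable (ae_of_all _ fun x => ?_)
  rw [Real.norm_of_nonneg (Real.exp_pos _).le, Real.exp_neg, ← mul_inv]
  have h3 := Real.quadratic_le_exp_of_nonneg (x := c * |x|) (by positivity)
  have h4 : (c * |x|) ^ 2 = c ^ 2 * x ^ 2 := by rw [mul_pow, sq_abs]
  have h5 : 0 ≤ c * |x| := by positivity
  have h6 : m * x ^ 2 ≤ c ^ 2 / 2 * x ^ 2 := by gcongr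
  gcongr
  linarith

section Shift

variable {f : ℂ → ℂ} {η₁ η₂ M c : ℝ}

theorem integrable_horizontal_line {η : ℝ} (hf : ∀ z : ℂ, z.im = η → ContinuousAt f z) (hc : 0 < c)
    (hM : ∀ t : ℝ, ‖f (t + Complex.I * η)‖ ≤ M * Real.exp (-(c * |t|))) :
    Integrable fun t : ℝ => f (t + Complex.I * η) := by
  refine ((integrable_exp_neg_mul_abs hc).const_mul M).mono' ?_ (ae_of_all _ hM)
  refine Continuous.aestronglyMeasurable (continuous_iff_continuousAt.2 fun t => ?_)
  exact ContinuousAt.comp (f := fun t : ℝ => (t : ℂ) + Complex.I * η) (hf _ (by simp))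
    (by fun_prop)

/-- Cauchy's theorem on the rectangles `[-R, R] × [η₁, η₂]`; the vertical sides vanish as `R → ∞`.
-/
theorem integral_horizontal_line_eq (hη : η₁ ≤ η₂)
    (hf : ∀ z : ℂ, η₁ ≤ z.im → z.im ≤ η₂ → DifferentiableAt ℂ f z) (hc : 0 < c)
    (hM : ∀ t η : ℝ, η₁ ≤ η → η ≤ η₂ → ‖f (t + Complex.I * η)‖ ≤ M * Real.exp (-(c * |t|))) :
    ∫ t : ℝ, f (t + Complex.I * η₁) = ∫ t : ℝ, f (t + Complex.I * η₂) := by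
  have hrect : ∀ R : ℝ, (∫ x : ℝ in -R..R, f (x + Complex.I * η₁)) -
      (∫ x : ℝ in -R..R, f (x + Complex.I * η₂)) =
      -(Complex.I * ∫ y : ℝ in η₁..η₂, f (R + Complex.I * y)) +
        Complex.I * ∫ y : ℝ in η₁..η₂, f ((-R : ℝ) + Complex.I * y) := by
    intro R
    have h := Complex.integral_boundary_rect_eq_zero_of_differentiableOn f ⟨-R, η₁⟩ ⟨R, η₂⟩
      fun z hz => by
        have hz2 := hz.2
        rw [mem_preimage, uIcc_of_le hη] at hz2
        exact (hf z hz2.1 hz2.2).differentiableWithinAt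
    simp only [smul_eq_mul, mul_comm _ Complex.I] at h
    linear_combination h
  have hvert : ∀ s : ℝ → ℝ, (∀ R, |s R| = |R|) →
      Tendsto (fun R : ℝ => ∫ y : ℝ in η₁..η₂, f (s R + Complex.I * y)) atTop (𝓝 0) := by
    intro s hs
    have h1 : Tendsto (fun R : ℝ => M * Real.exp (-(c * |R|)) * |η₂ - η₁|) atTop (𝓝 0) := by
      have h2 : Tendsto (fun R : ℝ => Real.exp (-(c * |R|))) atTop (𝓝 0) :=
        Real.tendsto_exp_neg_atTop_nhds_zero.comp
          (tendsto_abs_atTop_atTop.const_mul_atTop hc)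
      simpa using (h2.const_mul M).mul_const |η₂ - η₁|
    refine squeeze_zero_norm (fun R => ?_) h1
    refine intervalIntegral.norm_integral_le_of_norm_le_const fun y hy => ?_
    rw [uIoc_of_le hη] at hy
    have := hM (s R) y hy.1.le hy.2
    rwa [hs] at this
  have hint : ∀ η, η₁ ≤ η → η ≤ η₂ → Integrable fun t : ℝ => f (t + Complex.I * η) :=
    fun η h1 h2 => integrable_horizontal_line
      (fun z hz => (hf z (hz ▸ h1) (hz ▸ h2)).continuousAt) hc (fun t => hM t η h1 h2)
  have hL := (intervalIntegral_tendsto_integral (hint η₁ le_rfl hη) tendsto_neg_atTop_atBot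
    tendsto_id).sub (intervalIntegral_tendsto_integral (hint η₂ hη le_rfl)
    tendsto_neg_atTop_atBot tendsto_id)
  have hR : Tendsto (fun R : ℝ => -(Complex.I * ∫ y : ℝ in η₁..η₂, f (R + Complex.I * y)) +
        Complex.I * ∫ y : ℝ in η₁..η₂, f ((-R : ℝ) + Complex.I * y)) atTop (𝓝 0) := by
    have := ((hvert (fun R => R) fun _ => rfl).const_mul Complex.I).neg.add
      ((hvert (fun R => -R) fun R => abs_neg R).const_mul Complex.I)
    simpa using this
  have := tendsto_nhds_unique hL (hR.congr fun R => (hrect R).symm)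
  exact sub_eq_zero.1 this

end Shift

/-- The integrand of `𝒬` in the rescaled variable `X = b x`, with `β = b ^ 2`. -/
noncomputable def scaledIntegrand (β σ μ : ℝ) (X : ℂ) : ℂ :=
  Complex.exp (Complex.I / β * (-Real.pi * X ^ 2 + 2 * Real.pi * X *
    (μ - Complex.I * (1 + β) / 2) + transform (kern β) (X + σ) + transform (kern β) (X - σ)))

theorem integrandQ_div {b : ℝ} (hb : 0 < b) (σ μ : ℝ) (X : ℂ) :
    integrandQ b (σ / b) (μ / b) (X / b) = scaledIntegrand (b ^ 2) σ μ X := by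
  have hbC : (b : ℂ) ≠ 0 := by exact_mod_cast hb.ne'
  have e1 : X / (b : ℂ) + ((σ / b : ℝ) : ℂ) = (X + σ) / b := by push_cast; field_simp
  have e2 : X / (b : ℂ) - ((σ / b : ℝ) : ℂ) = (X - σ) / b := by push_cast; field_simp
  rw [integrandQ, e1, e2, sb_div_eq hb, sb_div_eq hb, scaledIntegrand, ← Complex.exp_add,
    ← Complex.exp_add, ← Complex.exp_add, bigQ]
  congr 1
  push_cast
  field_simp
  ring

theorem calQ_eq {b : ℝ} (hb : 0 < b) (h σ μ : ℝ) :
    calQ h b (σ / b) (μ / b) = prefactorQ b (σ / b) (μ / b) *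
      ((b⁻¹ : ℝ) * ∫ t : ℝ, scaledIntegrand (b ^ 2) σ μ (t + Complex.I * ((b * h : ℝ) : ℂ))) := by
  have hbC : (b : ℂ) ≠ 0 := by exact_mod_cast hb.ne'
  have hsc := Measure.integral_comp_mul_left
    (fun t : ℝ => scaledIntegrand (b ^ 2) σ μ (t + Complex.I * ((b * h : ℝ) : ℂ))) b
  rw [abs_of_pos (inv_pos.2 hb), Complex.real_smul] at hsc
  rw [calQ, ← hsc]
  congr 2
  funext t
  rw [← integrandQ_div hb]
  congr 1
  push_cast
  field_simp

variable {β σ μ : ℝ}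

theorem differentiableAt_scaledIntegrand (hβ : 0 < β) {X : ℂ} (hX : |X.im| < (1 + β) / 2) :
    DifferentiableAt ℂ (scaledIntegrand β σ μ) X := by
  have h1 : DifferentiableAt ℂ (fun X => transform (kern β) (X + σ)) X :=
    DifferentiableAt.comp (g := transform (kern β)) X
      ((isKernel_kern hβ).hasDerivAt_transform (by simpa using hX)).differentiableAt (by fun_prop)
  have h2 : DifferentiableAt ℂ (fun X => transform (kern β) (X - σ)) X :=
    DifferentiableAt.comp (g := transform (kern β)) X
      ((isKernel_kern hβ).hasDerivAt_transform (by simpa using hX)).differentiableAt (by fun_prop)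
  unfold scaledIntegrand
  fun_prop

theorem norm_scaledIntegrand (t η : ℝ) :
    ‖scaledIntegrand β σ μ (t + Complex.I * η)‖ =
      Real.exp ((2 * Real.pi * t * η - 2 * Real.pi * η * μ + Real.pi * (1 + β) * t -
        (transform (kern β) (((t + σ : ℝ) : ℂ) + Complex.I * η)).im -
        (transform (kern β) (((t - σ : ℝ) : ℂ) + Complex.I * η)).im) / β) := by
  have e1 : (t : ℂ) + Complex.I * η + σ = ((t + σ : ℝ) : ℂ) + Complex.I * η := by push_cast; ring
  have e2 : (t : ℂ) + Complex.I * η - σ = ((t - σ : ℝ) : ℂ) + Complex.I * η := by push_cast; ring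
  rw [scaledIntegrand, Complex.norm_exp, e1, e2]
  congr 1
  have e3 : ∀ w : ℂ, (Complex.I / β * w).re = -w.im / β := by
    intro w
    rw [div_mul_eq_mul_div, Complex.div_ofReal_re, Complex.I_mul_re]
  rw [e3]
  congr 1
  have e4 : (-Real.pi * ((t : ℂ) + Complex.I * η) ^ 2 + 2 * Real.pi * ((t : ℂ) + Complex.I * η) *
      (μ - Complex.I * (1 + β) / 2)) =
      ((-Real.pi * (t ^ 2 - η ^ 2) + 2 * Real.pi * t * μ + Real.pi * η * (1 + β) : ℝ) : ℂ) +
      ((-(2 * Real.pi * t * η) + 2 * Real.pi * η * μ - Real.pi * (1 + β) * t : ℝ) : ℂ) *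
        Complex.I := by
    push_cast
    linear_combination (-Real.pi * (η : ℂ) ^ 2 - Real.pi * η * (1 + β)) * Complex.I_sq
  rw [e4]
  simp only [Complex.add_im, Complex.ofReal_im, Complex.im_ofReal_mul, Complex.I_im]
  ring

/-- The exponent times `β` is `2πtη + π(1+β)t + 2πη|t|` up to a bounded term. Its slope on the left
is `π(1+β)`, and on the right `4πη + π(1+β)`, negative exactly for `η < -(1+β)/4`: this is the bound
`-Q/4` on the contour. -/
theorem exists_norm_scaledIntegrand_le (hβ : 0 < β) (σ μ : ℝ) {η₁ η₂ : ℝ}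
    (h1 : -((1 + β) / 2) < η₁) (h2 : η₂ < -((1 + β) / 4)) :
    ∃ M c : ℝ, 0 < c ∧ ∀ t η : ℝ, η₁ ≤ η → η ≤ η₂ →
      ‖scaledIntegrand β σ μ (t + Complex.I * η)‖ ≤ M * Real.exp (-(c * |t|)) := by
  have hpi := Real.pi_pos
  obtain ⟨M₀, hM₀⟩ := exists_abs_cosIntegral_sub_le
  have hM₀0 : 0 ≤ M₀ := (abs_nonneg _).trans (hM₀ 0)
  set C := 2 * Real.pi * |η₁| * |μ| + 2 * |η₁| * (Real.pi * |σ| + M₀) +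
    2 * growthBound (kern β) |η₁| with hC
  set c := min (Real.pi * (1 + β)) (-(4 * Real.pi * η₂ + Real.pi * (1 + β))) with hc
  have hc1 : c ≤ Real.pi * (1 + β) := min_le_left _ _
  have hc2 : c ≤ -(4 * Real.pi * η₂ + Real.pi * (1 + β)) := min_le_right _ _
  have hc0 : 0 < c := lt_min (by positivity) (by nlinarith)
  refine ⟨Real.exp (C / β), c / β, by positivity, fun t η hη1 hη2 => ?_⟩
  have hη0 : η < 0 := by linarith
  have hη10 : η₁ < 0 := by linarith
  have habs : |η| ≤ |η₁| := by
    rw [abs_of_neg hη0, abs_of_neg hη10]; linarith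
  have hlt : |η₁| < (1 + β) / 2 := by rw [abs_of_neg hη10]; linarith
  rw [norm_scaledIntegrand, ← Real.exp_add, Real.exp_le_exp]
  have hcos : ∀ s : ℝ, |s| = |σ| → η * cosIntegral (t + s) ≤
      Real.pi * η * |t| + |η₁| * (Real.pi * |σ| + M₀) := by
    intro s hs
    have a1 := (abs_le.1 (hM₀ (t + s))).1
    have a2 : |t| - |s| ≤ |t + s| := by
      have := abs_sub_abs_le_abs_sub t (-s)
      rwa [abs_neg, sub_neg_eq_add] at this
    have a3 : Real.pi * |t| - (Real.pi * |σ| + M₀) ≤ cosIntegral (t + s) := by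
      rw [hs] at a2
      have := mul_le_mul_of_nonneg_left a2 hpi.le
      linarith
    have a4 := mul_le_mul_of_nonpos_left a3 hη0.le
    have a5 : -η * (Real.pi * |σ| + M₀) ≤ |η₁| * (Real.pi * |σ| + M₀) := by
      rw [← abs_of_neg hη0]; gcongr
    linarith
  have g1 := (abs_le.1 ((isKernel_kern hβ).abs_im_transform_add_le (t := t + σ) habs hlt)).1
  have g2 := (abs_le.1 ((isKernel_kern hβ).abs_im_transform_add_le (t := t - σ) habs hlt)).1
  have c1 := hcos σ rfl
  have c2 := hcos (-σ) (abs_neg σ)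
  rw [← sub_eq_add_neg] at c2
  have hm : -(2 * Real.pi * η * μ) ≤ 2 * Real.pi * |η₁| * |μ| := by
    have : -(η * μ) ≤ |η₁| * |μ| := by
      calc -(η * μ) ≤ |η * μ| := neg_le_abs _
        _ = |η| * |μ| := abs_mul _ _
        _ ≤ _ := by gcongr
    nlinarith
  have hlin : 2 * Real.pi * t * η + Real.pi * (1 + β) * t + 2 * (Real.pi * η * |t|) ≤ -(c * |t|) := by
    rcases le_total 0 t with ht | ht
    · rw [abs_of_nonneg ht]
      have : 4 * Real.pi * η * t ≤ 4 * Real.pi * η₂ * t := by gcongr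
      have := mul_le_mul_of_nonneg_right hc2 ht
      linarith
    · rw [abs_of_nonpos ht]
      have := mul_le_mul_of_nonneg_right hc1 (neg_nonneg.2 ht)
      linarith
  rw [show C / β + -(c / β * |t|) = (C + -(c * |t|)) / β by ring]
  gcongr
  linarith

/-- The value of the rescaled integral does not depend on the admissible horizontal contour. -/
theorem integral_scaledIntegrand_eq (hβ : 0 < β) (σ μ : ℝ) {η η' : ℝ}
    (h1 : -((1 + β) / 2) < η) (h2 : η < -((1 + β) / 4))
    (h1' : -((1 + β) / 2) < η') (h2' : η' < -((1 + β) / 4)) :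
    ∫ t : ℝ, scaledIntegrand β σ μ (t + Complex.I * η) =
      ∫ t : ℝ, scaledIntegrand β σ μ (t + Complex.I * η') := by
  wlog hle : η ≤ η' generalizing η η'
  · exact (this h1' h2' h1 h2 (le_of_not_ge hle)).symm
  obtain ⟨M, c, hc, hM⟩ := exists_norm_scaledIntegrand_le hβ σ μ h1 h2'
  refine integral_horizontal_line_eq hle (fun z hz1 hz2 => ?_) hc hM
  exact differentiableAt_scaledIntegrand hβ (abs_lt.2 ⟨by linarith, by linarith⟩)

end HyperbolicQ

/-! ### Laplace's method -/

namespace HyperbolicQ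

open Set Filter MeasureTheory

theorem norm_exp_sub_exp_le {u v : ℂ} {M : ℝ} (hu : u.re ≤ M) (hv : v.re ≤ M) :
    ‖Complex.exp u - Complex.exp v‖ ≤ Real.exp M * ‖u - v‖ :=
  (convex_halfSpace_re_le M).norm_image_sub_le_of_norm_hasDerivWithin_le
    (fun w _ => (Complex.hasDerivAt_exp w).hasDerivWithinAt)
    (fun w hw => by rw [Complex.norm_exp]; exact Real.exp_le_exp.2 hw) hv hu

section Quadratic

variable {p p₁ p₂ : ℝ → ℝ} {c : ℝ}

/-- On `[0, 1]` two integrations give `-c t²`; beyond `1` concavity preserves the slope reached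
there and gives linear decay. The function `t² / (1 + t)` covers both regimes. -/
theorem le_neg_of_second_deriv_le_of_nonneg (h1 : ∀ t, HasDerivAt p (p₁ t) t)
    (h2 : ∀ t, HasDerivAt p₁ (p₂ t) t) (h00 : p 0 = 0) (h10 : p₁ 0 = 0) (hneg : ∀ t, p₂ t ≤ 0)
    (hc : 0 < c) (hlt : ∀ t, |t| ≤ 1 → p₂ t ≤ -(2 * c)) {t : ℝ} (ht : 0 ≤ t) :
    p t ≤ -(c * (t ^ 2 / (1 + t))) := by
  have hd1 : ∀ s ∈ Icc (0 : ℝ) 1, p₁ s ≤ -(2 * c * s) := by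
    intro s hs
    have hanti : AntitoneOn (fun s => p₁ s + 2 * c * s) (Icc 0 1) := by
      refine antitoneOn_of_hasDerivWithinAt_nonpos (f' := fun s => p₂ s + 2 * c) (convex_Icc _ _)
        (fun x _ => ((h2 x).continuousAt.add (by fun_prop)).continuousWithinAt) (fun x _ => ?_)
        fun x hx => ?_
      · exact (((h2 x).add ((hasDerivAt_id x).const_mul (2 * c))).congr_deriv
          (by simp)).hasDerivWithinAt
      · rw [interior_Icc] at hx
        linarith [hlt x (by rw [abs_of_pos hx.1]; exact hx.2.le)]
    have := hanti ⟨le_rfl, zero_le_one⟩ hs hs.1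
    simp only [h10] at this
    linarith
  have hp1 : ∀ s ∈ Icc (0 : ℝ) 1, p s ≤ -(c * s ^ 2) := by
    intro s hs
    have hanti : AntitoneOn (fun s => p s + c * s ^ 2) (Icc 0 1) := by
      refine antitoneOn_of_hasDerivWithinAt_nonpos (f' := fun s => p₁ s + c * (2 * s))
        (convex_Icc _ _)
        (fun x _ => ((h1 x).continuousAt.add (by fun_prop)).continuousWithinAt) (fun x _ => ?_)
        fun x hx => ?_
      · exact (((h1 x).add (((hasDerivAt_id x).pow 2).const_mul c)).congr_deriv
          (by simp)).hasDerivWithinAt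
      · rw [interior_Icc] at hx
        linarith [hd1 x ⟨hx.1.le, hx.2.le⟩]
    have := hanti ⟨le_rfl, zero_le_one⟩ hs hs.1
    simp only [h00] at this
    linarith
  have h1t : 0 < 1 + t := by linarith
  rcases le_total t 1 with ht1 | ht1
  · have h3 := hp1 t ⟨ht, ht1⟩
    have : t ^ 2 / (1 + t) ≤ t ^ 2 := div_le_self (by positivity) (by linarith)
    nlinarith
  · have hd2 : ∀ s, 1 ≤ s → p₁ s ≤ -(2 * c) := by
      intro s hs
      have hanti : Antitone p₁ := antitone_of_hasDerivAt_nonpos h2 hneg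
      linarith [hanti hs, hd1 1 ⟨zero_le_one, le_rfl⟩]
    have hanti : AntitoneOn (fun s => p s + 2 * c * s) (Ici 1) := by
      refine antitoneOn_of_hasDerivWithinAt_nonpos (f' := fun s => p₁ s + 2 * c) (convex_Ici _)
        (fun x _ => ((h1 x).continuousAt.add (by fun_prop)).continuousWithinAt) (fun x _ => ?_)
        fun x hx => ?_
      · exact (((h1 x).add ((hasDerivAt_id x).const_mul (2 * c))).congr_deriv
          (by simp)).hasDerivWithinAt
      · rw [interior_Ici] at hx
        linarith [hd2 x (le_of_lt hx)]
    have h4 := hanti (self_mem_Ici : (1 : ℝ) ∈ Ici 1) ht1 ht1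
    simp only at h4
    have h5 := hp1 1 ⟨zero_le_one, le_rfl⟩
    have h6 : t ^ 2 / (1 + t) ≤ t := by rw [div_le_iff₀ h1t]; nlinarith
    nlinarith

theorem le_neg_of_second_deriv_le (h1 : ∀ t, HasDerivAt p (p₁ t) t)
    (h2 : ∀ t, HasDerivAt p₁ (p₂ t) t) (h00 : p 0 = 0) (h10 : p₁ 0 = 0) (hneg : ∀ t, p₂ t ≤ 0)
    (hc : 0 < c) (hlt : ∀ t, |t| ≤ 1 → p₂ t ≤ -(2 * c)) (t : ℝ) :
    p t ≤ -(c * (t ^ 2 / (1 + |t|))) := by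
  rcases le_total 0 t with ht | ht
  · rw [abs_of_nonneg ht]
    exact le_neg_of_second_deriv_le_of_nonneg h1 h2 h00 h10 hneg hc hlt ht
  · have h := le_neg_of_second_deriv_le_of_nonneg (p := fun s => p (-s)) (p₁ := fun s => -p₁ (-s))
      (p₂ := fun s => p₂ (-s)) (c := c)
      (fun s => ((h1 (-s)).scomp s (hasDerivAt_neg s)).congr_deriv (by simp))
      (fun s => ((h2 (-s)).scomp s (hasDerivAt_neg s)).neg.congr_deriv (by simp))
      (by simpa using h00) (by simpa using h10) (fun s => hneg _) hc
      (fun s hs => hlt _ (by rwa [abs_neg])) (neg_nonneg.2 ht)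
    simpa [abs_of_nonpos ht] using h

end Quadratic

/-- Mean value inequality without the gain `1 / (n + 1)`; used twice, it bounds the cubic Taylor
remainder. -/
theorem norm_le_mul_pow_of_deriv {f f' : ℝ → ℂ} (hf : ∀ t, HasDerivAt f (f' t) t) (h0 : f 0 = 0)
    {K : ℝ} {n : ℕ} (hK : ∀ t, ‖f' t‖ ≤ K * |t| ^ n) (t : ℝ) : ‖f t‖ ≤ K * |t| ^ (n + 1) := by
  have hK0 : 0 ≤ K := by simpa using (norm_nonneg _).trans (hK 1)
  have h := (convex_segment (𝕜 := ℝ) (0 : ℝ) t).norm_image_sub_le_of_norm_hasDerivWithin_le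
    (f := f) (f' := f') (C := K * |t| ^ n) (fun u _ => (hf u).hasDerivWithinAt) ?_
    (left_mem_segment ℝ 0 t) (right_mem_segment ℝ 0 t)
  · rw [h0, sub_zero, sub_zero, Real.norm_eq_abs] at h
    rw [pow_succ, ← mul_assoc]; exact h
  · rintro _ ⟨a, b, ha, hb, hab, rfl⟩
    refine (hK _).trans ?_
    have : |a • (0 : ℝ) + b • t| ≤ |t| := by
      rw [smul_zero, zero_add, smul_eq_mul, abs_mul, abs_of_nonneg hb]
      exact mul_le_of_le_one_left (abs_nonneg _) (by linarith)
    gcongr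

theorem integrable_cube_mul_exp {c : ℝ} (hc : 0 < c) (C : ℝ) :
    Integrable fun s : ℝ => (1 + |s|) ^ 3 * Real.exp (C - c * |s|) := by
  have hε : 0 < c / 6 := by positivity
  refine ((integrable_exp_neg_mul_abs (half_pos hc)).const_mul
    ((1 + 1 / (c / 6)) ^ 3 * Real.exp C)).mono'
    (by fun_prop : Continuous _).aestronglyMeasurable (ae_of_all _ fun s => ?_)
  rw [Real.norm_of_nonneg (by positivity)]
  have h1 : 1 + |s| ≤ (1 + 1 / (c / 6)) * Real.exp (c / 6 * |s|) := by
    rcases eq_or_ne s 0 with rfl | hs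
    · simp; positivity
    · simpa using one_add_mul_le (y := |s|) 1 (c / 6) hε zero_le_one (abs_pos.2 hs)
  calc _ ≤ ((1 + 1 / (c / 6)) * Real.exp (c / 6 * |s|)) ^ 3 * Real.exp (C - c * |s|) := by gcongr
    _ = (1 + 1 / (c / 6)) ^ 3 * (Real.exp (c / 6 * |s|) ^ 3 * Real.exp (C - c * |s|)) := by ring
    _ = (1 + 1 / (c / 6)) ^ 3 * (Real.exp C * Real.exp (-(c / 2 * |s|))) := by
        rw [← Real.exp_nat_mul, ← Real.exp_add, ← Real.exp_add]
        congr 2; push_cast; ring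
    _ = _ := by ring

theorem cube_bound {K C b s : ℝ} (hK : 0 ≤ K) (hC : 0 ≤ C) (hb : 0 < b) :
    K * b * |s| ^ 3 + C * b * (1 + |s|) ≤ (K + C) * b * (1 + |s|) ^ 3 := by
  have h0 := abs_nonneg s
  have h1 : |s| ^ 3 ≤ (1 + |s|) ^ 3 := by gcongr; linarith
  have h2 : 1 + |s| ≤ (1 + |s|) ^ 3 := le_self_pow₀ (by linarith) (by norm_num)
  have h3 := mul_le_mul_of_nonneg_left h1 (by positivity : 0 ≤ K * b)
  have h4 := mul_le_mul_of_nonneg_left h2 (by positivity : 0 ≤ C * b)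
  linarith

/-- Laplace's method with an error bound, for a complex exponent whose real part has a
nondegenerate maximum at the origin and is concave, perturbed by a small term. -/
theorem laplace_method {φ φ₁ φ₂ : ℝ → ℂ} (h1 : ∀ t, HasDerivAt φ (φ₁ t) t)
    (h2 : ∀ t, HasDerivAt φ₁ (φ₂ t) t) (h00 : φ 0 = 0) (h10 : φ₁ 0 = 0) {K c : ℝ}
    (hK : ∀ t, ‖φ₂ t - φ₂ 0‖ ≤ K * |t|) (hneg : ∀ t, (φ₂ t).re ≤ 0) (hc : 0 < c)
    (hlt : ∀ t, |t| ≤ 1 → (φ₂ t).re ≤ -(2 * c)) {ε : ℝ → ℝ → ℂ} {C : ℝ}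
    (hεc : ∀ b, 0 < b → b ≤ 1 → Continuous (ε b))
    (hε : ∀ b, 0 < b → b ≤ 1 → ∀ s, ‖ε b s‖ ≤ C * b * (1 + |s|)) :
    ∃ D b₁ : ℝ, 0 < b₁ ∧ ∀ b, 0 < b → b ≤ b₁ →
      ‖(∫ s : ℝ, Complex.exp (φ (b * s) / (b : ℂ) ^ 2 + ε b s)) -
        ∫ s : ℝ, Complex.exp (φ₂ 0 / 2 * (s : ℂ) ^ 2)‖ ≤ D * b := by
  have hK0 : 0 ≤ K := by simpa using (norm_nonneg _).trans (hK 1)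
  have hC0 : 0 ≤ C := by
    have := (norm_nonneg _).trans (hε 1 one_pos le_rfl 0)
    simpa using this
  have hre : ∀ t, (φ t).re ≤ -(c * (t ^ 2 / (1 + |t|))) :=
    le_neg_of_second_deriv_le (p₁ := fun t => (φ₁ t).re) (p₂ := fun t => (φ₂ t).re)
      (fun t => Complex.reCLM.hasFDerivAt.comp_hasDerivAt t (h1 t))
      (fun t => Complex.reCLM.hasFDerivAt.comp_hasDerivAt t (h2 t)) (by simp [h00]) (by simp [h10])
      hneg hc hlt
  have hT1 : ∀ t : ℝ, ‖φ₁ t - φ₂ 0 * t‖ ≤ K * |t| ^ 2 :=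
    norm_le_mul_pow_of_deriv (f := fun t : ℝ => φ₁ t - φ₂ 0 * t) (f' := fun t => φ₂ t - φ₂ 0) (n := 1)
      (fun t => ((h2 t).sub ((Complex.ofRealCLM.hasDerivAt (x := t)).const_mul (φ₂ 0))).congr_deriv
        (by simp)) (by simp [h10]) (by simpa using hK)
  have hT : ∀ t : ℝ, ‖φ t - φ₂ 0 / 2 * (t : ℂ) ^ 2‖ ≤ K * |t| ^ 3 :=
    norm_le_mul_pow_of_deriv (f := fun t : ℝ => φ t - φ₂ 0 / 2 * (t : ℂ) ^ 2)
      (f' := fun t => φ₁ t - φ₂ 0 * t) (n := 2)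
      (fun t => by
        have := (h1 t).sub (((Complex.ofRealCLM.hasDerivAt (x := t)).pow 2).const_mul (φ₂ 0 / 2))
        refine this.congr_deriv ?_
        simp; ring) (by simp [h00]) hT1
  -- This gives `C b ≤ c/2`, so the perturbation uses up at most half of the linear decay.
  set b₁ := min 1 (c / (2 * C + 1)) with hb₁
  have hb₁0 : 0 < b₁ := by positivity
  have hφc : Continuous φ := continuous_iff_continuousAt.2 fun t => (h1 t).continuousAt
  -- Both exponents have real part at most `3c/2 - c|s|/2`: for the integrand this is `-c(|s| - 1) +
  -- (c/2)(1 + |s|)`. The cube leaves room for the Taylor remainder.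
  set E : ℝ → ℝ := fun s => (1 + |s|) ^ 3 * Real.exp (3 / 2 * c - c / 2 * |s|) with hE
  have hEint : Integrable E := integrable_cube_mul_exp (half_pos hc) _
  have hEle : ∀ s, Real.exp (3 / 2 * c - c / 2 * |s|) ≤ E s := fun s =>
    le_mul_of_one_le_left (Real.exp_pos _).le (one_le_pow₀ (by linarith [abs_nonneg s]))
  have hv : ∀ s : ℝ, (φ₂ 0 / 2 * (s : ℂ) ^ 2).re ≤ 3 / 2 * c - c / 2 * |s| := by
    intro s
    have e : (φ₂ 0 / 2 * (s : ℂ) ^ 2).re = (φ₂ 0).re / 2 * s ^ 2 := by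
      rw [← Complex.ofReal_pow, Complex.re_mul_ofReal, Complex.div_ofNat_re]
    have h3 := hlt 0 (by simp)
    have h4 : (φ₂ 0).re / 2 * s ^ 2 ≤ -c * s ^ 2 := by
      have := sq_nonneg s
      gcongr
      linarith
    rw [e]
    nlinarith [sq_nonneg (|s| - 1), sq_abs s, abs_nonneg s]
  have hvint : Integrable fun s : ℝ => Complex.exp (φ₂ 0 / 2 * (s : ℂ) ^ 2) := by
    refine hEint.mono' (by fun_prop : Continuous _).aestronglyMeasurable (ae_of_all _ fun s => ?_)
    rw [Complex.norm_exp]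
    exact (Real.exp_le_exp.2 (hv s)).trans (hEle s)
  refine ⟨(K + C) * ∫ s, E s, b₁, hb₁0, fun b hb hbb₁ => ?_⟩
  have hb1 : b ≤ 1 := hbb₁.trans (min_le_left _ _)
  have hbC : C * b ≤ c / 2 := by
    have h3 : b ≤ c / (2 * C + 1) := hbb₁.trans (min_le_right _ _)
    rw [le_div_iff₀ (by positivity)] at h3
    nlinarith
  have hu : ∀ s : ℝ, (φ (b * s) / (b : ℂ) ^ 2 + ε b s).re ≤ 3 / 2 * c - c / 2 * |s| := by
    intro s
    have h3 : (φ (b * s) / (b : ℂ) ^ 2).re ≤ -(c * (|s| - 1)) := by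
      rw [← Complex.ofReal_pow, Complex.div_ofReal_re, div_le_iff₀ (by positivity)]
      refine (hre (b * s)).trans ?_
      -- The bound on the phase becomes linear in `s`, uniformly in `b ≤ 1`.
      have h4 : (|s| - 1) * b ^ 2 ≤ (b * s) ^ 2 / (1 + |b * s|) := by
        rw [le_div_iff₀ (by positivity), abs_mul, abs_of_pos hb, mul_pow]
        have h5 : (|s| - 1) * (1 + b * |s|) ≤ s ^ 2 := by
          rw [← sq_abs s]
          have := abs_nonneg s
          rcases le_total |s| 1 with h | h
          · nlinarith [mul_nonneg hb.le this]
          · nlinarith [mul_le_mul_of_nonneg_left hb1 (mul_nonneg (sub_nonneg.2 h) this)]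
        nlinarith [sq_nonneg b]
      nlinarith
    have h6 : (ε b s).re ≤ c / 2 * (1 + |s|) :=
      (Complex.re_le_norm _).trans ((hε b hb hb1 s).trans
        (mul_le_mul_of_nonneg_right hbC (by positivity)))
    rw [Complex.add_re]
    linarith
  have huint : Integrable fun s : ℝ => Complex.exp (φ (b * s) / (b : ℂ) ^ 2 + ε b s) := by
    have := hεc b hb hb1
    refine hEint.mono' (by fun_prop : Continuous _).aestronglyMeasurable (ae_of_all _ fun s => ?_)
    rw [Complex.norm_exp]
    exact (Real.exp_le_exp.2 (hu s)).trans (hEle s)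
  rw [← integral_sub huint hvint]
  have hpt : ∀ s : ℝ, ‖Complex.exp (φ (b * s) / (b : ℂ) ^ 2 + ε b s) -
      Complex.exp (φ₂ 0 / 2 * (s : ℂ) ^ 2)‖ ≤ (K + C) * b * E s := by
    intro s
    refine (norm_exp_sub_exp_le (hu s) (hv s)).trans ?_
    have hbC0 : (b : ℂ) ≠ 0 := by exact_mod_cast hb.ne'
    have e : φ (b * s) / (b : ℂ) ^ 2 + ε b s - φ₂ 0 / 2 * (s : ℂ) ^ 2 =
        (φ (b * s) - φ₂ 0 / 2 * ((b * s : ℝ) : ℂ) ^ 2) / (b : ℂ) ^ 2 + ε b s := by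
      push_cast; field_simp; ring
    have h7 : ‖φ (b * s) / (b : ℂ) ^ 2 + ε b s - φ₂ 0 / 2 * (s : ℂ) ^ 2‖ ≤
        K * b * |s| ^ 3 + C * b * (1 + |s|) := by
      rw [e]
      refine (norm_add_le _ _).trans (add_le_add ?_ (hε b hb hb1 s))
      rw [norm_div, norm_pow, Complex.norm_real, Real.norm_of_nonneg hb.le,
        div_le_iff₀ (by positivity)]
      refine (hT (b * s)).trans (le_of_eq ?_)
      rw [abs_mul, abs_of_pos hb]; ring
    have h8 := h7.trans (cube_bound hK0 hC0 hb)
    calc _ ≤ Real.exp (3 / 2 * c - c / 2 * |s|) * ((K + C) * b * (1 + |s|) ^ 3) := by gcongr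
      _ = _ := by rw [hE]; ring
  refine (norm_integral_le_of_norm_le (hEint.const_mul ((K + C) * b)) (ae_of_all _ hpt)).trans
    (le_of_eq ?_)
  rw [integral_const_mul]; ring

end HyperbolicQ

/-! ### The saddle point and the expansion around it -/

namespace HyperbolicQ

open Set Filter MeasureTheory

/-- The saddle point in the rescaled variable. -/
noncomputable def saddlePoint (σ μ : ℝ) : ℂ := Complex.log (-saddle σ μ) / (2 * Real.pi)

/-- The leading exponent of the rescaled integrand. -/
noncomputable def phase (σ μ : ℝ) (X : ℂ) : ℂ :=
  Complex.I * (-Real.pi * X ^ 2 + 2 * Real.pi * X * μ) + Real.pi * X +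
    Complex.I * (transform kernZero (X + σ) + transform kernZero (X - σ))

/-- The derivative of `phase`. -/
noncomputable def phaseDeriv (σ μ : ℝ) (X : ℂ) : ℂ :=
  2 * Real.pi * Complex.I * μ + Real.pi - Complex.I *
    (Complex.log (1 + Complex.exp (2 * Real.pi * (X + σ))) +
      Complex.log (1 + Complex.exp (2 * Real.pi * (X - σ))))

/-- The logistic function `2π e^{2πz} / (1 + e^{2πz})`. -/
noncomputable def logistic (z : ℂ) : ℂ :=
  2 * Real.pi * Complex.exp (2 * Real.pi * z) / (1 + Complex.exp (2 * Real.pi * z))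

/-- The second derivative of `phase`. -/
noncomputable def phaseDeriv₂ (σ : ℝ) (X : ℂ) : ℂ :=
  -(Complex.I * (logistic (X + σ) + logistic (X - σ)))

variable {σ μ : ℝ}

theorem hasDerivAt_phase {X : ℂ} (hX : |X.im| < 1 / 2) :
    HasDerivAt (phase σ μ) (phaseDeriv σ μ X) X := by
  have h1 : |(X + σ).im| < 1 / 2 := by simpa using hX
  have h2 : |(X - σ).im| < 1 / 2 := by simpa using hX
  have d1 := (isKernel_kernZero.hasDerivAt_transform h1).comp X ((hasDerivAt_id X).add_const (σ : ℂ))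
  have d2 := (isKernel_kernZero.hasDerivAt_transform h2).comp X ((hasDerivAt_id X).sub_const (σ : ℂ))
  have d3 := ((hasDerivAt_id X).pow 2).const_mul (-Real.pi : ℂ)
  have d4 := ((hasDerivAt_id X).const_mul (2 * Real.pi : ℂ)).mul_const (μ : ℂ)
  have d5 := (hasDerivAt_id X).const_mul (Real.pi : ℂ)
  refine ((((d3.add d4).const_mul Complex.I).add d5).add
    ((d1.add d2).const_mul Complex.I)).congr_deriv ?_
  rw [transformDeriv_kernZero_eq h1, transformDeriv_kernZero_eq h2, phaseDeriv]
  simp only [id]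
  push_cast
  ring

theorem hasDerivAt_phaseDeriv {X : ℂ} (hX : |X.im| < 1 / 2) :
    HasDerivAt (phaseDeriv σ μ) (phaseDeriv₂ σ X) X := by
  have h1 : |(X + σ).im| < 1 / 2 := by simpa using hX
  have h2 : |(X - σ).im| < 1 / 2 := by simpa using hX
  have d1 := (hasDerivAt_log_one_add_exp h1).comp X ((hasDerivAt_id X).add_const (σ : ℂ))
  have d2 := (hasDerivAt_log_one_add_exp h2).comp X ((hasDerivAt_id X).sub_const (σ : ℂ))
  refine (((d1.add d2).const_mul Complex.I).const_sub
    (2 * Real.pi * Complex.I * μ + Real.pi)).congr_deriv ?_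
  rw [phaseDeriv₂, logistic, logistic]
  simp only [mul_one]

theorem hasDerivAt_logistic {z : ℂ} (hz : |z.im| < 1 / 2) :
    HasDerivAt logistic ((2 * Real.pi) ^ 2 * Complex.exp (2 * Real.pi * z) /
      (1 + Complex.exp (2 * Real.pi * z)) ^ 2) z := by
  have h := ((hasDerivAt_exp_two_pi z).const_mul (2 * Real.pi : ℂ)).div
    ((hasDerivAt_exp_two_pi z).const_add 1) (one_add_exp_ne_zero hz)
  refine h.congr_deriv ?_
  congr 1
  ring

theorem two_pi_mul_im (z : ℂ) : (2 * Real.pi * z).im = 2 * Real.pi * z.im := by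
  rw [show (2 * Real.pi : ℂ) = ((2 * Real.pi : ℝ) : ℂ) by push_cast; rfl, Complex.im_ofReal_mul]

theorem two_pi_mul_re (z : ℂ) : (2 * Real.pi * z).re = 2 * Real.pi * z.re := by
  rw [show (2 * Real.pi : ℂ) = ((2 * Real.pi : ℝ) : ℂ) by push_cast; rfl, Complex.re_ofReal_mul]

theorem normSq_one_add_exp (w : ℂ) : Complex.normSq (1 + Complex.exp w) =
    1 + 2 * Real.exp w.re * Real.cos w.im + Real.exp w.re ^ 2 := by
  rw [Complex.normSq_apply, Complex.add_re, Complex.add_im, Complex.exp_re, Complex.exp_im,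
    Complex.one_re, Complex.one_im]
  linear_combination (Real.exp w.re ^ 2) * Real.sin_sq_add_cos_sq w.im

/-- With `r = e^{re w}` and `θ = im w`, the norm is `(r + cos θ)² + sin² θ` and also `(1 + r cos θ)²
+ r² sin² θ`; one form serves for `r ≤ 1`, the other for `r ≥ 1`. -/
theorem sin_sq_mul_exp_le_normSq (w : ℂ) :
    Real.sin w.im ^ 2 * Real.exp w.re ≤ Complex.normSq (1 + Complex.exp w) := by
  rw [normSq_one_add_exp]
  have h := Real.sin_sq_add_cos_sq w.im
  set r := Real.exp w.re with hr
  set s := Real.sin w.im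
  set k := Real.cos w.im
  have hr0 : 0 < r := Real.exp_pos _
  rcases le_total r 1 with h1 | h1
  · nlinarith [sq_nonneg (r + k), mul_nonneg (sq_nonneg s) (sub_nonneg.2 h1)]
  · nlinarith [sq_nonneg (1 + r * k),
      mul_nonneg (mul_nonneg (sq_nonneg s) hr0.le) (sub_nonneg.2 h1)]

theorem norm_deriv_logistic_le {z : ℂ} (hs : Real.sin (2 * Real.pi * z.im) ≠ 0) :
    ‖(2 * (Real.pi : ℂ)) ^ 2 * Complex.exp (2 * Real.pi * z) /
      (1 + Complex.exp (2 * Real.pi * z)) ^ 2‖ ≤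
      (2 * Real.pi) ^ 2 / Real.sin (2 * Real.pi * z.im) ^ 2 := by
  have h := sin_sq_mul_exp_le_normSq (2 * Real.pi * z)
  rw [two_pi_mul_im] at h
  have hs2 : 0 < Real.sin (2 * Real.pi * z.im) ^ 2 := by positivity
  have hpos : 0 < Complex.normSq (1 + Complex.exp (2 * Real.pi * z)) :=
    lt_of_lt_of_le (mul_pos hs2 (Real.exp_pos _)) h
  have e : ‖2 * (Real.pi : ℂ)‖ = 2 * Real.pi := by
    rw [norm_mul, Complex.norm_ofNat, Complex.norm_real, Real.norm_of_nonneg Real.pi_pos.le]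
  rw [norm_div, norm_mul, norm_pow, norm_pow, e, ← Complex.normSq_eq_norm_sq, Complex.norm_exp,
    div_le_div_iff₀ hpos hs2]
  have := mul_le_mul_of_nonneg_left h (by positivity : 0 ≤ (2 * Real.pi) ^ 2)
  linarith

theorem logistic_im (z : ℂ) : (logistic z).im = 2 * Real.pi *
    (Real.exp (2 * Real.pi * z.re) * Real.sin (2 * Real.pi * z.im)) /
      Complex.normSq (1 + Complex.exp (2 * Real.pi * z)) := by
  rw [logistic, Complex.div_im, two_pi_mul_im, two_pi_mul_re, Complex.add_re,
    Complex.add_im, Complex.exp_re, Complex.exp_im, two_pi_mul_im, two_pi_mul_re]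
  simp only [Complex.one_re, Complex.one_im, zero_add]
  ring

theorem logistic_im_nonpos {z : ℂ} (hs : Real.sin (2 * Real.pi * z.im) ≤ 0) :
    (logistic z).im ≤ 0 := by
  rw [logistic_im]
  refine div_nonpos_of_nonpos_of_nonneg ?_ (Complex.normSq_nonneg _)
  exact mul_nonpos_of_nonneg_of_nonpos (by positivity)
    (mul_nonpos_of_nonneg_of_nonpos (Real.exp_pos _).le hs)

theorem logistic_im_le {z : ℂ} (hs : Real.sin (2 * Real.pi * z.im) < 0) {R : ℝ}
    (hR : |2 * Real.pi * z.re| ≤ R) :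
    (logistic z).im ≤ 2 * Real.pi * Real.sin (2 * Real.pi * z.im) * (Real.exp (-R) / 4) := by
  have hpi := Real.pi_pos
  have h := sin_sq_mul_exp_le_normSq (2 * Real.pi * z)
  rw [two_pi_mul_im] at h
  have hpos : 0 < Complex.normSq (1 + Complex.exp (2 * Real.pi * z)) :=
    lt_of_lt_of_le (mul_pos (sq_pos_of_neg hs) (Real.exp_pos _)) h
  have hN : Complex.normSq (1 + Complex.exp (2 * Real.pi * z)) ≤
      4 * Real.exp R * Real.exp (2 * Real.pi * z.re) := by
    rw [normSq_one_add_exp, two_pi_mul_re]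
    have h2 := abs_le.1 hR
    set x := 2 * Real.pi * z.re
    have hc := Real.cos_le_one (2 * Real.pi * z).im
    have hx := Real.exp_pos x
    have e1 : 1 ≤ Real.exp R * Real.exp x := by
      rw [← Real.exp_add]; exact Real.one_le_exp (by linarith)
    have e2 : Real.exp x ≤ Real.exp R := Real.exp_le_exp.2 h2.2
    have e3 : 1 ≤ Real.exp R := Real.one_le_exp (by linarith [abs_nonneg x])
    nlinarith [mul_le_mul_of_nonneg_right e2 hx.le, mul_le_mul_of_nonneg_right e3 hx.le,
      mul_le_mul_of_nonneg_left hc hx.le]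
  rw [logistic_im, div_le_iff₀ hpos]
  have e4 : Real.exp (-R) * Real.exp R = 1 := by rw [← Real.exp_add]; simp
  have h3 : Real.exp (-R) / 4 * Complex.normSq (1 + Complex.exp (2 * Real.pi * z)) ≤
      Real.exp (2 * Real.pi * z.re) := by
    calc _ ≤ Real.exp (-R) / 4 * (4 * Real.exp R * Real.exp (2 * Real.pi * z.re)) := by gcongr
      _ = (Real.exp (-R) * Real.exp R) * Real.exp (2 * Real.pi * z.re) := by ring
      _ = _ := by rw [e4, one_mul]
  have h4 := mul_le_mul_of_nonpos_left h3
    (by nlinarith : 2 * Real.pi * Real.sin (2 * Real.pi * z.im) ≤ 0)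
  linarith

theorem saddle_ne_zero
    (h : Real.sinh (2 * Real.pi * σ) ^ 2 < Real.exp (2 * Real.pi * μ)) : saddle σ μ ≠ 0 := fun h0 => by
  have := saddle_im_pos h
  simp [h0] at this

theorem exp_saddlePoint
    (h : Real.sinh (2 * Real.pi * σ) ^ 2 < Real.exp (2 * Real.pi * μ)) : Complex.exp (2 * Real.pi * saddlePoint σ μ) = -saddle σ μ := by
  rw [saddlePoint, mul_div_cancel₀ _ (by simp),
    Complex.exp_log (neg_ne_zero.2 (saddle_ne_zero h))]

theorem log_neg_saddle
    (h : Real.sinh (2 * Real.pi * σ) ^ 2 < Real.exp (2 * Real.pi * μ)) :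
    Complex.log (-saddle σ μ) = Complex.log (saddle σ μ) - Real.pi * Complex.I := by
  have harg := Complex.arg_neg_eq_arg_sub_pi_of_im_pos (saddle_im_pos h)
  rw [Complex.log, Complex.log, harg, norm_neg]
  push_cast; ring

/-- The saddle lies in the open first quadrant, so `-z` has argument in `(-π, -π/2)`. Strictness of
the upper bound makes the line through the saddle point admissible for small `b`. -/
theorem saddlePoint_im
    (h : Real.sinh (2 * Real.pi * σ) ^ 2 < Real.exp (2 * Real.pi * μ)) : -(1 / 2) < (saddlePoint σ μ).im ∧ (saddlePoint σ μ).im < -(1 / 4) := by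
  have hpi := Real.pi_pos
  have hz := arg_mem_Ioo_of_im_pos (saddle_im_pos h)
  have hz2 := Complex.abs_arg_lt_pi_div_two_iff.2 (Or.inl (saddle_re_pos σ μ))
  have hz3 := (abs_lt.1 hz2).2
  have e : (saddlePoint σ μ).im = ((saddle σ μ).arg - Real.pi) / (2 * Real.pi) := by
    rw [saddlePoint, show (2 * Real.pi : ℂ) = ((2 * Real.pi : ℝ) : ℂ) by push_cast; rfl,
      Complex.div_ofReal_im, Complex.log_im,
      Complex.arg_neg_eq_arg_sub_pi_of_im_pos (saddle_im_pos h)]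
  rw [e, lt_div_iff₀ (by positivity), div_lt_iff₀ (by positivity)]
  constructor <;> linarith [hz.1]

theorem abs_saddlePoint_im
    (h : Real.sinh (2 * Real.pi * σ) ^ 2 < Real.exp (2 * Real.pi * μ)) : |(saddlePoint σ μ).im| < 1 / 2 := by
  have := saddlePoint_im h
  exact abs_lt.2 ⟨by linarith, by linarith⟩

theorem sin_saddlePoint_im_neg
    (h : Real.sinh (2 * Real.pi * σ) ^ 2 < Real.exp (2 * Real.pi * μ)) : Real.sin (2 * Real.pi * (saddlePoint σ μ).im) < 0 := by
  have hpi := Real.pi_pos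
  have := saddlePoint_im h
  exact Real.sin_neg_of_neg_of_neg_pi_lt (by nlinarith) (by nlinarith)

theorem exp_saddlePoint_add
    (h : Real.sinh (2 * Real.pi * σ) ^ 2 < Real.exp (2 * Real.pi * μ)) : Complex.exp (2 * Real.pi * (saddlePoint σ μ + σ)) =
    -((Real.exp (2 * Real.pi * σ) : ℂ) * saddle σ μ) := by
  rw [mul_add, Complex.exp_add, exp_saddlePoint h]
  push_cast; ring

theorem exp_saddlePoint_sub
    (h : Real.sinh (2 * Real.pi * σ) ^ 2 < Real.exp (2 * Real.pi * μ)) : Complex.exp (2 * Real.pi * (saddlePoint σ μ - σ)) =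
    -((Real.exp (-2 * Real.pi * σ) : ℂ) * saddle σ μ) := by
  rw [mul_sub, sub_eq_add_neg, Complex.exp_add, exp_saddlePoint h]
  push_cast; ring_nf

/-- By the polar forms the two logarithms sum to `2πμ - iπ`: the angles and the shifts by `±2πσ`
cancel. -/
theorem phaseDeriv_saddlePoint
    (h : Real.sinh (2 * Real.pi * σ) ^ 2 < Real.exp (2 * Real.pi * μ)) : phaseDeriv σ μ (saddlePoint σ μ) = 0 := by
  have hm := angle_mem h
  have hpi := Real.pi_pos
  rw [phaseDeriv, exp_saddlePoint_add h, exp_saddlePoint_sub h, ← sub_eq_add_neg,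
    ← sub_eq_add_neg, one_sub_exp_mul_saddle h, one_sub_exp_neg_mul_saddle h, Complex.log_exp,
    Complex.log_exp]
  · push_cast
    linear_combination (Real.pi : ℂ) * Complex.I_sq
  · simpa using by linarith [hm.1]
  · simpa using by linarith [hm.2]
  · simpa using by linarith [hm.2]
  · simpa using by linarith [hm.1]

/-- The quadratic equation of the saddle says `(1 - e^{2πσ} z)(1 - e^{-2πσ} z) = -e^{2πμ}`, so each
denominator is inverted by the other factor. -/
theorem phaseDeriv₂_saddlePoint
    (h : Real.sinh (2 * Real.pi * σ) ^ 2 < Real.exp (2 * Real.pi * μ)) : phaseDeriv₂ σ (saddlePoint σ μ) =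
    -(4 * Real.pi * (√(disc σ μ) : ℂ) * saddle σ μ * (Real.exp (-(2 * Real.pi * μ)) : ℂ)) := by
  have hE1 : Real.exp (2 * Real.pi * σ) * Real.exp (-2 * Real.pi * σ) = 1 := by
    rw [← Real.exp_add]; simp
  have hE2 : Real.exp (2 * Real.pi * μ) * Real.exp (-(2 * Real.pi * μ)) = 1 := by
    rw [← Real.exp_add]; simp
  have hcosh : Real.exp (2 * Real.pi * σ) + Real.exp (-2 * Real.pi * σ) =
      2 * Real.cosh (2 * Real.pi * σ) := by
    rw [Real.cosh_eq]; ring_nf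
  have hcs := Real.cosh_sq (2 * Real.pi * σ)
  have hq : √(disc σ μ) ^ 2 = Real.exp (2 * Real.pi * μ) - Real.sinh (2 * Real.pi * σ) ^ 2 := by
    rw [Real.sq_sqrt (by rw [disc]; linarith), disc]
  have hB0 : 1 - (Real.exp (2 * Real.pi * σ) : ℂ) * saddle σ μ ≠ 0 := by
    rw [one_sub_exp_mul_saddle h]; exact Complex.exp_ne_zero _
  have hA0 : 1 - (Real.exp (-2 * Real.pi * σ) : ℂ) * saddle σ μ ≠ 0 := by
    rw [one_sub_exp_neg_mul_saddle h]; exact Complex.exp_ne_zero _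
  rw [phaseDeriv₂, logistic, logistic, exp_saddlePoint_add h, exp_saddlePoint_sub h,
    ← sub_eq_add_neg, ← sub_eq_add_neg]
  have hz : saddle σ μ = (Real.cosh (2 * Real.pi * σ) : ℂ) + Complex.I * (√(disc σ μ) : ℂ) := rfl
  set z := saddle σ μ
  set e := Real.exp (2 * Real.pi * σ)
  set e' := Real.exp (-2 * Real.pi * σ)
  set m := Real.exp (2 * Real.pi * μ)
  set m' := Real.exp (-(2 * Real.pi * μ))
  set ch := Real.cosh (2 * Real.pi * σ)
  set sh := Real.sinh (2 * Real.pi * σ)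
  set q := √(disc σ μ)
  have cE1 : (e : ℂ) * e' = 1 := by exact_mod_cast hE1
  have cE2 : (m : ℂ) * m' = 1 := by exact_mod_cast hE2
  have ccosh : (e : ℂ) + e' = 2 * ch := by exact_mod_cast hcosh
  have ccs : (ch : ℂ) ^ 2 = sh ^ 2 + 1 := by exact_mod_cast hcs
  have cq : (q : ℂ) ^ 2 = m - sh ^ 2 := by exact_mod_cast hq
  have hI := Complex.I_sq
  have hz2 : z ^ 2 = 2 * ch * z - 1 - m := by
    rw [hz]; linear_combination (q : ℂ) ^ 2 * hI - cq - ccs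
  have hprod : (1 - e * z) * (1 - e' * z) = -(m : ℂ) := by
    linear_combination z ^ 2 * cE1 - z * ccosh + hz2
  have hm0 : (m : ℂ) ≠ 0 := left_ne_zero_of_mul_eq_one cE2
  have hinvB : (1 - e * z)⁻¹ = -(m' : ℂ) * (1 - e' * z) := by
    refine inv_eq_of_mul_eq_one_right ?_
    linear_combination (-(m' : ℂ)) * hprod + cE2
  have hinvA : (1 - e' * z)⁻¹ = -(m' : ℂ) * (1 - e * z) := by
    refine inv_eq_of_mul_eq_one_right ?_
    linear_combination (-(m' : ℂ)) * hprod + cE2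
  rw [div_eq_mul_inv, div_eq_mul_inv, hinvA, hinvB]
  have hkey : z * (ch - z) = -Complex.I * q * z := by rw [hz]; ring
  have hs : Complex.I * (2 * Real.pi * -(e * z) * (-(m' : ℂ) * (1 - e' * z)) +
      2 * Real.pi * -(e' * z) * (-(m' : ℂ) * (1 - e * z))) =
      Complex.I * (4 * Real.pi * m' * (z * (ch - z))) := by
    linear_combination Complex.I * (2 * Real.pi * m' * z) * ccosh -
      Complex.I * (4 * Real.pi * m' * z ^ 2) * cE1
  rw [hs, hkey]
  linear_combination (4 * Real.pi * m' * q * z) * hI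

/-- The squares in the three closed forms of the transforms cancel those of the prefactor and of the
Gaussian factor, and the constants add to `7/24 + 3/24 = 5/12`. -/
theorem fQ_eq_phase
    (h : Real.sinh (2 * Real.pi * σ) ^ 2 < Real.exp (2 * Real.pi * μ)) : fQ σ μ =
    Complex.I * Real.pi * (7 / 24 - (μ : ℂ) ^ 2 / 2 + Complex.I * μ - (σ : ℂ) ^ 2) +
      Complex.I * transform kernZero μ + phase σ μ (saddlePoint σ μ) := by
  have him := abs_saddlePoint_im h
  have hpi : (Real.pi : ℂ) ≠ 0 := by exact_mod_cast Real.pi_ne_zero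
  have hX : 2 * Real.pi * saddlePoint σ μ = Complex.log (-saddle σ μ) := by
    rw [saddlePoint]; field_simp
  have h1 := I_mul_transform_kernZero (z := (μ : ℂ)) (by simp)
  have h2 := I_mul_transform_kernZero (z := saddlePoint σ μ + σ) (by simpa using him)
  have h3 := I_mul_transform_kernZero (z := saddlePoint σ μ - σ) (by simpa using him)
  rw [exp_saddlePoint_add h, neg_neg] at h2
  rw [exp_saddlePoint_sub h, neg_neg] at h3
  have e1 : Complex.exp (2 * Real.pi * μ) = (Real.exp (2 * Real.pi * μ) : ℂ) := by push_cast; rfl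
  rw [e1] at h1
  rw [phase, mul_add Complex.I (transform kernZero _), h1, h2, h3, fQ, ← hX]
  linear_combination (-(Real.pi : ℂ) * μ) * Complex.I_sq

theorem comparisonBound_nonneg (a : ℝ) : 0 ≤ comparisonBound a :=
  mul_nonneg zero_le_two (setIntegral_nonneg measurableSet_Ioi fun y hy =>
    mul_nonneg (by positivity) (kernZero_nonneg hy))

/-- The correction to the leading exponent of the rescaled integrand near the saddle point. -/
noncomputable def correction (σ μ b s : ℝ) : ℂ :=
  Real.pi * ((b * s : ℝ) : ℂ) + Complex.I / (b : ℂ) ^ 2 *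
    ((transform (kern (b ^ 2)) (saddlePoint σ μ + ((b * s : ℝ) : ℂ) + σ) -
        transform kernZero (saddlePoint σ μ + ((b * s : ℝ) : ℂ) + σ)) +
      (transform (kern (b ^ 2)) (saddlePoint σ μ + ((b * s : ℝ) : ℂ) - σ) -
        transform kernZero (saddlePoint σ μ + ((b * s : ℝ) : ℂ) - σ)))

/-- The `β` in `1 + β` contributes `πX` at order `b⁰`: its value at the saddle point is factored
out, and the rest `πbs` joins `correction`. -/
theorem scaledIntegrand_saddlePoint {b : ℝ} (hb : 0 < b) (σ μ s : ℝ) :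
    scaledIntegrand (b ^ 2) σ μ (saddlePoint σ μ + ((b * s : ℝ) : ℂ)) =
      Complex.exp (phase σ μ (saddlePoint σ μ) / (b : ℂ) ^ 2 + Real.pi * saddlePoint σ μ) *
        Complex.exp ((phase σ μ (saddlePoint σ μ + ((b * s : ℝ) : ℂ)) -
          phase σ μ (saddlePoint σ μ)) / (b : ℂ) ^ 2 + correction σ μ b s) := by
  have hbC : (b : ℂ) ≠ 0 := by exact_mod_cast hb.ne'
  rw [← Complex.exp_add, scaledIntegrand, correction]
  congr 1
  generalize phase σ μ (saddlePoint σ μ) = P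
  obtain ⟨t, ht⟩ : ∃ t : ℂ, t = ((b * s : ℝ) : ℂ) := ⟨_, rfl⟩
  rw [← ht]
  obtain ⟨X, hX⟩ : ∃ X : ℂ, X = saddlePoint σ μ + t := ⟨_, rfl⟩
  rw [← hX, phase, eq_sub_of_add_eq hX.symm]
  push_cast
  field_simp
  linear_combination (-(Real.pi : ℂ) * X * (1 + b ^ 2)) * Complex.I_sq

theorem norm_scaled_comparison_le {b a : ℝ} (hb : 0 < b) (ha : a < 1 / 2) {z : ℂ}
    (hz : |z.im| ≤ a) :
    ‖Complex.I / (b : ℂ) ^ 2 * (transform (kern (b ^ 2)) z - transform kernZero z)‖ ≤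
      b ^ 2 * (‖z‖ * comparisonBound a) := by
  have h := norm_transform_kern_sub_le (β := b ^ 2) (by positivity) ha hz
  rw [norm_mul, norm_div, Complex.norm_I, norm_pow, Complex.norm_real, Real.norm_of_nonneg hb.le,
    one_div, inv_mul_le_iff₀ (by positivity)]
  refine h.trans (le_of_eq ?_)
  ring

theorem continuous_correction (h : Real.sinh (2 * Real.pi * σ) ^ 2 < Real.exp (2 * Real.pi * μ))
    {b : ℝ} (hb : 0 < b) : Continuous (correction σ μ b) := by
  have him := abs_saddlePoint_im h
  have hk : ∀ {k : ℝ → ℝ} {B : ℝ}, IsKernel k B → 1 / 2 ≤ B → ∀ c : ℝ,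
      Continuous fun s : ℝ => transform k (saddlePoint σ μ + ((b * s : ℝ) : ℂ) + c) := by
    intro k B hk hB c
    refine continuous_iff_continuousAt.2 fun s => ?_
    refine ContinuousAt.comp (g := transform k)
      (f := fun s : ℝ => saddlePoint σ μ + ((b * s : ℝ) : ℂ) + c)
      (hk.hasDerivAt_transform ?_).continuousAt (by fun_prop)
    have e : (saddlePoint σ μ + ((b * s : ℝ) : ℂ) + c).im = (saddlePoint σ μ).im := by simp
    rw [e]
    linarith
  have hβ : 0 < b ^ 2 := by positivity
  have hB : (1 : ℝ) / 2 ≤ (1 + b ^ 2) / 2 := by linarith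
  have c1 := hk (isKernel_kern hβ) hB σ
  have c2 := hk isKernel_kernZero le_rfl σ
  have c3 := hk (isKernel_kern hβ) hB (-σ)
  have c4 := hk isKernel_kernZero le_rfl (-σ)
  simp only [Complex.ofReal_neg, ← sub_eq_add_neg] at c3 c4
  exact (continuous_const.mul (by fun_prop)).add
    (continuous_const.mul ((c1.sub c2).add (c3.sub c4)))

theorem norm_correction_le (h : Real.sinh (2 * Real.pi * σ) ^ 2 < Real.exp (2 * Real.pi * μ))
    {b : ℝ} (hb : 0 < b) (hb1 : b ≤ 1) (s : ℝ) :
    ‖correction σ μ b s‖ ≤ (Real.pi + 2 * (‖saddlePoint σ μ‖ + |σ| + 1) *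
      comparisonBound |(saddlePoint σ μ).im|) * b * (1 + |s|) := by
  have hpi := Real.pi_pos
  have him := abs_saddlePoint_im h
  set a := |(saddlePoint σ μ).im| with ha
  have hcb := comparisonBound_nonneg a
  set X := saddlePoint σ μ + ((b * s : ℝ) : ℂ) with hX
  have hXn : ‖X‖ ≤ ‖saddlePoint σ μ‖ + |s| := by
    refine (norm_add_le _ _).trans ?_
    rw [Complex.norm_real, Real.norm_eq_abs, abs_mul, abs_of_pos hb]
    gcongr
    exact mul_le_of_le_one_left (abs_nonneg _) hb1
  have h1 := norm_scaled_comparison_le hb him (z := X + σ) (by simp [hX, ha])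
  have h2 := norm_scaled_comparison_le hb him (z := X - σ) (by simp [hX, ha])
  have n1 : ‖X + σ‖ ≤ ‖saddlePoint σ μ‖ + |s| + |σ| := by
    have := norm_add_le X (σ : ℂ)
    rw [Complex.norm_real, Real.norm_eq_abs] at this
    linarith
  have n2 : ‖X - σ‖ ≤ ‖saddlePoint σ μ‖ + |s| + |σ| := by
    have := norm_sub_le X (σ : ℂ)
    rw [Complex.norm_real, Real.norm_eq_abs] at this
    linarith
  have h0 : ‖(Real.pi : ℂ) * ((b * s : ℝ) : ℂ)‖ = Real.pi * b * |s| := by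
    rw [norm_mul, Complex.norm_real, Complex.norm_real, Real.norm_of_nonneg hpi.le,
      Real.norm_eq_abs, abs_mul, abs_of_pos hb]
    ring
  have hs0 := abs_nonneg s
  have hσ0 := abs_nonneg σ
  have hn0 := norm_nonneg (saddlePoint σ μ)
  have hbb : b ^ 2 ≤ b := by nlinarith
  have hle : ‖saddlePoint σ μ‖ + |s| + |σ| ≤ (‖saddlePoint σ μ‖ + |σ| + 1) * (1 + |s|) := by
    nlinarith [mul_nonneg hn0 hs0, mul_nonneg hσ0 hs0]
  have hterm : ∀ w : ℂ, ‖w‖ ≤ ‖saddlePoint σ μ‖ + |s| + |σ| →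
      b ^ 2 * (‖w‖ * comparisonBound a) ≤
        b * ((‖saddlePoint σ μ‖ + |σ| + 1) * (1 + |s|) * comparisonBound a) := by
    intro w hw
    have := hw.trans hle
    gcongr
  have t1 := h1.trans (hterm _ n1)
  have t2 := h2.trans (hterm _ n2)
  rw [correction, mul_add]
  refine (norm_add_le _ _).trans ?_
  rw [h0]
  have h3 : Real.pi * b * |s| ≤ Real.pi * b * (1 + |s|) := by gcongr; linarith
  have := norm_add_le (Complex.I / (b : ℂ) ^ 2 *
      (transform (kern (b ^ 2)) (X + σ) - transform kernZero (X + σ)))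
    (Complex.I / (b : ℂ) ^ 2 * (transform (kern (b ^ 2)) (X - σ) - transform kernZero (X - σ)))
  linarith

/-- The integral over the steepest horizontal line in the variable `s`, `X = X₀ + b s`. -/
noncomputable def saddleIntegral (σ μ b : ℝ) : ℂ :=
  ∫ s : ℝ, Complex.exp ((phase σ μ (saddlePoint σ μ + ((b * s : ℝ) : ℂ)) -
    phase σ μ (saddlePoint σ μ)) / (b : ℂ) ^ 2 + correction σ μ b s)

/-- The limit of `saddleIntegral`. -/
noncomputable def saddleGaussian (σ μ : ℝ) : ℂ :=
  ∫ s : ℝ, Complex.exp (phaseDeriv₂ σ (saddlePoint σ μ) / 2 * (s : ℂ) ^ 2)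

/-- Along the line the real part of the second derivative is a sum of imaginary parts of `logistic`,
whose sign is that of `sin (2π im X₀) < 0`. This is the concavity that `laplace_method` needs. -/
theorem exists_norm_saddleIntegral_sub_le
    (h : Real.sinh (2 * Real.pi * σ) ^ 2 < Real.exp (2 * Real.pi * μ)) :
    ∃ D b₁ : ℝ, 0 < b₁ ∧ ∀ b, 0 < b → b ≤ b₁ →
      ‖saddleIntegral σ μ b - saddleGaussian σ μ‖ ≤ D * b := by
  have hpi := Real.pi_pos
  have him := abs_saddlePoint_im h
  have hsin := sin_saddlePoint_im_neg h
  set X₀ := saddlePoint σ μ with hX₀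
  have hline : ∀ t : ℝ, |(X₀ + (t : ℂ)).im| < 1 / 2 := fun t => by simpa using him
  have hshift : ∀ t : ℝ, HasDerivAt (fun t : ℝ => X₀ + (t : ℂ)) 1 t := fun t =>
    (Complex.ofRealCLM.hasDerivAt (x := t)).const_add X₀ |>.congr_deriv (by simp)
  have hd1 : ∀ t : ℝ, HasDerivAt (fun t : ℝ => phase σ μ (X₀ + (t : ℂ)) - phase σ μ X₀)
      (phaseDeriv σ μ (X₀ + (t : ℂ))) t := fun t =>
    (((hasDerivAt_phase (hline t)).comp t (hshift t)).sub_const _).congr_deriv (mul_one _)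
  have hd2 : ∀ t : ℝ, HasDerivAt (fun t : ℝ => phaseDeriv σ μ (X₀ + (t : ℂ)))
      (phaseDeriv₂ σ (X₀ + (t : ℂ))) t := fun t =>
    (HasDerivAt.comp (h₂ := phaseDeriv σ μ) (h := fun t : ℝ => X₀ + (t : ℂ)) t
      (hasDerivAt_phaseDeriv (hline t)) (hshift t)).congr_deriv (mul_one _)
  have him' : ∀ t c : ℝ, (X₀ + (t : ℂ) + (c : ℂ)).im = X₀.im := fun t c => by simp
  have hlog : ∀ c t : ℝ, HasDerivAt (fun t : ℝ => logistic (X₀ + (t : ℂ) + (c : ℂ)))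
      ((2 * Real.pi) ^ 2 * Complex.exp (2 * Real.pi * (X₀ + (t : ℂ) + (c : ℂ))) /
      (1 + Complex.exp (2 * Real.pi * (X₀ + (t : ℂ) + (c : ℂ)))) ^ 2) t := fun c t =>
    ((hasDerivAt_logistic (by rw [him']; exact him)).comp t
      ((hshift t).add_const (c : ℂ))).congr_deriv (mul_one _)
  set K := (2 * Real.pi) ^ 2 / Real.sin (2 * Real.pi * X₀.im) ^ 2 with hK
  have hlogLip : ∀ c t : ℝ, ‖logistic (X₀ + (t : ℂ) + (c : ℂ)) - logistic (X₀ + (c : ℂ))‖ ≤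
      K * |t| := fun c t => by
    have := norm_le_mul_pow_of_deriv (n := 0) (K := K)
      (fun t => (hlog c t).sub_const (logistic (X₀ + (c : ℂ)))) (by simp) (fun t => by
        have := norm_deriv_logistic_le (z := X₀ + (t : ℂ) + (c : ℂ)) (by rw [him']; exact hsin.ne)
        rw [him'] at this
        simpa using this) t
    simpa using this
  have hRe : ∀ t : ℝ, (phaseDeriv₂ σ (X₀ + (t : ℂ))).re =
      (logistic (X₀ + (t : ℂ) + (σ : ℂ))).im + (logistic (X₀ + (t : ℂ) + ((-σ : ℝ) : ℂ))).im := by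
    intro t
    rw [phaseDeriv₂, Complex.neg_re, Complex.I_mul_re, neg_neg, Complex.add_im, Complex.ofReal_neg,
      ← sub_eq_add_neg]
  set R := 2 * Real.pi * (|X₀.re| + 1 + |σ|) with hR
  -- Adding the two bounds of `logistic_im_le` on `|t| ≤ 1` gives `π sin (2π im X₀) e^{-R} = -2c`.
  set c := -(Real.pi * Real.sin (2 * Real.pi * X₀.im) * Real.exp (-R) / 2) with hc
  have hc0 : 0 < c := by
    have : 0 < Real.pi * -Real.sin (2 * Real.pi * X₀.im) * Real.exp (-R) :=
      mul_pos (mul_pos hpi (neg_pos.2 hsin)) (Real.exp_pos _)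
    rw [hc]; linarith
  have key := laplace_method (φ := fun t : ℝ => phase σ μ (X₀ + (t : ℂ)) - phase σ μ X₀)
    (φ₁ := fun t : ℝ => phaseDeriv σ μ (X₀ + (t : ℂ)))
    (φ₂ := fun t : ℝ => phaseDeriv₂ σ (X₀ + (t : ℂ))) hd1 hd2 (by simp)
    (by simpa using phaseDeriv_saddlePoint h) (K := 2 * K) (c := c) (fun t => ?_) (fun t => ?_) hc0
    (fun t ht => ?_) (ε := correction σ μ) (fun b hb _ => continuous_correction h hb)
    (fun b hb hb1 s => norm_correction_le h hb hb1 s)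
  · obtain ⟨D, b₁, hb₁, hD⟩ := key
    refine ⟨D, b₁, hb₁, fun b hb hbb => ?_⟩
    have := hD b hb hbb
    simpa only [saddleIntegral, saddleGaussian, ← hX₀, Complex.ofReal_zero, add_zero] using this
  · have l1 := hlogLip σ t
    have l2 := hlogLip (-σ) t
    rw [Complex.ofReal_neg, ← sub_eq_add_neg, ← sub_eq_add_neg] at l2
    have e : phaseDeriv₂ σ (X₀ + (t : ℂ)) - phaseDeriv₂ σ (X₀ + ((0 : ℝ) : ℂ)) =
        -(Complex.I * ((logistic (X₀ + (t : ℂ) + (σ : ℂ)) - logistic (X₀ + (σ : ℂ))) +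
          (logistic (X₀ + (t : ℂ) - (σ : ℂ)) - logistic (X₀ - (σ : ℂ))))) := by
      rw [phaseDeriv₂, phaseDeriv₂, Complex.ofReal_zero, add_zero]; ring
    rw [e, norm_neg, norm_mul, Complex.norm_I, one_mul]
    refine (norm_add_le _ _).trans ?_
    linarith
  · rw [hRe]
    exact add_nonpos (logistic_im_nonpos (by rw [him']; exact hsin.le))
      (logistic_im_nonpos (by rw [him']; exact hsin.le))
  · have hre : ∀ s : ℝ, |s| = |σ| → |2 * Real.pi * (X₀ + (t : ℂ) + (s : ℂ)).re| ≤ R := by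
      intro s hs
      rw [abs_mul, abs_of_pos (by positivity : 0 < 2 * Real.pi), hR]
      gcongr
      simp only [Complex.add_re, Complex.ofReal_re]
      have a1 := abs_add_le (X₀.re + t) s
      have a2 := abs_add_le X₀.re t
      linarith
    have b1 := logistic_im_le (z := X₀ + (t : ℂ) + (σ : ℂ)) (by rw [him']; exact hsin) (hre σ rfl)
    have b2 := logistic_im_le (z := X₀ + (t : ℂ) + ((-σ : ℝ) : ℂ)) (by rw [him']; exact hsin)
      (hre (-σ) (abs_neg σ))
    rw [him'] at b1 b2
    rw [hRe, hc]
    linarith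

theorem integral_scaledIntegrand_saddlePoint {b : ℝ} (hb : 0 < b) (σ μ : ℝ) :
    (b⁻¹ : ℝ) * ∫ t : ℝ, scaledIntegrand (b ^ 2) σ μ (t + Complex.I * (saddlePoint σ μ).im) =
      Complex.exp (phase σ μ (saddlePoint σ μ) / (b : ℂ) ^ 2 + Real.pi * saddlePoint σ μ) *
        saddleIntegral σ μ b := by
  have htr := integral_add_right_eq_self (μ := volume)
    (fun t : ℝ => scaledIntegrand (b ^ 2) σ μ (t + Complex.I * (saddlePoint σ μ).im))
    (saddlePoint σ μ).re
  have hsc := Measure.integral_comp_mul_left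
    (fun t : ℝ => scaledIntegrand (b ^ 2) σ μ (saddlePoint σ μ + (t : ℂ))) b
  rw [abs_of_pos (inv_pos.2 hb), Complex.real_smul] at hsc
  rw [← htr, saddleIntegral, ← integral_const_mul (Complex.exp _),
    integral_congr_ae (Eventually.of_forall fun s => (scaledIntegrand_saddlePoint hb σ μ s).symm),
    hsc]
  congr 2
  funext t
  congr 1
  conv_rhs => rw [← Complex.re_add_im (saddlePoint σ μ)]
  push_cast; ring

/-- The correction to the leading exponent of the prefactor. -/
noncomputable def prefactorCorrection (μ b : ℝ) : ℂ :=
  7 * Real.pi * Complex.I / 24 * (b : ℂ) ^ 2 + Complex.I / (b : ℂ) ^ 2 *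
    (transform (kern (b ^ 2)) μ - transform kernZero μ)

/-- As `Q² = b² + 2 + b⁻²`, the constant phase is `1/6 + 7/12 = 3/4`; the `b²` term goes to the
correction. -/
theorem prefactorQ_eq {b : ℝ} (hb : 0 < b) (σ μ : ℝ) :
    prefactorQ b (σ / b) (μ / b) =
      Complex.exp ((Complex.I * Real.pi * (7 / 24 - (μ : ℂ) ^ 2 / 2 + Complex.I * μ - (σ : ℂ) ^ 2) +
        Complex.I * transform kernZero μ) / (b : ℂ) ^ 2 +
        (3 * Real.pi * Complex.I / 4 - Real.pi * μ) + prefactorCorrection μ b) := by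
  have hbC : (b : ℂ) ≠ 0 := by exact_mod_cast hb.ne'
  have e : ((μ / b : ℝ) : ℂ) = (μ : ℂ) / b := by push_cast; rfl
  rw [prefactorQ, e, sb_div_eq hb, ← Complex.exp_add, prefactorCorrection, bigQ]
  congr 1
  push_cast
  field_simp
  linear_combination (1152 * (b : ℂ) ^ 2 * Real.pi * μ) * Complex.I_sq

theorem calQ_eq_saddleIntegral (h : Real.sinh (2 * Real.pi * σ) ^ 2 < Real.exp (2 * Real.pi * μ))
    {b η : ℝ} (hb : 0 < b) (h1 : -(bigQ b / 2) < η) (h2 : η < -(bigQ b / 4))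
    (hsmall : (saddlePoint σ μ).im < -((1 + b ^ 2) / 4)) :
    calQ η b (σ / b) (μ / b) = Complex.exp (fQ σ μ / (b : ℂ) ^ 2) *
      (Complex.exp (3 * Real.pi * Complex.I / 4 - Real.pi * μ + Real.pi * saddlePoint σ μ) *
        (Complex.exp (prefactorCorrection μ b) * saddleIntegral σ μ b)) := by
  have hβ : 0 < b ^ 2 := by positivity
  have hQ : b * bigQ b = 1 + b ^ 2 := by rw [bigQ]; field_simp; ring
  have g1 : -((1 + b ^ 2) / 2) < b * η := by
    have := mul_lt_mul_of_pos_left h1 hb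
    linarith
  have g2 : b * η < -((1 + b ^ 2) / 4) := by
    have := mul_lt_mul_of_pos_left h2 hb
    linarith
  have g3 : -((1 + b ^ 2) / 2) < (saddlePoint σ μ).im := by linarith [(saddlePoint_im h).1]
  rw [calQ_eq hb, integral_scaledIntegrand_eq hβ σ μ g1 g2 g3 hsmall,
    integral_scaledIntegrand_saddlePoint hb, prefactorQ_eq hb, fQ_eq_phase h, ← mul_assoc,
    ← mul_assoc, ← mul_assoc, ← Complex.exp_add, ← Complex.exp_add, ← Complex.exp_add]
  congr 2
  ring

/-- The Gaussian integral contributes `z^{-1/2}` and `e^{πX₀}` contributes `z^{1/2} e^{-πi/2}`, with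
principal logarithms. So `z` drops out and the phase is `3π/4 - π/2`. -/
theorem saddleGaussian_eq (h : Real.sinh (2 * Real.pi * σ) ^ 2 < Real.exp (2 * Real.pi * μ)) :
    Complex.exp (3 * Real.pi * Complex.I / 4 - Real.pi * μ + Real.pi * saddlePoint σ μ) *
      saddleGaussian σ μ = Complex.exp (Real.pi * Complex.I / 4) /
        ((√2 * (Real.exp (2 * Real.pi * μ) - Real.sinh (2 * Real.pi * σ) ^ 2) ^ (1 / 4 : ℝ) : ℝ) : ℂ) := by
  have hpi := Real.pi_pos
  have hpiC : (Real.pi : ℂ) ≠ 0 := by exact_mod_cast hpi.ne'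
  have hd : 0 < disc σ μ := by rw [disc]; linarith
  have hq : 0 < √(disc σ μ) := Real.sqrt_pos.2 hd
  have hz0 := saddle_ne_zero h
  set a : ℂ := ((2 * Real.pi * √(disc σ μ) * Real.exp (-(2 * Real.pi * μ)) : ℝ) : ℂ) * saddle σ μ
    with ha
  have ha2 : phaseDeriv₂ σ (saddlePoint σ μ) / 2 = -a := by
    rw [phaseDeriv₂_saddlePoint h, ha]; push_cast; ring
  have hare : 0 < a.re := by
    rw [ha, Complex.re_ofReal_mul]
    exact mul_pos (by positivity) (saddle_re_pos σ μ)
  have hG : saddleGaussian σ μ = (Real.pi / a) ^ (1 / 2 : ℂ) := by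
    rw [saddleGaussian, ha2]
    exact integral_gaussian_complex hare
  set r : ℝ := Real.exp (2 * Real.pi * μ) / (2 * √(disc σ μ)) with hr
  have hr0 : 0 < r := by positivity
  have hra : (Real.pi : ℂ) / a = (r : ℂ) * (saddle σ μ)⁻¹ := by
    have hqC : (√(disc σ μ) : ℂ) ≠ 0 := by exact_mod_cast hq.ne'
    have hE := Complex.exp_ne_zero (2 * Real.pi * μ)
    rw [ha, hr]
    push_cast
    rw [Complex.exp_neg]
    field_simp
  have hlogr : Real.log r = 2 * Real.pi * μ - Real.log 2 - Real.log (disc σ μ) / 2 := by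
    rw [hr, Real.log_div (Real.exp_pos _).ne' (by positivity), Real.log_exp,
      Real.log_mul two_ne_zero hq.ne', Real.log_sqrt hd.le]
    ring
  have hargz : (saddle σ μ).arg ≠ Real.pi := (arg_mem_Ioo_of_im_pos (saddle_im_pos h)).2.ne
  have hX : Real.pi * saddlePoint σ μ = (Complex.log (saddle σ μ) - Real.pi * Complex.I) / 2 := by
    rw [← log_neg_saddle h, saddlePoint]; field_simp
  have hden : √2 * (disc σ μ) ^ (1 / 4 : ℝ) =
      Real.exp (Real.log 2 / 2 + Real.log (disc σ μ) / 4) := by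
    rw [Real.exp_add, Real.rpow_def_of_pos hd, Real.sqrt_eq_rpow, Real.rpow_def_of_pos two_pos]
    congr 2 <;> ring
  have hdisc : Real.exp (2 * Real.pi * μ) - Real.sinh (2 * Real.pi * σ) ^ 2 = disc σ μ := rfl
  rw [hdisc, hden, hG, hra, Complex.cpow_def_of_ne_zero
    (mul_ne_zero (by exact_mod_cast hr0.ne') (inv_ne_zero hz0)),
    Complex.log_ofReal_mul hr0 (inv_ne_zero hz0), Complex.log_inv _ hargz, hlogr, hX,
    Complex.ofReal_exp, ← Complex.exp_sub, ← Complex.exp_add]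
  congr 1
  push_cast
  ring

theorem isBigO_prefactorCorrection (μ : ℝ) :
    (fun b : ℝ => Complex.exp (prefactorCorrection μ b) - 1) =O[𝓝[>] (0 : ℝ)] fun b : ℝ => b := by
  have hpi := Real.pi_pos
  set C := 7 * Real.pi / 24 + |μ| * comparisonBound 0 with hC
  have hcb := comparisonBound_nonneg 0
  have hC0 : 0 ≤ C := by positivity
  have hbd : ∀ b : ℝ, 0 < b → ‖prefactorCorrection μ b‖ ≤ C * b ^ 2 := by
    intro b hb
    have h := norm_scaled_comparison_le hb (a := 0) (by norm_num) (z := (μ : ℂ)) (by simp)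
    rw [Complex.norm_real, Real.norm_eq_abs] at h
    have h0 : ‖7 * Real.pi * Complex.I / 24 * (b : ℂ) ^ 2‖ = 7 * Real.pi / 24 * b ^ 2 := by
      simp [abs_of_pos hpi, abs_of_pos hb]
    refine (norm_add_le _ _).trans ?_
    rw [h0, hC]
    linarith
  have hO : (fun b : ℝ => prefactorCorrection μ b) =O[𝓝[>] (0 : ℝ)] fun b : ℝ => b := by
    refine Asymptotics.IsBigO.of_bound C ?_
    filter_upwards [Ioc_mem_nhdsGT one_pos] with b hb
    rw [Real.norm_of_nonneg hb.1.le]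
    refine (hbd b hb.1).trans ?_
    have : b ^ 2 ≤ b := by nlinarith [hb.1, hb.2]
    gcongr
  have ht : Tendsto (fun b : ℝ => prefactorCorrection μ b) (𝓝[>] 0) (𝓝 0) :=
    hO.trans_tendsto (tendsto_id.mono_left nhdsWithin_le_nhds)
  have hexp : (fun w : ℂ => Complex.exp w - 1) =O[𝓝 0] fun w : ℂ => w := by
    simpa using (Complex.hasDerivAt_exp 0).isBigO_sub
  exact (hexp.comp_tendsto ht).trans hO

/-- The remainder is defined as a quotient for every `b > 0`, so the exact formula is immediate; the
saddle analysis enters only in the bound for small `b`. -/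
theorem semiclassical_asymptotics
    (h : Real.sinh (2 * Real.pi * σ) ^ 2 < Real.exp (2 * Real.pi * μ)) {η : ℝ → ℝ}
    (hη : ∀ b : ℝ, 0 < b → -(bigQ b / 2) < η b ∧ η b < -(bigQ b / 4)) :
    ∃ r : ℝ → ℂ, r =O[𝓝[>] (0 : ℝ)] (fun b : ℝ => b) ∧ ∀ b : ℝ, 0 < b →
      calQ (η b) b (σ / b) (μ / b) = Complex.exp (Real.pi * Complex.I / 4) /
        ((√2 * (Real.exp (2 * Real.pi * μ) - Real.sinh (2 * Real.pi * σ) ^ 2) ^ (1 / 4 : ℝ) : ℝ) : ℂ) *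
          Complex.exp (fQ σ μ / (b : ℂ) ^ 2) * (1 + r b) := by
  set L : ℂ := Complex.exp (Real.pi * Complex.I / 4) /
    ((√2 * (Real.exp (2 * Real.pi * μ) - Real.sinh (2 * Real.pi * σ) ^ 2) ^ (1 / 4 : ℝ) : ℝ) : ℂ)
    with hL
  have hd : 0 < Real.exp (2 * Real.pi * μ) - Real.sinh (2 * Real.pi * σ) ^ 2 := by linarith
  have hL0 : L ≠ 0 := by
    refine div_ne_zero (Complex.exp_ne_zero _) ?_
    have : 0 < √2 * (Real.exp (2 * Real.pi * μ) - Real.sinh (2 * Real.pi * σ) ^ 2) ^ (1 / 4 : ℝ) := by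
      positivity
    exact_mod_cast this.ne'
  have hGL := saddleGaussian_eq h
  rw [← hL] at hGL
  have hG0 : saddleGaussian σ μ ≠ 0 := fun h0 => hL0 (by rw [← hGL, h0, mul_zero])
  refine ⟨fun b => calQ (η b) b (σ / b) (μ / b) / (L * Complex.exp (fQ σ μ / (b : ℂ) ^ 2)) - 1,
    ?_, fun b _ => ?_⟩
  · obtain ⟨D, b₁, hb₁, hD⟩ := exists_norm_saddleIntegral_sub_le h
    have hint : (fun b : ℝ => saddleIntegral σ μ b / saddleGaussian σ μ - 1) =O[𝓝[>] (0 : ℝ)]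
        fun b : ℝ => b := by
      refine Asymptotics.IsBigO.of_bound (D / ‖saddleGaussian σ μ‖) ?_
      filter_upwards [Ioc_mem_nhdsGT hb₁] with b hb
      have hn : 0 < ‖saddleGaussian σ μ‖ := norm_pos_iff.2 hG0
      rw [div_sub_one hG0, norm_div, Real.norm_of_nonneg hb.1.le, div_mul_eq_mul_div]
      exact div_le_div_of_nonneg_right (hD b hb.1 hb.2) hn.le
    have hpre := isBigO_prefactorCorrection μ
    have hprod : (fun b : ℝ => (Complex.exp (prefactorCorrection μ b) - 1) *
        (saddleIntegral σ μ b / saddleGaussian σ μ - 1)) =O[𝓝[>] (0 : ℝ)] fun b : ℝ => b := by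
      refine (hpre.mul hint).trans (Asymptotics.IsBigO.of_bound 1 ?_)
      filter_upwards [Ioc_mem_nhdsGT one_pos] with b hb
      rw [norm_mul, one_mul]
      refine mul_le_of_le_one_left (norm_nonneg _) ?_
      rw [Real.norm_of_nonneg hb.1.le]; exact hb.2
    -- `uv - 1 = (u - 1) + (v - 1) + (u - 1)(v - 1)`.
    refine ((hpre.add hint).add hprod).congr' ?_ EventuallyEq.rfl
    -- `b² < b₂` says exactly that the saddle point lies below `-(1 + b²)/4`.
    set b₂ := -(4 * (saddlePoint σ μ).im) - 1 with hb₂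
    have hb₂0 : 0 < b₂ := by linarith [(saddlePoint_im h).2]
    filter_upwards [Ioo_mem_nhdsGT (lt_min one_pos hb₂0)] with b hb
    have hb1 : b < 1 := hb.2.trans_le (min_le_left _ _)
    have hb2 : b < b₂ := hb.2.trans_le (min_le_right _ _)
    have hsq : b ^ 2 < b₂ := by nlinarith [hb.1]
    have hQ := calQ_eq_saddleIntegral h hb.1 (hη b hb.1).1 (hη b hb.1).2 (by linarith)
    have he := Complex.exp_ne_zero (fQ σ μ / (b : ℂ) ^ 2)
    have hc := Complex.exp_ne_zero
      (3 * Real.pi * Complex.I / 4 - Real.pi * μ + Real.pi * saddlePoint σ μ)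
    rw [hQ, ← hGL]
    field_simp
    ring
  · have he := Complex.exp_ne_zero (fQ σ μ / (b : ℂ) ^ 2)
    field_simp
    ring

end HyperbolicQ

/-! ### The main theorem -/

theorem theorem2p4 :
    (∀ σ μ : ℝ, Real.sinh (2 * Real.pi * σ) ^ 2 < Real.exp (2 * Real.pi * μ) →
      ∀ h : ℝ → ℝ,
        (∀ b : ℝ, 0 < b → -(HyperbolicQ.bigQ b / 2) < h b ∧ h b < -(HyperbolicQ.bigQ b / 4)) →
        ∃ r : ℝ → ℂ, Asymptotics.IsBigO (𝓝[>] (0 : ℝ)) r (fun b : ℝ => b) ∧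
          ∀ b : ℝ, 0 < b →
            HyperbolicQ.calQ (h b) b (σ / b) (μ / b) =
              Complex.exp (Real.pi * Complex.I / 4) /
                  ((Real.sqrt 2 *
                    (Real.exp (2 * Real.pi * μ) - Real.sinh (2 * Real.pi * σ) ^ 2) ^
                      (1 / 4 : ℝ) : ℝ) : ℂ) *
                Complex.exp (HyperbolicQ.fQ σ μ / (b : ℂ) ^ 2) * (1 + r b)) ∧
    (∃ W : ℂ × ℂ → ℂ, HyperbolicQ.IsPIII3GeneratingFunction W) ∧
    (∀ W : ℂ × ℂ → ℂ, HyperbolicQ.IsPIII3GeneratingFunction W →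
      ∀ σ μ : ℝ, Real.sinh (2 * Real.pi * σ) ^ 2 < Real.exp (2 * Real.pi * μ) →
        (Complex.I * (σ : ℂ), -(μ : ℂ) - Complex.I / 2) ∈ HyperbolicQ.domainW ∧
        HyperbolicQ.fQ σ μ =
          4 * Real.pi * Complex.I * W (Complex.I * (σ : ℂ), -(μ : ℂ) - Complex.I / 2)
            - HyperbolicQ.dilog (-(Real.exp (2 * Real.pi * μ) : ℂ)) / (2 * Real.pi * Complex.I)
            - 2 * Real.pi * Complex.I * (σ : ℂ) ^ 2 + Real.pi * Complex.I / 4) := by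
  refine ⟨fun σ μ h η hη => HyperbolicQ.semiclassical_asymptotics h hη,
    ⟨_, HyperbolicQ.isPIII3GeneratingFunction_principalW⟩, fun W hW σ μ h => ?_⟩
  have hmem := HyperbolicQ.specialPoint_mem_domainW h
  refine ⟨hmem, ?_⟩
  have hE := hW.eqOn_principalW hmem
  rw [HyperbolicQ.specialPoint] at hE
  rw [hE]
  exact HyperbolicQ.fQ_eq_principalW h
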